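/- Let $n\in\mathbb N$, $n\ge 2$, $N=2^{\lfloor (n+1)/2\rfloor}$, and let $\alpha_1,\dots,\alpha_n,\alpha_{n+1}=\beta$ be Hermitian $N\times N$ matrices with $\alpha_j\alpha_k+\alpha_k\alpha_j=2\delta_{j,k}I_N$. Write $\langle x\rangle=(1+|x|^2)^{1/2}$. Let $V\in[L^\infty(\mathbb R^n)]^{N\times N}$ be a.e. self-adjoint with $|V_{\ell,m}(x)|\le C\langle x\rangle^{-2}$ for a.e. $x$ and all $\ell,m$, for some $C\in(0,\infty)$. Let $V=U_V|V|$ be the polar decomposition, $V_1=V_1^*=|V|^{1/2}$ and $V_2=U_V|V|^{1/2}$, so that $V=V_1^*V_2$. Consider the massless Dirac operator $H=H_0+V$, $H_0=\alpha\cdot(-i\nabla)=\sum_{j=1}^n\alpha_j(-i\partial_j)$, $\operatorname{dom}(H)=[W^{1,2}(\mathbb R^n)]^N$, in $[L^2(\mathbb R^n)]^N$. Put $$\big((H_0-(0+i0))^{-1}f\big)(x)=\frac{i}{2}\pi^{-n/2}\Gamma(n/2)\int_{\mathbb R^n}|x-y|^{-n}\,[\alpha\cdot(x-y)]\,f(y)\,d^ny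 ,$$ let $K=V_2(H_0-(0+i0))^{-1}V_1^*$ be the corresponding integral operator in $[L^2(\mathbb R^n)]^N$, and for $\Phi\in\ker(I+K)\subseteq[L^2(\mathbb R^n)]^N$ set $\Psi_\Phi=-(H_0-(0+i0))^{-1}V_1^*\Phi$. A zero-energy eigenfunction of $H$ is a distributional solution $0\ne\Psi\in[W^{1,2}(\mathbb R^n)]^N$ of $H\Psi=0$. A zero-energy resonance function is a function $\Psi=\Psi_\Phi$ with $0\neq\Phi\in\ker(I+K)$ that is a distributional solution of $H\Psi=0$ with $\Psi\notin[L^2(\mathbb R^n)]^N$. The point $0$ is an eigenvalue (resp. a resonance) of $H$ if an eigenfunction (resp. a resonance function) exists, and it is regular if it is neither. **(i)** If $n=2$, exactly one of the following four cases holds: (I) $0$ is regular; (II) $0$ is a resonance and not an eigenvalue; (III) $0$ is an eigenvalue and not a resonance; (IV) $0$ is both. Every resonance function $\Psi$ satisfies $$\Psi\in[L^q(\mathbb R^2)]^2\ \text{ for all } q\in(2,\infty)\cup\{\infty\},\qquad \nabla\Psi\in[L^2(\mathbb R^2)]^{2\times2},\qquad \Psi\notin[L^2(\mathbb R^2)]^2,$$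 and every eigenfunction $\Psi$ satisfies $\Psi\in[L^q(\mathbb R^2)]^2$ for all $q\in[2,\infty)\cup\{\infty\}$. **(ii)** If $n\ge3$, then for every $\Phi\in\ker(I+K)$ the function $\Psi_\Phi$ is a distributional solution of $H\Psi_\Phi=0$ and lies in $[W^{1,2}(\mathbb R^n)]^N$. In particular, there are no zero-energy resonances, and exactly one of two cases holds: (I) $0$ is regular; (II) $0$ is an eigenvalue. Every eigenfunction $\Psi$ satisfies $$\Psi\in[L^q(\mathbb R^n)]^N\ \text{ for all } q\in\begin{cases}(3/2,\infty)\cup\{\infty\},& n=3,\\ (4/3,4),& n=4,\\ \big(2n/(n+2),\,2n/(n-2)\big),& n\ge5.\end{cases}$$ **(iii)** For every $n\ge2$, the point $0$ is regular for $H$ if and only if $\ker(I+K)=\{0\}$. -/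

import Mathlib

open MeasureTheory
open scoped ENNReal ContDiff

namespace MasslessDirac

noncomputable section

/-- The space `ℝⁿ` with its Euclidean norm. -/
abbrev Pos (n : ℕ) : Type := EuclideanSpace ℝ (Fin n)

/-- The size `N = 2^⌊(n+1)/2⌋` of the Dirac matrices. -/
abbrev spinorDim (n : ℕ) : ℕ := 2 ^ ((n + 1) / 2)

/-- The spinor space `ℂᴺ` with its Euclidean norm. -/
abbrev Spinor (n : ℕ) : Type := EuclideanSpace ℂ (Fin (spinorDim n))

/-- Complex `N × N` matrices. -/
abbrev Mat (n : ℕ) : Type := Matrix (Fin (spinorDim n)) (Fin (spinorDim n)) ℂ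

/-- The Hilbert space `[L²(ℝⁿ)]ᴺ`. -/
abbrev L2 (n : ℕ) : Type := Lp (Spinor n) 2 (volume : Measure (Pos n))

/-- `⟨x⟩ = (1 + |x|²)^{1/2}`. -/
def bracket {n : ℕ} (x : Pos n) : ℝ := Real.sqrt (1 + ‖x‖ ^ 2)

/-- `α₁, …, αₙ, αₙ₊₁ = β` are Hermitian with `αⱼ αₖ + αₖ αⱼ = 2 δⱼₖ I_N`. -/
structure IsDiracFamily {n : ℕ} (α : Fin (n + 1) → Mat n) : Prop where
  hermitian : ∀ j, (α j).IsHermitian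
  anticomm : ∀ j k, α j * α k + α k * α j = if j = k then (2 : ℂ) • (1 : Mat n) else 0

/-- The matrix `α · x = ∑_{j=1}^n xⱼ αⱼ`; the last matrix `β` does not enter. -/
def alphaDot {n : ℕ} (α : Fin (n + 1) → Mat n) (x : Pos n) : Mat n :=
  ∑ j : Fin n, (x j : ℂ) • α j.castSucc

/-- A potential `V ∈ [L^∞(ℝⁿ)]^{N × N}` that is self-adjoint almost everywhere and satisfies
`|V_{ℓ,m}(x)| ≤ C ⟨x⟩⁻²` almost everywhere, for some `C > 0`. -/
structure IsAdmissiblePotential {n : ℕ} (V : Pos n → Mat n) : Prop where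
  memLp_top : ∀ l m, MemLp (fun x => V x l m) ∞ volume
  selfAdjoint : ∀ᵐ x, (V x).IsHermitian
  decay : ∃ C : ℝ, 0 < C ∧ ∀ l m, ∀ᵐ x, ‖V x l m‖ ≤ C * (bracket x ^ 2)⁻¹

/-- `|A|^{1/2}` for a Hermitian matrix `A`, by the functional calculus. -/
def sqrtAbs {n : ℕ} (A : Mat n) : Mat n := cfc (fun t : ℝ => Real.sqrt |t|) A

/-- The partial isometry `U = sgn(A)` in the polar decomposition `A = U |A|` of a Hermitian
matrix `A`, by the functional calculus, with `sgn(0) = 0`. -/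
def polarSign {n : ℕ} (A : Mat n) : Mat n := cfc Real.sign A

/-- `V₁ = V₁* = |V|^{1/2}`. -/
def V₁ {n : ℕ} (V : Pos n → Mat n) (x : Pos n) : Mat n := sqrtAbs (V x)

/-- `V₂ = U_V |V|^{1/2}`. -/
def V₂ {n : ℕ} (V : Pos n → Mat n) (x : Pos n) : Mat n := polarSign (V x) * sqrtAbs (V x)

/-- The boundary value at zero energy of the Green's function of the free massless Dirac operator,
`G₀(0 + i0; x, y) = (i/2) π^{-n/2} Γ(n/2) |x - y|^{-n} α · (x - y)`, as a function of `x - y`. -/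
def green {n : ℕ} (α : Fin (n + 1) → Mat n) (x : Pos n) : Mat n :=
  (Complex.I / 2 * ((Real.pi ^ (-(n : ℝ) / 2) * Real.Gamma ((n : ℝ) / 2) * (‖x‖ ^ n)⁻¹ : ℝ) : ℂ)) •
    alphaDot α x

/-- `((H₀ - (0 + i0))⁻¹ f)(x) = ∫ G₀(0 + i0; x, y) f(y) dy`. -/
def freeResolvent {n : ℕ} (α : Fin (n + 1) → Mat n) (f : Pos n → Spinor n) (x : Pos n) :
    Spinor n :=
  ∫ y, Matrix.toEuclideanLin (green α (x - y)) (f y)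

/-- The function `Ψ = -(H₀ - (0 + i0))⁻¹ V₁* Φ` built from `Φ`. -/
def zeroSolution {n : ℕ} (α : Fin (n + 1) → Mat n) (V : Pos n → Mat n) (Φ : Pos n → Spinor n)
    (x : Pos n) : Spinor n :=
  -freeResolvent α (fun y => Matrix.toEuclideanLin (V₁ V y).conjTranspose (Φ y)) x

/-- The zero-energy Birman–Schwinger operator `V₂ (H₀ - (0 + i0))⁻¹ V₁*` as the integral operator
with kernel `V₂(x) G₀(0 + i0; x, y) V₁(y)*`. -/
def birmanSchwinger {n : ℕ} (α : Fin (n + 1) → Mat n) (V : Pos n → Mat n)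
    (Φ : Pos n → Spinor n) (x : Pos n) : Spinor n :=
  Matrix.toEuclideanLin (V₂ V x)
    (freeResolvent α (fun y => Matrix.toEuclideanLin (V₁ V y).conjTranspose (Φ y)) x)

/-- The Birman–Schwinger kernel `ker (I + V₂ (H₀ - (0 + i0))⁻¹ V₁*)` in `[L²(ℝⁿ)]ᴺ`. -/
def bsKernel {n : ℕ} (α : Fin (n + 1) → Mat n) (V : Pos n → Mat n) : Set (L2 n) :=
  {Φ | ∀ᵐ x, Φ x + birmanSchwinger α V Φ x = 0}

/-- The partial derivative `∂ⱼ φ` of a smooth real-valued function. -/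
def partialDeriv {n : ℕ} (j : Fin n) (φ : Pos n → ℝ) (x : Pos n) : ℝ :=
  fderiv ℝ φ x (EuclideanSpace.single j 1)

/-- Test functions: smooth with compact support. -/
structure IsTestFunction {n : ℕ} (φ : Pos n → ℝ) : Prop where
  smooth : ContDiff ℝ ∞ φ
  compact : HasCompactSupport φ

/-- `g` is the weak partial derivative `∂ⱼ Ψ`. -/
structure HasWeakPartialDeriv {n : ℕ} (j : Fin n) (Ψ g : Pos n → Spinor n) : Prop where
  locInt : LocallyIntegrable Ψ volume
  locInt_deriv : LocallyIntegrable g volume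
  integral_eq : ∀ φ : Pos n → ℝ, IsTestFunction φ →
    ∫ x, partialDeriv j φ x • Ψ x = -∫ x, φ x • g x

/-- `∇Ψ ∈ [L²(ℝⁿ)]^{N × n}`, in the weak sense. -/
def GradMemL2 {n : ℕ} (Ψ : Pos n → Spinor n) : Prop :=
  ∀ j, ∃ g : Pos n → Spinor n, HasWeakPartialDeriv j Ψ g ∧ MemLp g 2 volume

/-- `Ψ ∈ [W^{1,2}(ℝⁿ)]ᴺ`, the domain of `H₀` and of `H = H₀ + V`. -/
def MemW12 {n : ℕ} (Ψ : Pos n → Spinor n) : Prop :=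
  MemLp Ψ 2 volume ∧ GradMemL2 Ψ

/-- `Ψ` is a distributional solution of `H Ψ = 0`, where `H = α · (-i∇) + V`: the derivatives in
`∑ⱼ αⱼ (-i ∂ⱼ) Ψ + V Ψ = 0` are moved onto the test function. -/
structure IsZeroSolution {n : ℕ} (α : Fin (n + 1) → Mat n) (V : Pos n → Mat n)
    (Ψ : Pos n → Spinor n) : Prop where
  locInt : LocallyIntegrable Ψ volume
  integral_eq : ∀ φ : Pos n → ℝ, IsTestFunction φ →
    ∫ x, ((∑ j : Fin n,
        (Complex.I * (partialDeriv j φ x : ℂ)) • Matrix.toEuclideanLin (α j.castSucc) (Ψ x))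
      + φ x • Matrix.toEuclideanLin (V x) (Ψ x)) = 0

/-- `Ψ` is a zero-energy eigenfunction of `H`: a nonzero distributional solution of `H Ψ = 0` in
`dom(H) = [W^{1,2}(ℝⁿ)]ᴺ`. -/
structure IsZeroEigenfunction {n : ℕ} (α : Fin (n + 1) → Mat n) (V : Pos n → Mat n)
    (Ψ : Pos n → Spinor n) : Prop where
  mem_dom : MemW12 Ψ
  solution : IsZeroSolution α V Ψ
  ne_zero : ¬ Ψ =ᵐ[volume] 0

/-- `Ψ` is a zero-energy resonance function of `H`: it is built from some nonzero element of the
Birman–Schwinger kernel, solves `H Ψ = 0` as a distribution, and is not square integrable. -/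
structure IsResonanceFunction {n : ℕ} (α : Fin (n + 1) → Mat n) (V : Pos n → Mat n)
    (Ψ : Pos n → Spinor n) : Prop where
  built : ∃ Φ ∈ bsKernel α V, Φ ≠ 0 ∧ Ψ =ᵐ[volume] zeroSolution α V Φ
  solution : IsZeroSolution α V Ψ
  not_memLp : ¬ MemLp Ψ 2 volume

/-- `0` is a zero-energy eigenvalue of `H`. -/
def IsZeroEigenvalue {n : ℕ} (α : Fin (n + 1) → Mat n) (V : Pos n → Mat n) : Prop :=
  ∃ Ψ, IsZeroEigenfunction α V Ψ

/-- `0` is a zero-energy resonance of `H`. -/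
def IsZeroResonance {n : ℕ} (α : Fin (n + 1) → Mat n) (V : Pos n → Mat n) : Prop :=
  ∃ Ψ, IsResonanceFunction α V Ψ

/-- `0` is a regular point for `H`. -/
def IsRegular {n : ℕ} (α : Fin (n + 1) → Mat n) (V : Pos n → Mat n) : Prop :=
  ¬ IsZeroEigenvalue α V ∧ ¬ IsZeroResonance α V

end

end MasslessDirac

/-!
The zero-energy theory of the massless Dirac operator `H = α · (-i∇) + V` rests on the vector field
`x / |x|ⁿ`: it is curl free, and its divergence is the surface area `ω` of the unit sphere times the
delta distribution. For a real test function `φ`, the vector potential `w_j = φ ⋆ (x_j / |x|ⁿ)`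
(`gradPotential`) is therefore smooth, satisfies `∂_l w_j = ∂_j w_l` and `∑_j ∂_j w_j = ω φ`, and
decays like `|x|^{-(n-1)}`. Moreover `‖∂_l w_j‖₂ ≤ ω ‖φ‖₂`, since the `L²` norm of a gradient is
controlled by divergence and curl. Up to the factor `i / ω`, the Green's function of `α · (-i∇)` is
`∑_j α_j x_j / |x|ⁿ`, so by Fubini's theorem and the Clifford relations every statement about
`G f = (H₀ - (0 + i0))⁻¹ f` in the sense of distributions becomes one about the `w_j`:

* `Ψ = -G f` solves `H₀ Ψ = -f` (`IsDiracFamily.sum_integral_freeResolvent`);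
* `G f` has a weak gradient in `L²` whenever `(1 + |x|) f ∈ L²`
  (`WeightedL2.gradMemL2_freeResolvent`): the map `φ ↦ ∂_l w_j` is bounded in `L²`, and its
  transpose applied to `f` is the gradient;
* a square-integrable solution of `H Ψ = 0` equals `-G (V Ψ)`
  (`IsZeroSolution.ae_eq_freeResolvent`): by cutting off, the equation may be tested with the `w_j`.

The polar decomposition gives `V = V₁* V₂`, with both factors of decay `|x|⁻¹`. Hence `Φ ↦ Ψ_Φ` and
`Ψ ↦ V₂ Ψ` are inverse to each other between the Birman–Schwinger kernel and the zero-energy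
solutions, which are eigenfunctions or resonance functions according as they are square integrable
or not; this is the equivalence of regularity with the triviality of the kernel (`isRegular_iff`).

The integrability statements follow from the bound of `|G f|` by the Riesz potential of order one of
`|f|`. After the kernel `|x|^{-(n-1)}` is split at `|x| = 1`, Young's inequality shows that this
potential lowers a reciprocal exponent by `1/n`, up to an arbitrarily small amount in either
direction (`memLp_of_le_rieszPotential`). Multiplication by `V` (by `V₁`) raises the reciprocal
exponent by less than `2/n` (by less than `1/n`), by Hölder's inequality. So `Φ ∈ L²` gives `Ψ_Φ` in
all spaces with reciprocal exponent in `(1/2 - 1/n, 1/2)`. As `V₁* Φ = V Ψ_Φ`, a second pass, now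
with the decay of `V`, reaches `L²`, provided that the intermediate exponent is at least one, which
is the condition `n ≥ 3`; this is why resonances occur only for `n = 2`. The same two steps give the
ranges of exponents in the theorem.
-/

namespace MasslessDirac

noncomputable section

open Filter Topology

variable {n : ℕ}

/-! ### Test functions -/

lemma IsTestFunction.continuous {φ : Pos n → ℝ} (hφ : IsTestFunction φ) : Continuous φ :=
  hφ.smooth.continuous

lemma IsTestFunction.differentiable {φ : Pos n → ℝ} (hφ : IsTestFunction φ) :
    Differentiable ℝ φ :=
  hφ.smooth.differentiable (by simp)

lemma IsTestFunction.partialDeriv {φ : Pos n → ℝ} (hφ : IsTestFunction φ) (j : Fin n) :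
    IsTestFunction (partialDeriv j φ) := by
  refine ⟨?_, ?_⟩
  · exact (hφ.smooth.fderiv_right (m := ∞) (by simp)).clm_apply contDiff_const
  · exact hφ.compact.fderiv_apply (𝕜 := ℝ) _

lemma IsTestFunction.mul {φ χ : Pos n → ℝ} (hφ : IsTestFunction φ) (hχ : ContDiff ℝ ∞ χ) :
    IsTestFunction (fun x => φ x * χ x) :=
  ⟨hφ.smooth.mul hχ, hφ.compact.mul_right⟩

lemma IsTestFunction.integrable {φ : Pos n → ℝ} (hφ : IsTestFunction φ) :
    Integrable φ volume :=
  hφ.continuous.integrable_of_hasCompactSupport hφ.compact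

lemma IsTestFunction.exists_bound {φ : Pos n → ℝ} (hφ : IsTestFunction φ) :
    ∃ M R : ℝ, 0 ≤ M ∧ 0 < R ∧ (∀ x, |φ x| ≤ M) ∧ ∀ x, R ≤ ‖x‖ → φ x = 0 := by
  obtain ⟨M, hM⟩ := hφ.compact.exists_bound_of_continuous hφ.continuous
  obtain ⟨R, hR0, hR⟩ := hφ.compact.exists_pos_le_norm
  exact ⟨M, R, (norm_nonneg _).trans (hM 0), hR0, hM, hR⟩

/-! ### The vector kernel `x / |x|ⁿ` -/

/-- The `j`-th component of the vector field `x / |x|ⁿ`, which is, up to a constant, the gradient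
of the Newtonian potential. At the origin its value is `0`. -/
def gradNewton (j : Fin n) (x : Pos n) : ℝ := x j * (‖x‖ ^ n)⁻¹

/-- The kernel `|x|^{-(n-1)}` of the Riesz potential of order one; for `n ≥ 2` its value at the
origin is `0`. -/
def rieszKernel (x : Pos n) : ℝ := (‖x‖ ^ (n - 1))⁻¹

lemma rieszKernel_nonneg (x : Pos n) : 0 ≤ rieszKernel x := by unfold rieszKernel; positivity

lemma rieszKernel_neg (x : Pos n) : rieszKernel (-x) = rieszKernel x := by simp [rieszKernel]

lemma abs_coord_le_norm (x : Pos n) (j : Fin n) : |x j| ≤ ‖x‖ := by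
  simpa using PiLp.norm_apply_le x j

lemma norm_mul_inv_pow (hn : 2 ≤ n) (x : Pos n) : ‖x‖ * (‖x‖ ^ n)⁻¹ = rieszKernel x := by
  unfold rieszKernel
  rcases eq_or_ne ‖x‖ 0 with h | h
  · rw [h, zero_mul, zero_pow (by omega), inv_zero]
  · obtain ⟨m, rfl⟩ : ∃ m, n = m + 1 := ⟨n - 1, by omega⟩
    rw [Nat.add_sub_cancel, pow_succ]
    field_simp

lemma abs_gradNewton_le (hn : 2 ≤ n) (j : Fin n) (x : Pos n) :
    |gradNewton j x| ≤ rieszKernel x := by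
  rw [gradNewton, abs_mul, abs_of_nonneg (a := (‖x‖ ^ n)⁻¹) (by positivity),
    ← norm_mul_inv_pow hn]
  gcongr
  exact abs_coord_le_norm x j

lemma gradNewton_neg (j : Fin n) (x : Pos n) : gradNewton j (-x) = -gradNewton j x := by
  simp [gradNewton]

lemma measurable_coord (j : Fin n) : Measurable fun x : Pos n => x j :=
  Continuous.measurable (by fun_prop)

@[fun_prop]
lemma measurable_gradNewton (j : Fin n) : Measurable (gradNewton j : Pos n → ℝ) := by
  unfold gradNewton
  exact (measurable_coord j).mul (by fun_prop)

@[fun_prop]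
lemma measurable_rieszKernel : Measurable (rieszKernel : Pos n → ℝ) := by
  unfold rieszKernel
  fun_prop

lemma rieszKernel_eq_rpow (hn : 2 ≤ n) (x : Pos n) :
    rieszKernel x = ‖x‖ ^ (-((n : ℝ) - 1)) := by
  rw [rieszKernel, Real.rpow_neg (norm_nonneg _), ← Nat.cast_pred (by omega), Real.rpow_natCast]

/-- `|x|^{-s}` is integrable near the origin for `s < n`. -/
lemma integrableOn_ball_norm_rpow (hn : 2 ≤ n) {s : ℝ} (hs : s < n) {R : ℝ} (hR : 0 < R) :
    IntegrableOn (fun x : Pos n => ‖x‖ ^ (-s)) (Metric.ball 0 R) volume := by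
  have : Nonempty (Fin n) := ⟨⟨0, by omega⟩⟩
  have h := (integrable_fun_norm_addHaar (volume : Measure (Pos n))
    (f := Set.indicator (Set.Iio R) fun t : ℝ => t ^ (-s))).2 ?_
  · rw [← integrable_indicator_iff Metric.isOpen_ball.measurableSet]
    refine h.congr (Eventually.of_forall fun x => ?_)
    simp only [Set.indicator, Metric.mem_ball, dist_zero_right, Set.mem_Iio]
  · rw [finrank_euclideanSpace_fin]
    have h1 : IntegrableOn (fun t : ℝ => t ^ ((n : ℝ) - 1 - s)) (Set.Ioo 0 R) volume :=
      (intervalIntegral.integrableOn_Ioo_rpow_iff hR).2 (by linarith)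
    have h2 : IntegrableOn (Set.indicator (Set.Iio R) fun t : ℝ => t ^ ((n : ℝ) - 1 - s))
        (Set.Ioi 0) volume := by
      rwa [integrableOn_indicator_iff measurableSet_Iio, Set.inter_comm, Set.Ioi_inter_Iio]
    refine h2.congr_fun (fun t ht => ?_) measurableSet_Ioi
    have ht : 0 < t := ht
    by_cases htR : t < R
    · simp only [Set.indicator, Set.mem_Iio, htR, if_true, smul_eq_mul]
      rw [← Real.rpow_natCast t (n - 1), Nat.cast_pred (by omega), ← Real.rpow_add ht]
      ring_nf
    · simp [Set.indicator, htR]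

lemma locallyIntegrable_rieszKernel (hn : 2 ≤ n) :
    LocallyIntegrable (rieszKernel : Pos n → ℝ) volume := by
  intro x
  refine ⟨Metric.ball 0 (‖x‖ + 1), Metric.isOpen_ball.mem_nhds (by simp), ?_⟩
  have h := integrableOn_ball_norm_rpow hn (s := (n : ℝ) - 1) (by linarith)
    (R := ‖x‖ + 1) (by positivity)
  exact h.congr_fun (fun y _ => (rieszKernel_eq_rpow hn y).symm) Metric.isOpen_ball.measurableSet

lemma locallyIntegrable_gradNewton (hn : 2 ≤ n) (j : Fin n) :
    LocallyIntegrable (gradNewton j : Pos n → ℝ) volume :=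
  (locallyIntegrable_rieszKernel hn).mono (measurable_gradNewton j).aestronglyMeasurable
    (Eventually.of_forall fun x => by
      rw [Real.norm_eq_abs, Real.norm_eq_abs, abs_of_nonneg (rieszKernel_nonneg x)]
      exact abs_gradNewton_le hn j x)

lemma IsTestFunction.integrable_mul {φ : Pos n → ℝ} (hφ : IsTestFunction φ) {k : Pos n → ℝ}
    (hk : LocallyIntegrable k volume) : Integrable (fun x => φ x * k x) volume := by
  simpa using hk.integrable_smul_left_of_hasCompactSupport hφ.continuous hφ.compact

/-! ### Divergence and curl of the kernel -/

lemma sq_rpow_neg_half (n : ℕ) {t : ℝ} (ht : 0 ≤ t) :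
    (t ^ 2) ^ (-((n : ℝ) / 2)) = (t ^ n)⁻¹ := by
  rw [Real.rpow_neg (by positivity), ← Real.rpow_natCast t 2, ← Real.rpow_mul ht]
  push_cast
  rw [mul_div_cancel₀ _ (two_ne_zero' ℝ), Real.rpow_natCast]

/-- The smooth regularisation `x_j (|x|² + ε)^{-n/2}` of `gradNewton`. -/
def gradNewtonReg (ε : ℝ) (j : Fin n) (x : Pos n) : ℝ :=
  x j * (‖x‖ ^ 2 + ε) ^ (-((n : ℝ) / 2))

lemma hasFDerivAt_gradNewtonReg {ε : ℝ} (hε : 0 < ε) (j : Fin n) (x : Pos n) :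
    HasFDerivAt (gradNewtonReg ε j)
      (x j • ((-((n : ℝ) / 2) * (‖x‖ ^ 2 + ε) ^ (-((n : ℝ) / 2) - 1)) • (2 • innerSL ℝ x))
        + (‖x‖ ^ 2 + ε) ^ (-((n : ℝ) / 2)) • (EuclideanSpace.proj j : Pos n →L[ℝ] ℝ)) x := by
  have h1 : HasFDerivAt (fun x : Pos n => x j) (EuclideanSpace.proj j : Pos n →L[ℝ] ℝ) x :=
    (EuclideanSpace.proj j : Pos n →L[ℝ] ℝ).hasFDerivAt
  have h2 : HasFDerivAt (fun x : Pos n => ‖x‖ ^ 2 + ε) (2 • innerSL ℝ x) x :=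
    (hasStrictFDerivAt_norm_sq x).hasFDerivAt.add_const ε
  have h3 := h2.rpow_const (p := -((n : ℝ) / 2)) (Or.inl (by positivity))
  exact h1.mul h3

lemma partialDeriv_gradNewtonReg {ε : ℝ} (hε : 0 < ε) (j l : Fin n) (x : Pos n) :
    partialDeriv l (gradNewtonReg ε j) x
      = (if l = j then 1 else 0) * (‖x‖ ^ 2 + ε) ^ (-((n : ℝ) / 2))
        - n * (x j * x l) * (‖x‖ ^ 2 + ε) ^ (-((n : ℝ) / 2) - 1) := by
  have hinner : inner ℝ x (EuclideanSpace.single l 1) = x l := by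
    rw [real_inner_comm]
    simp [EuclideanSpace.inner_single_left]
  rw [partialDeriv, (hasFDerivAt_gradNewtonReg hε j x).fderiv]
  simp [hinner, eq_comm (a := j)]
  ring

lemma contDiff_gradNewtonReg {ε : ℝ} (hε : 0 < ε) (j : Fin n) :
    ContDiff ℝ ∞ (gradNewtonReg ε j : Pos n → ℝ) := by
  unfold gradNewtonReg
  refine ContDiff.mul (EuclideanSpace.proj j : Pos n →L[ℝ] ℝ).contDiff ?_
  refine ContDiff.rpow_const_of_ne (((contDiff_norm_sq ℝ).add contDiff_const)) fun x => ?_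
  positivity

lemma integral_partialDeriv_mul {φ χ : Pos n → ℝ} (hφ : IsTestFunction φ)
    (hχ : ContDiff ℝ ∞ χ) (l : Fin n) :
    ∫ x, partialDeriv l φ x * χ x = -∫ x, φ x * partialDeriv l χ x := by
  have hχ' : ContDiff ℝ ∞ (partialDeriv l χ) :=
    (hχ.fderiv_right (m := ∞) (by simp)).clm_apply contDiff_const
  have h := integral_mul_fderiv_eq_neg_fderiv_mul_of_integrable (μ := (volume : Measure (Pos n)))
    (f := φ) (g := χ) (v := EuclideanSpace.single l 1)
    ((hφ.partialDeriv l).mul hχ).integrable (hφ.mul hχ').integrable (hφ.mul hχ).integrable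
    (fun x _ => hφ.differentiable x) (fun x _ => hχ.differentiable (by simp) x)
  unfold MasslessDirac.partialDeriv
  rw [h, neg_neg]

lemma abs_gradNewtonReg_le (hn : 2 ≤ n) {ε : ℝ} (hε : 0 < ε) (j : Fin n) (x : Pos n) :
    |gradNewtonReg ε j x| ≤ rieszKernel x := by
  rcases eq_or_ne x 0 with rfl | hx
  · simpa [gradNewtonReg] using rieszKernel_nonneg _
  · have hx' : 0 < ‖x‖ := norm_pos_iff.2 hx
    rw [gradNewtonReg, abs_mul, abs_of_nonneg (a := (_ : ℝ) ^ (_ : ℝ)) (by positivity),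
      ← norm_mul_inv_pow hn]
    have : (‖x‖ ^ 2 + ε) ^ (-((n : ℝ) / 2)) ≤ (‖x‖ ^ n)⁻¹ := by
      calc (‖x‖ ^ 2 + ε) ^ (-((n : ℝ) / 2)) ≤ (‖x‖ ^ 2) ^ (-((n : ℝ) / 2)) :=
            Real.rpow_le_rpow_of_nonpos (by positivity) (by linarith)
              (by have : (0 : ℝ) ≤ n := by positivity
                  linarith)
        _ = (‖x‖ ^ n)⁻¹ := sq_rpow_neg_half n hx'.le
    gcongr
    exact abs_coord_le_norm x j

lemma tendsto_gradNewtonReg (j : Fin n) (x : Pos n) {δ : ℕ → ℝ}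
    (hδ : Tendsto δ atTop (𝓝 0)) :
    Tendsto (fun m => gradNewtonReg (δ m) j x) atTop (𝓝 (gradNewton j x)) := by
  rcases eq_or_ne x 0 with rfl | hx
  · simp [gradNewtonReg, gradNewton]
  · have hx' : 0 < ‖x‖ := norm_pos_iff.2 hx
    have h1 : (‖x‖ ^ n)⁻¹ = (‖x‖ ^ 2 + 0) ^ (-((n : ℝ) / 2)) := by
      rw [add_zero, sq_rpow_neg_half n hx'.le]
    rw [gradNewton, h1]
    refine Tendsto.const_mul _ ?_
    exact (tendsto_const_nhds.add hδ).rpow_const (Or.inl (by positivity))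

lemma tendsto_integral_mul_gradNewtonReg (hn : 2 ≤ n) {φ : Pos n → ℝ} (hφ : IsTestFunction φ)
    (j : Fin n) {δ : ℕ → ℝ} (hδ0 : ∀ m, 0 < δ m) (hδ : Tendsto δ atTop (𝓝 0)) :
    Tendsto (fun m => ∫ x, φ x * gradNewtonReg (δ m) j x) atTop
      (𝓝 (∫ x, φ x * gradNewton j x)) := by
  refine tendsto_integral_of_dominated_convergence (fun x => |φ x * rieszKernel x|) ?_ ?_ ?_ ?_
  · intro m
    exact (hφ.mul (contDiff_gradNewtonReg (hδ0 m) j)).continuous.aestronglyMeasurable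
  · exact (hφ.integrable_mul (locallyIntegrable_rieszKernel hn)).abs
  · intro m
    refine Eventually.of_forall fun x => ?_
    rw [Real.norm_eq_abs, abs_mul, abs_mul, abs_of_nonneg (rieszKernel_nonneg x)]
    gcongr
    exact abs_gradNewtonReg_le hn (hδ0 m) j x
  · exact Eventually.of_forall fun x => (tendsto_gradNewtonReg j x hδ).const_mul _

lemma tendsto_one_div_succ_sq : Tendsto (fun m : ℕ => (1 / ((m : ℝ) + 1)) ^ 2) atTop (𝓝 0) := by
  simpa using (tendsto_one_div_add_atTop_nhds_zero_nat (𝕜 := ℝ)).pow 2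

/-- The vector field `x / |x|ⁿ` is curl free in the sense of distributions. -/
lemma integral_partialDeriv_mul_gradNewton_symm (hn : 2 ≤ n) {φ : Pos n → ℝ}
    (hφ : IsTestFunction φ) (j l : Fin n) :
    ∫ x, partialDeriv l φ x * gradNewton j x = ∫ x, partialDeriv j φ x * gradNewton l x := by
  have h0 : ∀ m : ℕ, 0 < (1 / ((m : ℝ) + 1)) ^ 2 := fun m => by positivity
  refine tendsto_nhds_unique (tendsto_integral_mul_gradNewtonReg hn (hφ.partialDeriv l) j h0
    tendsto_one_div_succ_sq) ?_
  refine (tendsto_integral_mul_gradNewtonReg hn (hφ.partialDeriv j) l h0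
    tendsto_one_div_succ_sq).congr fun m => ?_
  rw [integral_partialDeriv_mul hφ (contDiff_gradNewtonReg (h0 m) l),
    integral_partialDeriv_mul hφ (contDiff_gradNewtonReg (h0 m) j)]
  congr 2
  ext x
  rw [partialDeriv_gradNewtonReg (h0 m), partialDeriv_gradNewtonReg (h0 m)]
  simp only [eq_comm (a := l) (b := j), mul_comm (x j) (x l)]

/-- The surface area of the unit sphere in `ℝⁿ`, as `n` times the volume of the unit ball. -/
def sphereArea (n : ℕ) : ℝ := n * (volume : Measure (Pos n)).real (Metric.ball 0 1)

lemma sphereArea_eq (hn : 2 ≤ n) :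
    sphereArea n = 2 * Real.pi ^ ((n : ℝ) / 2) / Real.Gamma ((n : ℝ) / 2) := by
  have : Nonempty (Fin n) := ⟨⟨0, by omega⟩⟩
  have hn0 : (0 : ℝ) < n := by exact_mod_cast (by omega : 0 < n)
  have hG := Real.Gamma_pos_of_pos (half_pos hn0)
  rw [sphereArea, Measure.real, EuclideanSpace.volume_ball, Fintype.card_fin, ENNReal.ofReal_one,
    one_pow, one_mul, ENNReal.toReal_ofReal (by
      have := Real.Gamma_pos_of_pos (s := (n : ℝ) / 2 + 1) (by positivity)
      positivity), Real.Gamma_add_one (by positivity), Real.sqrt_eq_rpow, ← Real.rpow_natCast,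
    ← Real.rpow_mul Real.pi_pos.le]
  field_simp

lemma integral_radial_profile (hn : 2 ≤ n) :
    ∫ t in Set.Ioi (0 : ℝ), t ^ (n - 1) • (n * (1 + t ^ 2) ^ (-((n : ℝ) / 2) - 1)) = 1 := by
  have hn0 : (0 : ℝ) < n := by exact_mod_cast (by omega : 0 < n)
  have hderiv : ∀ t ∈ Set.Ici (0 : ℝ), HasDerivAt
      (fun t : ℝ => t ^ n * (1 + t ^ 2) ^ (-((n : ℝ) / 2)))
      (t ^ (n - 1) • (n * (1 + t ^ 2) ^ (-((n : ℝ) / 2) - 1))) t := by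
    intro t _
    have hp : 0 < 1 + t ^ 2 := by positivity
    have h1 : HasDerivAt (fun t : ℝ => 1 + t ^ 2) (2 * t) t := by
      simpa using (hasDerivAt_pow 2 t).const_add 1
    have h2 := (hasDerivAt_pow n t).mul (h1.rpow_const (p := -((n : ℝ) / 2)) (Or.inl hp.ne'))
    have h3 : (1 + t ^ 2) ^ (-((n : ℝ) / 2))
        = (1 + t ^ 2) * (1 + t ^ 2) ^ (-((n : ℝ) / 2) - 1) := by
      rw [Real.rpow_sub_one hp.ne']
      field_simp
    refine h2.congr_deriv ?_
    rw [h3]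
    obtain ⟨m, rfl⟩ : ∃ m, n = m + 1 := ⟨n - 1, by omega⟩
    simp only [Nat.add_sub_cancel, smul_eq_mul]
    ring
  have hlim : Tendsto (fun t : ℝ => t ^ n * (1 + t ^ 2) ^ (-((n : ℝ) / 2))) atTop (𝓝 1) := by
    have h1 : Tendsto (fun t : ℝ => ((t ^ 2)⁻¹ + 1) ^ (-((n : ℝ) / 2))) atTop
        (𝓝 ((0 + 1) ^ (-((n : ℝ) / 2)))) :=
      ((tendsto_inv_atTop_zero.comp (tendsto_pow_atTop (two_ne_zero))).add_const 1).rpow_const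
        (Or.inl (by norm_num))
    rw [zero_add, Real.one_rpow] at h1
    refine h1.congr' ?_
    filter_upwards [eventually_gt_atTop 0] with t ht
    have : 1 + t ^ 2 = t ^ 2 * ((t ^ 2)⁻¹ + 1) := by field_simp
    rw [this, Real.mul_rpow (by positivity) (by positivity), ← mul_assoc,
      sq_rpow_neg_half n ht.le, mul_inv_cancel₀ (by positivity), one_mul]
  have := integral_Ioi_of_hasDerivAt_of_nonneg' hderiv
    (fun t ht => by have : (0 : ℝ) < t := ht
                    positivity) hlim
  rw [this]
  simp [show n ≠ 0 by omega]

lemma integral_divergence_profile (hn : 2 ≤ n) :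
    ∫ y : Pos n, n * (1 + ‖y‖ ^ 2) ^ (-((n : ℝ) / 2) - 1) = sphereArea n := by
  have : Nonempty (Fin n) := ⟨⟨0, by omega⟩⟩
  rw [integral_fun_norm_addHaar (volume : Measure (Pos n))
    (fun t : ℝ => (n : ℝ) * (1 + t ^ 2) ^ (-((n : ℝ) / 2) - 1)), finrank_euclideanSpace_fin,
    integral_radial_profile hn, sphereArea]
  simp

lemma sphereArea_pos (hn : 2 ≤ n) : 0 < sphereArea n := by
  rw [sphereArea_eq hn]
  have hn0 : (0 : ℝ) < n := by exact_mod_cast (by omega : 0 < n)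
  have := Real.Gamma_pos_of_pos (half_pos hn0)
  have := Real.pi_pos
  positivity

lemma integrable_divergence_profile (hn : 2 ≤ n) :
    Integrable (fun y : Pos n => n * (1 + ‖y‖ ^ 2) ^ (-((n : ℝ) / 2) - 1)) volume :=
  Integrable.of_integral_ne_zero (by
    rw [integral_divergence_profile hn]
    exact (sphereArea_pos hn).ne')

lemma sum_partialDeriv_gradNewtonReg {ε : ℝ} (hε : 0 < ε) (x : Pos n) :
    ∑ j, partialDeriv j (gradNewtonReg ε j) x
      = n * ε * (‖x‖ ^ 2 + ε) ^ (-((n : ℝ) / 2) - 1) := by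
  have hp : 0 < ‖x‖ ^ 2 + ε := by positivity
  simp only [partialDeriv_gradNewtonReg hε, if_true, one_mul]
  rw [Finset.sum_sub_distrib, ← Finset.sum_mul, ← Finset.mul_sum]
  have h1 : ∑ j, x j * x j = ‖x‖ ^ 2 := by
    rw [EuclideanSpace.norm_sq_eq]
    simp [sq]
  have h2 : (‖x‖ ^ 2 + ε) ^ (-((n : ℝ) / 2))
      = (‖x‖ ^ 2 + ε) * (‖x‖ ^ 2 + ε) ^ (-((n : ℝ) / 2) - 1) := by
    rw [Real.rpow_sub_one hp.ne']
    field_simp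
  rw [h1, h2]
  simp
  ring

/-- Rescaling by `δ` turns the divergence of the regularised kernel into an approximate
identity. -/
lemma integral_mul_divergence_reg (φ : Pos n → ℝ) {δ : ℝ} (hδ : 0 < δ) :
    ∫ x : Pos n, φ x * (n * δ ^ 2 * (‖x‖ ^ 2 + δ ^ 2) ^ (-((n : ℝ) / 2) - 1))
      = ∫ y : Pos n, φ (δ • y) * (n * (1 + ‖y‖ ^ 2) ^ (-((n : ℝ) / 2) - 1)) := by
  have h := Measure.integral_comp_smul (volume : Measure (Pos n))
    (fun x => φ x * (n * δ ^ 2 * (‖x‖ ^ 2 + δ ^ 2) ^ (-((n : ℝ) / 2) - 1))) δ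
  rw [finrank_euclideanSpace_fin, abs_of_nonneg (by positivity), smul_eq_mul,
    eq_inv_mul_iff_mul_eq₀ (by positivity), ← integral_const_mul] at h
  rw [← h]
  congr 1
  ext y
  have h1 : ‖δ • y‖ ^ 2 + δ ^ 2 = δ ^ 2 * (1 + ‖y‖ ^ 2) := by
    rw [norm_smul, Real.norm_eq_abs, mul_pow, sq_abs]
    ring
  have h2 : (δ ^ 2) ^ (-((n : ℝ) / 2) - 1) = (δ ^ n)⁻¹ * (δ ^ 2)⁻¹ := by
    rw [← Real.rpow_natCast δ 2, ← Real.rpow_mul hδ.le, ← Real.rpow_natCast δ n,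
      ← Real.rpow_neg hδ.le, ← Real.rpow_neg hδ.le, ← Real.rpow_add hδ]
    congr 1
    push_cast
    ring
  rw [h1, Real.mul_rpow (by positivity) (by positivity), h2]
  field_simp

/-- `x / |x|ⁿ` is a fundamental solution of the divergence operator, up to the factor
`sphereArea n`. -/
lemma integral_sum_partialDeriv_mul_gradNewton (hn : 2 ≤ n) {φ : Pos n → ℝ}
    (hφ : IsTestFunction φ) :
    ∑ j, ∫ x, partialDeriv j φ x * gradNewton j x = -(sphereArea n * φ 0) := by
  have h0 : ∀ m : ℕ, 0 < (1 / ((m : ℝ) + 1)) ^ 2 := fun m => by positivity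
  refine tendsto_nhds_unique (tendsto_finsetSum _ fun j _ =>
    tendsto_integral_mul_gradNewtonReg hn (hφ.partialDeriv j) j h0 tendsto_one_div_succ_sq) ?_
  have h1 : ∀ m : ℕ, ∑ j, ∫ x, partialDeriv j φ x * gradNewtonReg ((1 / ((m : ℝ) + 1)) ^ 2) j x
      = -∫ y : Pos n, φ ((1 / ((m : ℝ) + 1)) • y)
          * (n * (1 + ‖y‖ ^ 2) ^ (-((n : ℝ) / 2) - 1)) := by
    intro m
    have hC : ∀ j : Fin n,
        ContDiff ℝ ∞ (partialDeriv j (gradNewtonReg ((1 / ((m : ℝ) + 1)) ^ 2) j)) := fun j =>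
      ((contDiff_gradNewtonReg (h0 m) j).fderiv_right (m := ∞) (by simp)).clm_apply contDiff_const
    rw [← integral_mul_divergence_reg φ (by positivity)]
    simp only [integral_partialDeriv_mul hφ (contDiff_gradNewtonReg (h0 m) _)]
    rw [Finset.sum_neg_distrib, ← integral_finsetSum _ fun j _ => (hφ.mul (hC j)).integrable]
    congr 2
    ext x
    rw [← Finset.mul_sum, sum_partialDeriv_gradNewtonReg (h0 m)]
  simp only [h1]
  refine Tendsto.neg ?_
  have h2 : sphereArea n * φ 0
      = ∫ y : Pos n, φ 0 * (n * (1 + ‖y‖ ^ 2) ^ (-((n : ℝ) / 2) - 1)) := by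
    rw [integral_const_mul, integral_divergence_profile hn, mul_comm]
  rw [h2]
  obtain ⟨M, R, hM0, -, hM, -⟩ := hφ.exists_bound
  refine tendsto_integral_of_dominated_convergence
    (fun y => M * |n * (1 + ‖y‖ ^ 2) ^ (-((n : ℝ) / 2) - 1)|) ?_ ?_ ?_ ?_
  · intro m
    exact ((hφ.continuous.comp (by fun_prop)).aestronglyMeasurable).mul
      (integrable_divergence_profile hn).aestronglyMeasurable
  · exact (integrable_divergence_profile hn).abs.const_mul M
  · intro m
    refine Eventually.of_forall fun y => ?_
    rw [norm_mul, Real.norm_eq_abs, Real.norm_eq_abs]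
    gcongr
    exact hM _
  · refine Eventually.of_forall fun y => ?_
    refine Tendsto.mul_const _ ?_
    have h3 : Tendsto (fun m : ℕ => (1 / ((m : ℝ) + 1)) • y) atTop (𝓝 0) := by
      simpa using (tendsto_one_div_add_atTop_nhds_zero_nat (𝕜 := ℝ)).smul_const y
    exact (hφ.continuous.tendsto 0).comp h3

/-! ### Potentials of test functions -/

/-- The convolution `φ ⋆ (x_j / |x|ⁿ)`. -/
def gradPotential (φ : Pos n → ℝ) (j : Fin n) (x : Pos n) : ℝ :=
  ∫ y, φ y * gradNewton j (x - y)

lemma gradPotential_eq_convolution (φ : Pos n → ℝ) (j : Fin n) :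
    gradPotential φ j
      = convolution φ (gradNewton j) (ContinuousLinearMap.mul ℝ ℝ) volume := by
  ext x
  simp [gradPotential, convolution_def]

lemma gradPotential_eq_integral_sub (φ : Pos n → ℝ) (j : Fin n) (x : Pos n) :
    gradPotential φ j x = ∫ z, φ (x - z) * gradNewton j z := by
  rw [gradPotential, ← integral_sub_left_eq_self _ _ x]
  simp

lemma contDiff_gradPotential (hn : 2 ≤ n) {φ : Pos n → ℝ} (hφ : IsTestFunction φ) (j : Fin n) :
    ContDiff ℝ ∞ (gradPotential φ j) := by
  rw [gradPotential_eq_convolution]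
  exact hφ.compact.contDiff_convolution_left _ hφ.smooth (locallyIntegrable_gradNewton hn j)

lemma partialDeriv_gradPotential (hn : 2 ≤ n) {φ : Pos n → ℝ} (hφ : IsTestFunction φ)
    (j l : Fin n) (x : Pos n) :
    partialDeriv l (gradPotential φ j) x = gradPotential (partialDeriv l φ) j x := by
  have h := hφ.compact.hasFDerivAt_convolution_left (ContinuousLinearMap.mul ℝ ℝ)
    (hφ.smooth.of_le (by exact_mod_cast le_top)) (locallyIntegrable_gradNewton hn j) x
  have hint := (hφ.compact.fderiv ℝ).convolutionExists_left
    ((ContinuousLinearMap.mul ℝ ℝ).precompL (Pos n))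
    (hφ.smooth.continuous_fderiv (by simp)) (locallyIntegrable_gradNewton hn j) x
  rw [partialDeriv, gradPotential_eq_convolution, h.fderiv, convolution_def,
    ContinuousLinearMap.integral_apply hint, gradPotential]
  rfl

lemma isTestFunction_comp_sub {φ : Pos n → ℝ} (hφ : IsTestFunction φ) (x : Pos n) :
    IsTestFunction fun z => φ (x - z) :=
  ⟨hφ.smooth.comp (by fun_prop), hφ.compact.comp_homeomorph (Homeomorph.subLeft x)⟩

lemma partialDeriv_comp_sub {φ : Pos n → ℝ} (hφ : IsTestFunction φ) (x z : Pos n) (l : Fin n) :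
    partialDeriv l (fun z => φ (x - z)) z = -partialDeriv l φ (x - z) := by
  have h : HasFDerivAt (fun z => φ (x - z))
      ((fderiv ℝ φ (x - z)).comp (-ContinuousLinearMap.id ℝ (Pos n))) z :=
    (hφ.differentiable (x - z)).hasFDerivAt.comp z ((hasFDerivAt_id z).const_sub x)
  simp [partialDeriv, h.fderiv]

lemma partialDeriv_gradPotential_symm (hn : 2 ≤ n) {φ : Pos n → ℝ} (hφ : IsTestFunction φ)
    (j l : Fin n) (x : Pos n) :
    gradPotential (partialDeriv l φ) j x = gradPotential (partialDeriv j φ) l x := by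
  have h := integral_partialDeriv_mul_gradNewton_symm hn (isTestFunction_comp_sub hφ x) j l
  simp only [partialDeriv_comp_sub hφ, neg_mul, integral_neg, neg_inj] at h
  rw [gradPotential_eq_integral_sub, gradPotential_eq_integral_sub, h]

/-- The divergence of the vector potential of `φ` is a multiple of `φ`. -/
lemma sum_gradPotential_partialDeriv (hn : 2 ≤ n) {φ : Pos n → ℝ} (hφ : IsTestFunction φ)
    (x : Pos n) :
    ∑ j, gradPotential (partialDeriv j φ) j x = sphereArea n * φ x := by
  have h := integral_sum_partialDeriv_mul_gradNewton hn (isTestFunction_comp_sub hφ x)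
  simp only [partialDeriv_comp_sub hφ, neg_mul, integral_neg, Finset.sum_neg_distrib, neg_inj,
    sub_zero] at h
  simp only [gradPotential_eq_integral_sub, h]

lemma integrable_mul_rieszKernel_sub (hn : 2 ≤ n) {φ : Pos n → ℝ} (hφ : IsTestFunction φ)
    (x : Pos n) : Integrable (fun y => |φ y| * rieszKernel (x - y)) volume := by
  have h := hφ.compact.convolutionExists_left (ContinuousLinearMap.mul ℝ ℝ) hφ.continuous
    (locallyIntegrable_rieszKernel hn) x
  refine (Integrable.abs h).congr (Eventually.of_forall fun y => ?_)
  simp [abs_mul, abs_of_nonneg (rieszKernel_nonneg _)]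

/-- The Riesz potential of a test function decays like `|x|^{-(n-1)}`. -/
lemma exists_rieszPotential_le (hn : 2 ≤ n) {φ : Pos n → ℝ} (hφ : IsTestFunction φ) :
    ∃ C, 0 ≤ C ∧ ∀ x, ∫ y, |φ y| * rieszKernel (x - y) ≤ C * ((1 + ‖x‖) ^ (n - 1))⁻¹ := by
  obtain ⟨M, R₀, hM0, hR₀, hM, hR₀'⟩ := hφ.exists_bound
  obtain ⟨R, hR1, hR⟩ : ∃ R : ℝ, 1 ≤ R ∧ ∀ x, R ≤ ‖x‖ → φ x = 0 :=
    ⟨max R₀ 1, le_max_right _ _, fun x hx => hR₀' x ((le_max_left _ _).trans hx)⟩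
  set A : ℝ := ∫ z in Metric.ball (0 : Pos n) (3 * R), M * rieszKernel z with hA
  have hA0 : 0 ≤ A := integral_nonneg fun z => mul_nonneg hM0 (rieszKernel_nonneg z)
  set B : ℝ := ∫ y, |φ y| with hB
  have hB0 : 0 ≤ B := integral_nonneg fun y => abs_nonneg _
  refine ⟨A * (1 + 2 * R) ^ (n - 1) + B * 4 ^ (n - 1), by positivity, fun x => ?_⟩
  rw [← div_eq_mul_inv, le_div_iff₀ (by positivity)]
  rcases le_or_gt ‖x‖ (2 * R) with hx | hx
  · -- near the support, the kernel is integrated over a fixed ball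
    have h1 : ∫ y, |φ y| * rieszKernel (x - y) ≤ A := by
      rw [← integral_sub_left_eq_self _ _ x, hA,
        ← integral_indicator Metric.isOpen_ball.measurableSet]
      have hint : Integrable (Set.indicator (Metric.ball (0 : Pos n) (3 * R))
          fun z => M * rieszKernel z) volume := by
        rw [integrable_indicator_iff Metric.isOpen_ball.measurableSet]
        exact (((locallyIntegrable_rieszKernel hn).integrableOn_isCompact
          (isCompact_closedBall 0 (3 * R))).mono_set Metric.ball_subset_closedBall).const_mul M
      refine integral_mono_of_nonneg (Eventually.of_forall fun z =>
        mul_nonneg (abs_nonneg _) (rieszKernel_nonneg _)) hint (Eventually.of_forall fun z => ?_)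
      simp only [sub_sub_cancel]
      by_cases hz : ‖z‖ < 3 * R
      · rw [Set.indicator_of_mem (by simpa using hz)]
        exact mul_le_mul_of_nonneg_right (hM _) (rieszKernel_nonneg _)
      · rw [Set.indicator_of_notMem (by simpa using hz), hR (x - z), abs_zero, zero_mul]
        have := norm_sub_norm_le z x
        rw [norm_sub_rev] at this
        linarith
    calc (∫ y, |φ y| * rieszKernel (x - y)) * (1 + ‖x‖) ^ (n - 1)
        ≤ A * (1 + 2 * R) ^ (n - 1) := by gcongr
      _ ≤ _ := by have : 0 ≤ B * 4 ^ (n - 1) := by positivity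
                  linarith
  · -- away from the support, `|x - y| ≥ |x| / 2 ≥ (1 + |x|) / 4`
    have h1 : ∫ y, |φ y| * rieszKernel (x - y) ≤ B * (((1 + ‖x‖) / 4) ^ (n - 1))⁻¹ := by
      rw [hB, ← integral_mul_const]
      refine integral_mono_of_nonneg (Eventually.of_forall fun z =>
        mul_nonneg (abs_nonneg _) (rieszKernel_nonneg _)) (hφ.integrable.abs.mul_const _)
        (Eventually.of_forall fun y => ?_)
      rcases lt_or_ge ‖y‖ R with hy | hy
      · have : (1 + ‖x‖) / 4 ≤ ‖x - y‖ := by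
          have := norm_sub_norm_le x y
          linarith
        simp only [rieszKernel]
        gcongr
      · simp [hR y hy]
    calc (∫ y, |φ y| * rieszKernel (x - y)) * (1 + ‖x‖) ^ (n - 1)
        ≤ B * (((1 + ‖x‖) / 4) ^ (n - 1))⁻¹ * (1 + ‖x‖) ^ (n - 1) := by gcongr
      _ = B * 4 ^ (n - 1) := by
          rw [div_pow]
          field_simp
      _ ≤ _ := by have : 0 ≤ A * (1 + 2 * R) ^ (n - 1) := by positivity
                  linarith

lemma abs_gradPotential_le_integral (hn : 2 ≤ n) {φ : Pos n → ℝ} (hφ : IsTestFunction φ)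
    (j : Fin n) (x : Pos n) :
    |gradPotential φ j x| ≤ ∫ y, |φ y| * rieszKernel (x - y) := by
  rw [gradPotential, ← Real.norm_eq_abs]
  refine norm_integral_le_of_norm_le (integrable_mul_rieszKernel_sub hn hφ x)
    (Eventually.of_forall fun y => ?_)
  rw [Real.norm_eq_abs, abs_mul]
  gcongr
  exact abs_gradNewton_le hn j _

lemma exists_abs_gradPotential_le (hn : 2 ≤ n) {φ : Pos n → ℝ} (hφ : IsTestFunction φ) :
    ∃ C, 0 ≤ C ∧ ∀ j x, |gradPotential φ j x| ≤ C * ((1 + ‖x‖) ^ (n - 1))⁻¹ := by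
  obtain ⟨C, hC0, hC⟩ := exists_rieszPotential_le hn hφ
  exact ⟨C, hC0, fun j x => (abs_gradPotential_le_integral hn hφ j x).trans (hC x)⟩

/-! ### Cutoff functions -/

/-- Test functions `χ_k` that converge to `1`, with gradients that are bounded by a multiple of
`(1 + |x|)⁻¹`, uniformly in `k`, and converge to `0`. -/
structure IsCutoffSequence (χ : ℕ → Pos n → ℝ) (C : ℝ) : Prop where
  test : ∀ k, IsTestFunction (χ k)
  bound : ∀ k x, |χ k x| ≤ C
  tendsto_one : ∀ x, Tendsto (fun k => χ k x) atTop (𝓝 1)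
  deriv_bound : ∀ k l x, |partialDeriv l (χ k) x| ≤ C * (1 + ‖x‖)⁻¹
  deriv_tendsto : ∀ l x, Tendsto (fun k => partialDeriv l (χ k) x) atTop (𝓝 0)

lemma exists_isTestFunction_eq_one : ∃ χ : Pos n → ℝ, IsTestFunction χ ∧ χ 0 = 1 := by
  let b : ContDiffBump (0 : Pos n) := ⟨1, 2, one_pos, one_lt_two⟩
  exact ⟨b, ⟨b.contDiff, b.hasCompactSupport⟩, b.one_of_mem_closedBall (by simp [b])⟩

lemma partialDeriv_comp_smul {φ : Pos n → ℝ} (hφ : IsTestFunction φ) (t : ℝ) (l : Fin n)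
    (x : Pos n) :
    partialDeriv l (fun z => φ (t • z)) x = t * partialDeriv l φ (t • x) := by
  have h : HasFDerivAt (fun z => φ (t • z))
      ((fderiv ℝ φ (t • x)).comp (t • ContinuousLinearMap.id ℝ (Pos n))) x :=
    (hφ.differentiable (t • x)).hasFDerivAt.comp x ((hasFDerivAt_id x).const_smul t)
  simp [partialDeriv, h.fderiv]

lemma isTestFunction_comp_smul {φ : Pos n → ℝ} (hφ : IsTestFunction φ) {t : ℝ} (ht : t ≠ 0) :
    IsTestFunction fun z => φ (t • z) :=
  ⟨hφ.smooth.comp (by fun_prop), hφ.compact.comp_homeomorph (Homeomorph.smulOfNeZero t ht)⟩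

lemma exists_isCutoffSequence : ∃ (χ : ℕ → Pos n → ℝ) (C : ℝ), IsCutoffSequence χ C := by
  obtain ⟨χ, hχ, hχ0⟩ := exists_isTestFunction_eq_one (n := n)
  obtain ⟨M, R, hM0, hR0, hM, -⟩ := hχ.exists_bound
  choose M' R' hM0' hR0' hM' hR' using fun l => (hχ.partialDeriv l).exists_bound
  have hS0 : 0 ≤ ∑ l, M' l * (1 + R' l) :=
    Finset.sum_nonneg fun l _ => mul_nonneg (hM0' l) (by have := hR0' l; positivity)
  have hlim : ∀ x : Pos n, Tendsto (fun k : ℕ => (1 / ((k : ℝ) + 1)) • x) atTop (𝓝 0) :=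
    fun x => by simpa using (tendsto_one_div_add_atTop_nhds_zero_nat (𝕜 := ℝ)).smul_const x
  refine ⟨fun k x => χ ((1 / ((k : ℝ) + 1)) • x), M + ∑ l, M' l * (1 + R' l),
    ⟨fun k => isTestFunction_comp_smul hχ (by positivity), fun k x => ?_, fun x => ?_,
      fun k l x => ?_, fun l x => ?_⟩⟩
  · exact (hM _).trans (by linarith)
  · have := (hχ.continuous.tendsto 0).comp (hlim x)
    rwa [hχ0] at this
  · rw [partialDeriv_comp_smul hχ, ← div_eq_mul_inv, le_div_iff₀ (by positivity)]
    have hle : M' l * (1 + R' l) ≤ M + ∑ l, M' l * (1 + R' l) :=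
      (Finset.single_le_sum (f := fun l => M' l * (1 + R' l))
        (fun l _ => mul_nonneg (hM0' l) (by have := hR0' l; positivity))
        (Finset.mem_univ l)).trans (by linarith)
    refine le_trans ?_ hle
    rcases lt_or_ge ‖(1 / ((k : ℝ) + 1)) • x‖ (R' l) with h | h
    · rw [norm_smul, Real.norm_eq_abs, abs_of_nonneg (by positivity), one_div_mul_eq_div,
        div_lt_iff₀ (by positivity)] at h
      rw [abs_mul, abs_of_nonneg (a := 1 / ((k : ℝ) + 1)) (by positivity), mul_right_comm,
        mul_comm (M' l)]
      have h2 : 1 / ((k : ℝ) + 1) * (1 + ‖x‖) ≤ 1 + R' l := by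
        rw [one_div_mul_eq_div, div_le_iff₀ (by positivity)]
        have : (0 : ℝ) ≤ k := by positivity
        linarith
      have := hR0' l
      gcongr
      exact hM' l _
    · rw [hR' l _ h]
      simp only [mul_zero, abs_zero, zero_mul]
      exact mul_nonneg (hM0' l) (by have := hR0' l; positivity)
  · simp only [partialDeriv_comp_smul hχ]
    have := (tendsto_one_div_add_atTop_nhds_zero_nat (𝕜 := ℝ)).mul
      (((hχ.partialDeriv l).continuous.tendsto 0).comp (hlim x))
    rwa [zero_mul] at this

/-! ### The `L²` bound for second derivatives -/

lemma partialDeriv_comm {φ : Pos n → ℝ} (hφ : IsTestFunction φ) (j l : Fin n) :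
    partialDeriv l (partialDeriv j φ) = partialDeriv j (partialDeriv l φ) := by
  ext x
  have hd : Differentiable ℝ (fderiv ℝ φ) :=
    (hφ.smooth.fderiv_right (m := ∞) (by simp)).differentiable (by simp)
  have key : ∀ a b : Fin n, partialDeriv a (partialDeriv b φ) x
      = fderiv ℝ (fderiv ℝ φ) x (EuclideanSpace.single a 1) (EuclideanSpace.single b 1) := by
    intro a b
    have h : HasFDerivAt (partialDeriv b φ) _ x :=
      (hd x).hasFDerivAt.clm_apply (hasFDerivAt_const (EuclideanSpace.single b (1 : ℝ)) x)
    rw [partialDeriv, h.fderiv]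
    simp
  rw [key, key]
  exact (hφ.smooth.contDiffAt.isSymmSndFDerivAt (by
    simpa using WithTop.coe_le_coe.2 (le_top (a := (2 : ℕ∞))))).eq _ _

lemma IsTestFunction.integrable_mul_test {φ ψ : Pos n → ℝ} (hφ : IsTestFunction φ)
    (hψ : IsTestFunction ψ) : Integrable (fun x => φ x * ψ x) volume :=
  (hφ.mul hψ.smooth).integrable

lemma integral_partialDeriv_mul_partialDeriv {φ ψ : Pos n → ℝ} (hφ : IsTestFunction φ)
    (hψ : IsTestFunction ψ) (j l : Fin n) :
    ∫ x, partialDeriv l φ x * partialDeriv j ψ x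
      = ∫ x, partialDeriv j φ x * partialDeriv l ψ x := by
  rw [integral_partialDeriv_mul hφ (hψ.partialDeriv j).smooth,
    integral_partialDeriv_mul hφ (hψ.partialDeriv l).smooth, partialDeriv_comm hψ]

/-- For a compactly supported vector field, the `L²` norm of the gradient is controlled by
those of the divergence and of the curl. -/
lemma integral_sum_sq_partialDeriv {u : Fin n → Pos n → ℝ} (hu : ∀ j, IsTestFunction (u j)) :
    ∑ j, ∑ l, ∫ x, partialDeriv l (u j) x ^ 2
      = ∫ x, ((∑ j, partialDeriv j (u j) x) ^ 2
        + 1 / 2 * ∑ j, ∑ l, (partialDeriv l (u j) x - partialDeriv j (u l) x) ^ 2) := by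
  have hi : ∀ a b c d : Fin n,
      Integrable (fun x => partialDeriv a (u b) x * partialDeriv c (u d) x) volume :=
    fun a b c d => ((hu b).partialDeriv a).integrable_mul_test ((hu d).partialDeriv c)
  have hpt : ∀ x, (∑ j, partialDeriv j (u j) x) ^ 2
        + 1 / 2 * ∑ j, ∑ l, (partialDeriv l (u j) x - partialDeriv j (u l) x) ^ 2
      = ∑ j, ∑ l, (partialDeriv l (u j) x * partialDeriv l (u j) x
        + (partialDeriv j (u j) x * partialDeriv l (u l) x
          - partialDeriv l (u j) x * partialDeriv j (u l) x)) := by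
    intro x
    have h1 : ∑ j, ∑ l, partialDeriv j (u l) x * partialDeriv j (u l) x
        = ∑ j, ∑ l, partialDeriv l (u j) x * partialDeriv l (u j) x := Finset.sum_comm
    have h2 : ∀ j l, (partialDeriv l (u j) x - partialDeriv j (u l) x) ^ 2
        = partialDeriv l (u j) x * partialDeriv l (u j) x
          + partialDeriv j (u l) x * partialDeriv j (u l) x
          - 2 * (partialDeriv l (u j) x * partialDeriv j (u l) x) := fun j l => by ring
    simp only [h2, Finset.sum_add_distrib, Finset.sum_sub_distrib, ← Finset.mul_sum, h1]
    rw [sq, Finset.sum_mul_sum]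
    simp only [← Finset.mul_sum]
    ring
  have hi2 : ∀ j l, Integrable (fun x => partialDeriv j (u j) x * partialDeriv l (u l) x
      - partialDeriv l (u j) x * partialDeriv j (u l) x) volume :=
    fun j l => (hi _ _ _ _).sub (hi _ _ _ _)
  have hi3 : ∀ j l, Integrable (fun x => partialDeriv l (u j) x * partialDeriv l (u j) x
      + (partialDeriv j (u j) x * partialDeriv l (u l) x
        - partialDeriv l (u j) x * partialDeriv j (u l) x)) volume :=
    fun j l => (hi _ _ _ _).add (hi2 j l)
  simp only [hpt]
  rw [integral_finsetSum _ fun j _ => integrable_finsetSum _ fun l _ => hi3 j l]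
  refine Finset.sum_congr rfl fun j _ => ?_
  rw [integral_finsetSum _ fun l _ => hi3 j l]
  refine Finset.sum_congr rfl fun l _ => ?_
  rw [integral_add (hi _ _ _ _) (hi2 j l), integral_sub (hi _ _ _ _) (hi _ _ _ _),
    integral_partialDeriv_mul_partialDeriv (hu j) (hu l) j l, sub_self, add_zero]
  simp only [sq]

lemma partialDeriv_mul {φ ψ : Pos n → ℝ} (hφ : IsTestFunction φ) (hψ : ContDiff ℝ ∞ ψ)
    (l : Fin n) (x : Pos n) :
    partialDeriv l (fun x => φ x * ψ x) x
      = partialDeriv l φ x * ψ x + φ x * partialDeriv l ψ x := by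
  have h : HasFDerivAt (fun x => φ x * ψ x) _ x :=
    (hφ.differentiable x).hasFDerivAt.mul ((hψ.differentiable (by simp)) x).hasFDerivAt
  rw [partialDeriv, h.fderiv]
  simp [partialDeriv]
  ring

lemma inv_one_add_norm_mul (hn : 2 ≤ n) (x : Pos n) :
    (1 + ‖x‖)⁻¹ * ((1 + ‖x‖) ^ (n - 1))⁻¹ = ((1 + ‖x‖) ^ n)⁻¹ := by
  rw [← mul_inv, ← pow_succ', Nat.sub_add_cancel (by omega)]

lemma integrable_sq_inv_one_add_norm_pow (hn : 2 ≤ n) :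
    Integrable (fun x : Pos n => (((1 + ‖x‖) ^ n)⁻¹) ^ 2) volume := by
  have hn0 : (0 : ℝ) < n := by exact_mod_cast (by omega : 0 < n)
  have h := integrable_one_add_norm (E := Pos n) (μ := volume) (r := 2 * n) (by
    rw [finrank_euclideanSpace_fin]
    linarith)
  refine h.congr (Eventually.of_forall fun x => ?_)
  simp only
  rw [Real.rpow_neg (by positivity), inv_pow, ← pow_mul, ← Real.rpow_natCast]
  push_cast
  rw [mul_comm]

/-- The second derivatives of the Newtonian potential of `φ` are bounded by `φ` in `L²`: the
vector field `gradPotential φ` is curl free and has divergence `sphereArea n * φ`. -/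
lemma lintegral_sq_gradPotential_partialDeriv_le (hn : 2 ≤ n) {φ : Pos n → ℝ}
    (hφ : IsTestFunction φ) (j l : Fin n) :
    ∫⁻ x, ENNReal.ofReal (gradPotential (partialDeriv l φ) j x ^ 2)
      ≤ ENNReal.ofReal (sphereArea n ^ 2 * ∫ x, φ x ^ 2) := by
  obtain ⟨χ, C, hχ⟩ := exists_isCutoffSequence (n := n)
  obtain ⟨C', hC'0, hC'⟩ := exists_abs_gradPotential_le hn hφ
  have hC0 : 0 ≤ C := (abs_nonneg _).trans (hχ.bound 0 0)
  have hω := (sphereArea_pos hn).le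
  let u : ℕ → Fin n → Pos n → ℝ := fun k j x => χ k x * gradPotential φ j x
  have hu : ∀ k j, IsTestFunction (u k j) := fun k j =>
    (hχ.test k).mul (contDiff_gradPotential hn hφ j)
  have hdu : ∀ k j l x, partialDeriv l (u k j) x
      = partialDeriv l (χ k) x * gradPotential φ j x
        + χ k x * gradPotential (partialDeriv l φ) j x := fun k j l x => by
    rw [partialDeriv_mul (hχ.test k) (contDiff_gradPotential hn hφ j),
      partialDeriv_gradPotential hn hφ]
  have hdiv : ∀ k x, ∑ j, partialDeriv j (u k j) x
      = ∑ j, partialDeriv j (χ k) x * gradPotential φ j x + χ k x * (sphereArea n * φ x) :=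
    fun k x => by
      simp only [hdu, Finset.sum_add_distrib, ← Finset.mul_sum,
        sum_gradPotential_partialDeriv hn hφ]
  have hcurl : ∀ k j l x, partialDeriv l (u k j) x - partialDeriv j (u k l) x
      = partialDeriv l (χ k) x * gradPotential φ j x
        - partialDeriv j (χ k) x * gradPotential φ l x := fun k j l x => by
    rw [hdu, hdu, partialDeriv_gradPotential_symm hn hφ j l]
    ring
  -- the products of the gradient of the cutoff with the potential decay like `|x|^{-n}`
  set p : Pos n → ℝ := fun x => C * C' * ((1 + ‖x‖) ^ n)⁻¹ with hp
  have hp0 : ∀ x, 0 ≤ p x := fun x => by positivity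
  have hcross : ∀ k j l x, |partialDeriv l (χ k) x * gradPotential φ j x| ≤ p x := by
    intro k j l x
    calc |partialDeriv l (χ k) x * gradPotential φ j x|
        ≤ (C * (1 + ‖x‖)⁻¹) * (C' * ((1 + ‖x‖) ^ (n - 1))⁻¹) := by
          rw [abs_mul]
          gcongr
          · exact hχ.deriv_bound k l x
          · exact hC' j x
      _ = p x := by
          rw [hp, mul_mul_mul_comm, inv_one_add_norm_mul hn]
  have hlim : Tendsto (fun k => ∑ j, ∑ l, ∫ x, partialDeriv l (u k j) x ^ 2) atTop
      (𝓝 (∫ x, (sphereArea n * φ x) ^ 2)) := by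
    simp only [fun k => integral_sum_sq_partialDeriv (hu k)]
    refine tendsto_integral_of_dominated_convergence
      (fun x => 2 * (n * p x) ^ 2 + 2 * (C * (sphereArea n * |φ x|)) ^ 2
        + 1 / 2 * ∑ _j : Fin n, ∑ _l : Fin n, (2 * p x) ^ 2) ?_ ?_ ?_ ?_
    · intro k
      refine Continuous.aestronglyMeasurable ?_
      have hc := fun j l => ((hu k j).partialDeriv l).continuous
      fun_prop
    · have hpi : Integrable (fun x => p x ^ 2) volume := by
        simp only [hp, mul_pow]
        exact (integrable_sq_inv_one_add_norm_pow hn).const_mul _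
      have hφi : Integrable (fun x => |φ x| ^ 2) volume := by
        simp only [sq_abs]
        simp only [sq]
        exact hφ.integrable_mul_test hφ
      simp only [mul_pow]
      exact (((hpi.const_mul _).const_mul _).add
        (((hφi.const_mul _).const_mul _).const_mul _)).add
        ((integrable_finsetSum _ fun _ _ => integrable_finsetSum _ fun _ _ =>
          hpi.const_mul _).const_mul _)
    · intro k
      refine Eventually.of_forall fun x => ?_
      rw [Real.norm_eq_abs, abs_of_nonneg (by positivity)]
      refine add_le_add ?_ ?_
      · rw [hdiv]
        have h1 : |∑ j, partialDeriv j (χ k) x * gradPotential φ j x| ≤ n * p x := by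
          refine (Finset.abs_sum_le_sum_abs _ _).trans ?_
          refine (Finset.sum_le_sum fun j _ => hcross k j j x).trans ?_
          simp
        have h2 : |χ k x * (sphereArea n * φ x)| ≤ C * (sphereArea n * |φ x|) := by
          rw [abs_mul, abs_mul, abs_of_nonneg hω]
          gcongr
          exact hχ.bound k x
        have h3 := sq_le_sq' (abs_le.1 h1).1 (abs_le.1 h1).2
        have h4 := sq_le_sq' (abs_le.1 h2).1 (abs_le.1 h2).2
        have h5 := add_sq_le (a := ∑ j, partialDeriv j (χ k) x * gradPotential φ j x)
          (b := χ k x * (sphereArea n * φ x))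
        linarith
      · refine mul_le_mul_of_nonneg_left (Finset.sum_le_sum fun j _ =>
          Finset.sum_le_sum fun l _ => ?_) (by norm_num)
        rw [hcurl]
        have h1 := abs_le.1 (hcross k j l x)
        have h2 := abs_le.1 (hcross k l j x)
        exact sq_le_sq' (by linarith) (by linarith)
    · refine Eventually.of_forall fun x => ?_
      have h1 : ∀ j l, Tendsto (fun k => partialDeriv l (χ k) x * gradPotential φ j x) atTop
          (𝓝 0) := fun j l => by
        simpa using (hχ.deriv_tendsto l x).mul_const (gradPotential φ j x)
      have h2 : Tendsto (fun k => χ k x * (sphereArea n * φ x)) atTop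
          (𝓝 (1 * (sphereArea n * φ x))) := (hχ.tendsto_one x).mul_const _
      have h3 := (((tendsto_finsetSum Finset.univ fun j _ => h1 j j).add h2).pow 2).add
        ((tendsto_finsetSum Finset.univ fun j _ => tendsto_finsetSum Finset.univ fun l _ =>
          ((h1 j l).sub (h1 l j)).pow 2).const_mul (1 / 2))
      simpa [hdiv, hcurl] using h3
  have hpt : ∀ x, Tendsto (fun k => ENNReal.ofReal (partialDeriv l (u k j) x ^ 2)) atTop
      (𝓝 (ENNReal.ofReal (gradPotential (partialDeriv l φ) j x ^ 2))) := by
    intro x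
    refine ENNReal.tendsto_ofReal (Tendsto.pow ?_ 2)
    simp only [hdu]
    simpa using ((hχ.deriv_tendsto l x).mul_const (gradPotential φ j x)).add
      ((hχ.tendsto_one x).mul_const (gradPotential (partialDeriv l φ) j x))
  have hmeas : ∀ k, Measurable fun x => ENNReal.ofReal (partialDeriv l (u k j) x ^ 2) := fun k =>
    (((hu k j).partialDeriv l).continuous.measurable.pow_const 2).ennreal_ofReal
  calc ∫⁻ x, ENNReal.ofReal (gradPotential (partialDeriv l φ) j x ^ 2)
      = ∫⁻ x, liminf (fun k => ENNReal.ofReal (partialDeriv l (u k j) x ^ 2)) atTop :=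
        lintegral_congr fun x => (hpt x).liminf_eq.symm
    _ ≤ liminf (fun k => ∫⁻ x, ENNReal.ofReal (partialDeriv l (u k j) x ^ 2)) atTop :=
        lintegral_liminf_le hmeas
    _ ≤ liminf (fun k => ENNReal.ofReal (∑ j, ∑ l, ∫ x, partialDeriv l (u k j) x ^ 2)) atTop := by
        refine liminf_le_liminf (Eventually.of_forall fun k => ?_)
        have hi : Integrable (fun x => partialDeriv l (u k j) x ^ 2) volume := by
          simp only [sq]
          exact ((hu k j).partialDeriv l).integrable_mul_test ((hu k j).partialDeriv l)
        rw [← ofReal_integral_eq_lintegral_ofReal hi (Eventually.of_forall fun x => sq_nonneg _)]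
        refine ENNReal.ofReal_le_ofReal ?_
        have hnn : ∀ a b : Fin n, 0 ≤ ∫ x, partialDeriv a (u k b) x ^ 2 := fun a b =>
          integral_nonneg fun x => sq_nonneg _
        refine (Finset.single_le_sum (f := fun l => ∫ x, partialDeriv l (u k j) x ^ 2)
          (fun l _ => hnn l j) (Finset.mem_univ l)).trans ?_
        exact Finset.single_le_sum (f := fun j => ∑ l, ∫ x, partialDeriv l (u k j) x ^ 2)
          (fun j _ => Finset.sum_nonneg fun l _ => hnn l j) (Finset.mem_univ j)
    _ = ENNReal.ofReal (∫ x, (sphereArea n * φ x) ^ 2) :=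
        (ENNReal.tendsto_ofReal hlim).liminf_eq
    _ = ENNReal.ofReal (sphereArea n ^ 2 * ∫ x, φ x ^ 2) := by
        simp only [mul_pow]
        rw [integral_const_mul]

lemma IsTestFunction.memLp {φ : Pos n → ℝ} (hφ : IsTestFunction φ) (p : ℝ≥0∞) :
    MemLp φ p volume :=
  hφ.continuous.memLp_of_hasCompactSupport hφ.compact

lemma eLpNorm_two_eq (f : Pos n → ℝ) :
    eLpNorm f 2 volume = (∫⁻ x, ENNReal.ofReal (f x ^ 2)) ^ (1 / 2 : ℝ) := by
  rw [eLpNorm_eq_lintegral_rpow_enorm_toReal (by norm_num) (by norm_num)]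
  simp only [ENNReal.toReal_ofNat]
  congr 2
  ext x
  rw [← sq_abs, ENNReal.ofReal_pow (abs_nonneg _), ← Real.norm_eq_abs, ofReal_norm]
  norm_cast

lemma eLpNorm_gradPotential_partialDeriv_le (hn : 2 ≤ n) {φ : Pos n → ℝ}
    (hφ : IsTestFunction φ) (j l : Fin n) :
    eLpNorm (gradPotential (partialDeriv l φ) j) 2 volume
      ≤ ENNReal.ofReal (sphereArea n) * eLpNorm φ 2 volume := by
  have hi : Integrable (fun x => φ x ^ 2) volume := by
    simp only [sq]
    exact hφ.integrable_mul_test hφ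
  have h := lintegral_sq_gradPotential_partialDeriv_le hn hφ j l
  rw [ENNReal.ofReal_mul (sq_nonneg _),
    ofReal_integral_eq_lintegral_ofReal hi (Eventually.of_forall fun x => sq_nonneg _)] at h
  rw [eLpNorm_two_eq, eLpNorm_two_eq]
  refine (ENNReal.rpow_le_rpow h (by norm_num)).trans ?_
  rw [ENNReal.mul_rpow_of_nonneg _ _ (by norm_num), ENNReal.ofReal_pow (sphereArea_pos hn).le,
    ← ENNReal.rpow_natCast, ← ENNReal.rpow_mul]
  norm_num

lemma memLp_gradPotential_partialDeriv (hn : 2 ≤ n) {φ : Pos n → ℝ}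
    (hφ : IsTestFunction φ) (j l : Fin n) :
    MemLp (gradPotential (partialDeriv l φ) j) 2 volume :=
  ⟨(contDiff_gradPotential hn (hφ.partialDeriv l) j).continuous.aestronglyMeasurable,
    (eLpNorm_gradPotential_partialDeriv_le hn hφ j l).trans_lt
      (ENNReal.mul_lt_top ENNReal.ofReal_lt_top (hφ.memLp 2).2)⟩

lemma abs_integral_mul_le_eLpNorm {f g : Pos n → ℝ} (hf : MemLp f 2 volume)
    (hg : MemLp g 2 volume) :
    |∫ x, f x * g x| ≤ (eLpNorm f 2 volume).toReal * (eLpNorm g 2 volume).toReal := by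
  have h : ∫ x, f x * g x = inner ℝ (hg.toLp g) (hf.toLp f) := by
    rw [L2.inner_def]
    refine integral_congr_ae ?_
    filter_upwards [hf.coeFn_toLp, hg.coeFn_toLp] with x h1 h2
    simp [h1, h2]
  rw [h, mul_comm, ← Lp.norm_toLp f hf, ← Lp.norm_toLp g hg]
  exact abs_real_inner_le_norm _ _

/-! ### Transposition of the second derivatives -/

lemma gradPotential_add (hn : 2 ≤ n) {φ ψ : Pos n → ℝ} (hφ : IsTestFunction φ)
    (hψ : IsTestFunction ψ) (j l : Fin n) (x : Pos n) :
    gradPotential (partialDeriv l (φ + ψ)) j x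
      = gradPotential (partialDeriv l φ) j x + gradPotential (partialDeriv l ψ) j x := by
  have hd : ∀ y, partialDeriv l (φ + ψ) y = partialDeriv l φ y + partialDeriv l ψ y := fun y => by
    simp [partialDeriv, fderiv_add (hφ.differentiable y) (hψ.differentiable y)]
  have hi : ∀ {θ : Pos n → ℝ}, IsTestFunction θ →
      Integrable (fun z => θ (x - z) * gradNewton j z) volume := fun h =>
    (isTestFunction_comp_sub h x).integrable_mul (locallyIntegrable_gradNewton hn j)
  simp only [gradPotential_eq_integral_sub, hd, add_mul]
  exact integral_add (hi (hφ.partialDeriv l)) (hi (hψ.partialDeriv l))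

lemma gradPotential_smul {φ : Pos n → ℝ} (hφ : IsTestFunction φ) (t : ℝ) (j l : Fin n)
    (x : Pos n) :
    gradPotential (partialDeriv l (t • φ)) j x = t * gradPotential (partialDeriv l φ) j x := by
  have hd : ∀ y, partialDeriv l (t • φ) y = t * partialDeriv l φ y := fun y => by
    simp [partialDeriv, fderiv_const_smul (hφ.differentiable y)]
  simp only [gradPotential, hd, mul_assoc]
  rw [integral_const_mul]

/-- The transpose of the bounded operator that maps a test function `φ` to
`∂_l (φ ⋆ x_j / |x|ⁿ)`, by the Riesz representation theorem. -/
lemma exists_transpose_real (hn : 2 ≤ n) {h : Pos n → ℝ} (hh : MemLp h 2 volume) (j l : Fin n) :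
    ∃ g : Pos n → ℝ, MemLp g 2 volume ∧ ∀ φ, IsTestFunction φ →
      ∫ x, gradPotential (partialDeriv l φ) j x * h x = ∫ x, φ x * g x := by
  let S : Submodule ℝ (Pos n → ℝ) :=
    { carrier := {φ | IsTestFunction φ}
      add_mem' := fun {a b} ha hb => ⟨ha.smooth.add hb.smooth, ha.compact.add hb.compact⟩
      zero_mem' := ⟨contDiff_const, HasCompactSupport.zero⟩
      smul_mem' := fun c a ha => ⟨contDiff_const.smul ha.smooth, ha.compact.smul_left⟩ }
  let e : S →ₗ[ℝ] Lp ℝ 2 (volume : Measure (Pos n)) :=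
    { toFun := fun φ => (IsTestFunction.memLp φ.2 2).toLp φ
      map_add' := fun _ _ => rfl
      map_smul' := fun _ _ => rfl }
  let T : S →ₗ[ℝ] ℝ :=
    { toFun := fun φ => ∫ x, gradPotential (partialDeriv l φ) j x * h x
      map_add' := fun φ ψ => by
        have hi : ∀ θ : S, Integrable
            (fun x => gradPotential (partialDeriv l θ) j x * h x) volume := fun θ =>
          (memLp_gradPotential_partialDeriv hn θ.2 j l).integrable_mul hh
        rw [← integral_add (hi φ) (hi ψ)]
        congr 1
        ext x
        rw [← add_mul, ← gradPotential_add hn φ.2 ψ.2]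
        rfl
      map_smul' := fun t φ => by
        rw [RingHom.id_apply, smul_eq_mul, ← integral_const_mul]
        congr 1
        ext x
        rw [← mul_assoc, ← gradPotential_smul φ.2]
        rfl }
  have hbound : ∃ K : ℝ, ∀ φ, ‖T φ‖ ≤ K * ‖e φ‖ := by
    refine ⟨sphereArea n * (eLpNorm h 2 volume).toReal, fun φ => ?_⟩
    have h1 := abs_integral_mul_le_eLpNorm (memLp_gradPotential_partialDeriv hn φ.2 j l) hh
    have h2 := ENNReal.toReal_mono
      (ENNReal.mul_ne_top ENNReal.ofReal_ne_top (IsTestFunction.memLp φ.2 2).2.ne)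
      (eLpNorm_gradPotential_partialDeriv_le hn φ.2 j l)
    rw [ENNReal.toReal_mul, ENNReal.toReal_ofReal (sphereArea_pos hn).le] at h2
    have h3 : ‖e φ‖ = (eLpNorm (φ : Pos n → ℝ) 2 volume).toReal :=
      Lp.norm_toLp _ (IsTestFunction.memLp φ.2 2)
    rw [h3]
    calc ‖T φ‖ ≤ _ := h1
      _ ≤ sphereArea n * (eLpNorm (φ : Pos n → ℝ) 2 volume).toReal
          * (eLpNorm h 2 volume).toReal := by gcongr
      _ = _ := by ring
  obtain ⟨F, hF, -⟩ := exists_extension_norm_eq (LinearMap.range e) (T.compLeftInverse e)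
  refine ⟨((InnerProductSpace.toDual ℝ _).symm F : Lp ℝ 2 (volume : Measure (Pos n))),
    Lp.memLp _, fun φ hφ => ?_⟩
  have h1 := hF ⟨e ⟨φ, hφ⟩, LinearMap.mem_range_self e _⟩
  rw [LinearMap.compLeftInverse_apply_of_bdd T e hbound ⟨φ, hφ⟩ _ rfl,
    ← InnerProductSpace.toDual_symm_apply, L2.inner_def] at h1
  refine Eq.trans h1.symm (integral_congr_ae ?_)
  filter_upwards [(hφ.memLp 2).coeFn_toLp] with x hx
  have hx' : (e ⟨φ, hφ⟩ : Lp ℝ 2 (volume : Measure (Pos n))) x = φ x := hx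
  rw [hx']
  simp

/-- Vector-valued form of `exists_transpose_real`. -/
lemma exists_transpose (hn : 2 ≤ n) {F : Type*} [NormedAddCommGroup F] [NormedSpace ℝ F]
    [FiniteDimensional ℝ F] {h : Pos n → F} (hh : MemLp h 2 volume) (j l : Fin n) :
    ∃ g : Pos n → F, MemLp g 2 volume ∧ ∀ φ, IsTestFunction φ →
      ∫ x, gradPotential (partialDeriv l φ) j x • h x = ∫ x, φ x • g x := by
  let b := Module.finBasis ℝ F
  let c : Fin (Module.finrank ℝ F) → F →L[ℝ] ℝ := fun i => (b.coord i).toContinuousLinearMap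
  have hc : ∀ i, MemLp (fun x => c i (h x)) 2 volume := fun i => (c i).comp_memLp' hh
  choose g hg hg' using fun i => exists_transpose_real hn (hc i) j l
  refine ⟨fun x => ∑ i, g i x • b i, memLp_finsetSum _ fun i _ => ?_, fun φ hφ => ?_⟩
  · exact ((ContinuousLinearMap.toSpanSingleton ℝ (b i)).comp_memLp' (hg i))
  · have hrepr : ∀ x, h x = ∑ i, c i (h x) • b i := fun x => (b.sum_repr (h x)).symm
    have hL : ∀ i, Integrable (fun x => gradPotential (partialDeriv l φ) j x * c i (h x)) volume :=
      fun i => (memLp_gradPotential_partialDeriv hn hφ j l).integrable_mul (hc i)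
    have hR : ∀ i, Integrable (fun x => φ x * g i x) volume :=
      fun i => (hφ.memLp 2).integrable_mul (hg i)
    calc ∫ x, gradPotential (partialDeriv l φ) j x • h x
        = ∫ x, ∑ i, (gradPotential (partialDeriv l φ) j x * c i (h x)) • b i := by
          congr 1
          ext x
          conv_lhs => rw [hrepr x, Finset.smul_sum]
          simp only [smul_smul]
      _ = ∑ i, (∫ x, gradPotential (partialDeriv l φ) j x * c i (h x)) • b i := by
          rw [integral_finsetSum _ fun i _ => (hL i).smul_const _]
          simp only [integral_smul_const]
      _ = ∑ i, (∫ x, φ x * g i x) • b i := by simp only [fun i => hg' i φ hφ]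
      _ = ∫ x, ∑ i, (φ x * g i x) • b i := by
          rw [integral_finsetSum _ fun i _ => (hR i).smul_const _]
          simp only [integral_smul_const]
      _ = ∫ x, φ x • ∑ i, g i x • b i := by
          simp only [Finset.smul_sum, smul_smul]

/-! ### Young's inequality and the Riesz potential of order one -/

lemma measurable_sub_uncurry {u v : Pos n → ℝ≥0∞} (hu : Measurable u) (hv : Measurable v) :
    Measurable (Function.uncurry fun x y : Pos n => u (x - y) * v y) :=
  (hu.comp (measurable_fst.sub measurable_snd)).mul (hv.comp measurable_snd)

lemma lintegral_comp_sub_left {u : Pos n → ℝ≥0∞} (x : Pos n) :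
    ∫⁻ y, u (x - y) = ∫⁻ y, u y :=
  lintegral_sub_left_eq_self u x

/-- Young's convolution inequality for the reciprocal exponents `a + c = 1 + b`, in the form of a
finiteness statement for `u ^ c ⋆ v ^ a`, where `u` and `v` have finite integrals. -/
lemma lintegral_convolution_rpow_lt_top {u v : Pos n → ℝ≥0∞} (hu : Measurable u)
    (hv : Measurable v) (hui : ∫⁻ y, u y ≠ ⊤) (hvi : ∫⁻ y, v y ≠ ⊤) {a b c : ℝ} (hb : 0 < b)
    (hab : b ≤ a) (hbc : b ≤ c) (habc : a + c = 1 + b) :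
    ∫⁻ x, (∫⁻ y, u (x - y) ^ c * v y ^ a) ^ (1 / b) < ⊤ := by
  have hpt : ∀ x, ∫⁻ y, u (x - y) ^ c * v y ^ a
      ≤ (∫⁻ y, u (x - y) * v y) ^ b * ((∫⁻ y, u y) ^ (c - b) * (∫⁻ y, v y) ^ (a - b)) := by
    intro x
    have hux : Measurable fun y => u (x - y) := hu.comp (measurable_const.sub measurable_id)
    have h := ENNReal.lintegral_prod_norm_pow_le (μ := (volume : Measure (Pos n)))
      (Finset.univ : Finset (Fin 3))
      (f := ![fun y => u (x - y) * v y, fun y => u (x - y), v])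
      (by
        intro i _
        fin_cases i
        · exact (hux.mul hv).aemeasurable
        · exact hux.aemeasurable
        · exact hv.aemeasurable)
      (p := ![b, c - b, a - b])
      (by simp [Fin.sum_univ_three]; linarith)
      (by
        intro i _
        fin_cases i
        · exact hb.le
        · exact sub_nonneg.2 hbc
        · exact sub_nonneg.2 hab)
    simp only [Fin.prod_univ_three, Matrix.cons_val_zero, Matrix.cons_val_one,
      Matrix.cons_val_two, Matrix.tail_cons, Matrix.head_cons, lintegral_comp_sub_left] at h
    rw [← mul_assoc]
    refine le_trans (le_of_eq (lintegral_congr fun y => ?_)) h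
    rw [ENNReal.mul_rpow_of_nonneg _ _ hb.le]
    have h1 : u (x - y) ^ c = u (x - y) ^ b * u (x - y) ^ (c - b) := by
      rw [← ENNReal.rpow_add_of_nonneg _ _ hb.le (sub_nonneg.2 hbc), add_sub_cancel]
    have h2 : v y ^ a = v y ^ b * v y ^ (a - b) := by
      rw [← ENNReal.rpow_add_of_nonneg _ _ hb.le (sub_nonneg.2 hab), add_sub_cancel]
    rw [h1, h2]
    ring
  set K : ℝ≥0∞ := (∫⁻ y, u y) ^ (c - b) * (∫⁻ y, v y) ^ (a - b) with hK
  have hKt : K ≠ ⊤ := ENNReal.mul_ne_top (ENNReal.rpow_ne_top_of_nonneg (sub_nonneg.2 hbc) hui)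
    (ENNReal.rpow_ne_top_of_nonneg (sub_nonneg.2 hab) hvi)
  have hb' : 0 ≤ 1 / b := by positivity
  calc ∫⁻ x, (∫⁻ y, u (x - y) ^ c * v y ^ a) ^ (1 / b)
      ≤ ∫⁻ x, (∫⁻ y, u (x - y) * v y) * K ^ (1 / b) := by
        refine lintegral_mono fun x => ?_
        refine (ENNReal.rpow_le_rpow (hpt x) hb').trans (le_of_eq ?_)
        rw [ENNReal.mul_rpow_of_nonneg _ _ hb', ← ENNReal.rpow_mul, mul_one_div_cancel hb.ne',
          ENNReal.rpow_one]
    _ = (∫⁻ x, ∫⁻ y, u (x - y) * v y) * K ^ (1 / b) :=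
        lintegral_mul_const _ (measurable_sub_uncurry hu hv).lintegral_prod_right'
    _ = ((∫⁻ y, u y) * ∫⁻ y, v y) * K ^ (1 / b) := by
        rw [lintegral_lintegral_swap (measurable_sub_uncurry hu hv).aemeasurable]
        congr 1
        rw [← lintegral_const_mul _ hv]
        refine lintegral_congr fun y => ?_
        have huy : Measurable fun x => u (x - y) := hu.comp (measurable_id.sub measurable_const)
        rw [lintegral_mul_const _ huy, lintegral_sub_right_eq_self u y]
    _ < ⊤ := ENNReal.mul_lt_top (ENNReal.mul_lt_top hui.lt_top hvi.lt_top)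
        (ENNReal.rpow_lt_top_of_nonneg hb' hKt)

/-- The part of the Riesz kernel in the unit ball. -/
def rieszNear (x : Pos n) : ℝ≥0∞ :=
  Set.indicator (Metric.ball 0 1) (fun x => ENNReal.ofReal (rieszKernel x)) x

/-- The part of the Riesz kernel outside the unit ball. -/
def rieszFar (x : Pos n) : ℝ≥0∞ :=
  Set.indicator (Metric.ball 0 1)ᶜ (fun x => ENNReal.ofReal (rieszKernel x)) x

lemma rieszNear_add_rieszFar (x : Pos n) :
    rieszNear x + rieszFar x = ENNReal.ofReal (rieszKernel x) :=
  Set.indicator_self_add_compl_apply _ _ _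

lemma measurable_rieszNear : Measurable (rieszNear : Pos n → ℝ≥0∞) :=
  measurable_rieszKernel.ennreal_ofReal.indicator Metric.isOpen_ball.measurableSet

lemma measurable_rieszFar : Measurable (rieszFar : Pos n → ℝ≥0∞) :=
  measurable_rieszKernel.ennreal_ofReal.indicator Metric.isOpen_ball.measurableSet.compl

lemma lintegral_rieszNear_rpow_ne_top (hn : 2 ≤ n) {c : ℝ} (hc0 : 0 < c)
    (hc : 1 - 1 / (n : ℝ) < c) : ∫⁻ x : Pos n, rieszNear x ^ (1 / c) ≠ ⊤ := by
  have hn0 : (0 : ℝ) < n := by exact_mod_cast (by omega : 0 < n)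
  have hs : ((n : ℝ) - 1) / c < n := by
    rw [div_lt_iff₀ hc0]
    have : n * (1 - 1 / (n : ℝ)) < n * c := by gcongr
    rw [mul_sub, mul_one_div_cancel hn0.ne'] at this
    linarith
  have h := (integrableOn_ball_norm_rpow hn hs one_pos).lintegral_lt_top
  rw [← lintegral_indicator Metric.isOpen_ball.measurableSet] at h
  refine ne_of_lt (lt_of_le_of_lt (lintegral_mono fun x => ?_) h)
  simp only [rieszNear]
  by_cases hx : x ∈ Metric.ball (0 : Pos n) 1
  · rw [Set.indicator_of_mem hx, Set.indicator_of_mem hx,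
      ENNReal.ofReal_rpow_of_nonneg (rieszKernel_nonneg x) (by positivity),
      rieszKernel_eq_rpow hn, ← Real.rpow_mul (norm_nonneg _), neg_mul, mul_one_div]
  · rw [Set.indicator_of_notMem hx, Set.indicator_of_notMem hx,
      ENNReal.zero_rpow_of_pos (by positivity)]

lemma lintegral_rieszFar_rpow_ne_top (hn : 2 ≤ n) {c : ℝ} (hc0 : 0 < c)
    (hc : c < 1 - 1 / (n : ℝ)) : ∫⁻ x : Pos n, rieszFar x ^ (1 / c) ≠ ⊤ := by
  have hn0 : (0 : ℝ) < n := by exact_mod_cast (by omega : 0 < n)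
  have hn1 : (1 : ℝ) < n := by exact_mod_cast (by omega : 1 < n)
  have hs : (n : ℝ) < ((n : ℝ) - 1) / c := by
    rw [lt_div_iff₀ hc0]
    have : n * c < n * (1 - 1 / (n : ℝ)) := by gcongr
    rw [mul_sub, mul_one_div_cancel hn0.ne'] at this
    linarith
  set s := ((n : ℝ) - 1) / c with hs'
  have hs0 : 0 ≤ s := hn0.le.trans hs.le
  have h := ((integrable_one_add_norm (E := Pos n) (μ := volume) (r := s)
    (by rwa [finrank_euclideanSpace_fin])).const_mul (2 ^ s)).lintegral_lt_top
  refine ne_of_lt (lt_of_le_of_lt (lintegral_mono fun x => ?_) h)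
  simp only [rieszFar]
  by_cases hx : x ∈ (Metric.ball (0 : Pos n) 1)ᶜ
  · have hx1 : 1 ≤ ‖x‖ := by simpa using hx
    rw [Set.indicator_of_mem hx,
      ENNReal.ofReal_rpow_of_nonneg (rieszKernel_nonneg x) (by positivity),
      rieszKernel_eq_rpow hn, ← Real.rpow_mul (norm_nonneg _), neg_mul, mul_one_div, ← hs']
    refine ENNReal.ofReal_le_ofReal ?_
    calc ‖x‖ ^ (-s) ≤ ((1 + ‖x‖) / 2) ^ (-s) :=
          Real.rpow_le_rpow_of_nonpos (by positivity) (by linarith) (by linarith)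
      _ = 2 ^ s * (1 + ‖x‖) ^ (-s) := by
          rw [Real.div_rpow (by positivity) (by norm_num), Real.rpow_neg zero_le_two,
            div_inv_eq_mul, mul_comm]
  · rw [Set.indicator_of_notMem hx, ENNReal.zero_rpow_of_pos (by positivity)]
    exact zero_le

/-- The exponent `p` with `1 / p = a`, with `p = ∞` for `a = 0`. -/
def expInv (a : ℝ) : ℝ≥0∞ := (ENNReal.ofReal a)⁻¹

lemma toReal_expInv {a : ℝ} (ha : 0 < a) : (expInv a).toReal = 1 / a := by
  rw [expInv, ENNReal.toReal_inv, ENNReal.toReal_ofReal ha.le, one_div]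

lemma expInv_ne_zero (a : ℝ) : expInv a ≠ 0 := by simp [expInv]

lemma expInv_ne_top {a : ℝ} (ha : 0 < a) : expInv a ≠ ⊤ := by simp [expInv, ha]

lemma expInv_zero : expInv 0 = ⊤ := by simp [expInv]

lemma expInv_half : expInv (1 / 2) = 2 := by
  rw [expInv, one_div, ENNReal.ofReal_inv_of_pos two_pos, inv_inv]
  simp

lemma memLp_expInv_iff {F : Type*} [NormedAddCommGroup F] {f : Pos n → F} {a : ℝ} (ha : 0 < a) :
    MemLp f (expInv a) volume
      ↔ AEStronglyMeasurable f volume ∧ ∫⁻ x, ‖f x‖ₑ ^ (1 / a) < ⊤ := by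
  refine and_congr_right fun _ => ?_
  rw [eLpNorm_lt_top_iff_lintegral_rpow_enorm_lt_top (expInv_ne_zero a) (expInv_ne_top ha),
    toReal_expInv ha]

lemma expInv_holder {a b : ℝ} (ha : 0 ≤ a) (hb : 0 ≤ b) :
    ENNReal.HolderTriple (expInv a) (expInv b) (expInv (a + b)) :=
  ⟨by simp only [expInv, inv_inv, ENNReal.ofReal_add ha hb]⟩

lemma lintegral_enorm_rpow_ne_top {F : Type*} [NormedAddCommGroup F] {f : Pos n → F} {a : ℝ}
    (ha : 0 < a) (hf : MemLp f (expInv a) volume) {v : Pos n → ℝ≥0∞}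
    (hv : ∀ᵐ y, ‖f y‖ₑ = v y) : ∫⁻ y, v y ^ (1 / a) ≠ ⊤ := by
  have h := ((memLp_expInv_iff ha).1 hf).2.ne
  rwa [lintegral_congr_ae (hv.mono fun y hy => by rw [hy])] at h

lemma rpow_one_div_rpow (t : ℝ≥0∞) {a : ℝ} (ha : 0 < a) : (t ^ (1 / a)) ^ a = t := by
  rw [← ENNReal.rpow_mul, one_div_mul_cancel ha.ne', ENNReal.rpow_one]

lemma lintegral_rieszKernel_split {v : Pos n → ℝ≥0∞} (hv : Measurable v) (x : Pos n) :
    ∫⁻ y, ENNReal.ofReal (rieszKernel (x - y)) * v y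
      = (∫⁻ y, rieszNear (x - y) * v y) + ∫⁻ y, rieszFar (x - y) * v y := by
  have hm : Measurable fun y => rieszNear (x - y) * v y :=
    (measurable_rieszNear.comp (measurable_const.sub measurable_id)).mul hv
  rw [← lintegral_add_left hm]
  simp only [← rieszNear_add_rieszFar, add_mul]

/-- Mapping properties of the Riesz potential of order one in Lebesgue spaces, with reciprocal
exponents: if `f` lies in the spaces with reciprocal exponents `a₁` and `a₂`, then its Riesz
potential lies in those with reciprocal exponent strictly between `a₂ - 1/n` and `a₁ - 1/n`. -/
lemma memLp_of_le_rieszPotential (hn : 2 ≤ n) {F G : Type*} [NormedAddCommGroup F]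
    [NormedAddCommGroup G] {f : Pos n → F} {g : Pos n → G} {C : ℝ≥0∞} (hC : C ≠ ⊤)
    (hg : AEStronglyMeasurable g volume)
    (hgf : ∀ x, ‖g x‖ₑ ≤ C * ∫⁻ y, ENNReal.ofReal (rieszKernel (x - y)) * ‖f y‖ₑ)
    {a₁ a₂ b : ℝ} (hf₁ : MemLp f (expInv a₁) volume) (hf₂ : MemLp f (expInv a₂) volume)
    (hb : 0 < b) (ha₁ : a₁ ≤ 1) (hb₁ : b < a₁ - 1 / n) (hb₂ : a₂ - 1 / n < b)
    (hba : b ≤ a₂) : MemLp g (expInv b) volume := by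
  have hn0 : (0 : ℝ) < n := by exact_mod_cast (by omega : 0 < n)
  have hn1 : 0 < 1 / (n : ℝ) := by positivity
  have hn2 : 1 / (n : ℝ) < 1 := by
    rw [div_lt_one hn0]
    exact_mod_cast (by omega : 1 < n)
  rw [memLp_expInv_iff hb]
  refine ⟨hg, ?_⟩
  set v := hf₁.1.enorm.mk with hv
  have hvm : Measurable v := hf₁.1.enorm.measurable_mk
  have hfv : ∀ᵐ y, ‖f y‖ₑ = v y := hf₁.1.enorm.ae_eq_mk
  have hnear := lintegral_convolution_rpow_lt_top
    (measurable_rieszNear.pow_const (1 / (1 + b - a₂))) (hvm.pow_const (1 / a₂))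
    (lintegral_rieszNear_rpow_ne_top hn (by linarith) (by linarith))
    (lintegral_enorm_rpow_ne_top (by linarith) hf₂ hfv) hb hba (by linarith)
    (by ring : a₂ + (1 + b - a₂) = 1 + b)
  have hfar := lintegral_convolution_rpow_lt_top
    (measurable_rieszFar.pow_const (1 / (1 + b - a₁))) (hvm.pow_const (1 / a₁))
    (lintegral_rieszFar_rpow_ne_top hn (by linarith) (by linarith))
    (lintegral_enorm_rpow_ne_top (by linarith) hf₁ hfv) hb (by linarith) (by linarith)
    (by ring : a₁ + (1 + b - a₁) = 1 + b)
  simp only [rpow_one_div_rpow _ (by linarith : 0 < a₂),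
    rpow_one_div_rpow _ (by linarith : 0 < 1 + b - a₂)] at hnear
  simp only [rpow_one_div_rpow _ (by linarith : 0 < a₁),
    rpow_one_div_rpow _ (by linarith : 0 < 1 + b - a₁)] at hfar
  have hb' : 0 ≤ 1 / b := by positivity
  have hb1 : 1 ≤ 1 / b := by
    rw [one_le_div hb]
    linarith
  set D : ℝ≥0∞ := C ^ (1 / b) * 2 ^ (1 / b - 1)
  calc ∫⁻ x, ‖g x‖ₑ ^ (1 / b)
      ≤ ∫⁻ x, D * ((∫⁻ y, rieszNear (x - y) * v y) ^ (1 / b)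
          + (∫⁻ y, rieszFar (x - y) * v y) ^ (1 / b)) := by
        refine lintegral_mono fun x => ?_
        have h1 : ‖g x‖ₑ ≤ C * ((∫⁻ y, rieszNear (x - y) * v y)
            + ∫⁻ y, rieszFar (x - y) * v y) := by
          rw [← lintegral_rieszKernel_split hvm]
          refine (hgf x).trans (le_of_eq ?_)
          congr 1
          exact lintegral_congr_ae (hfv.mono fun y hy => by simp only [hy])
        refine (ENNReal.rpow_le_rpow h1 hb').trans ?_
        rw [ENNReal.mul_rpow_of_nonneg _ _ hb', mul_assoc]
        gcongr
        exact ENNReal.rpow_add_le_mul_rpow_add_rpow _ _ hb1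
    _ = D * ((∫⁻ x, (∫⁻ y, rieszNear (x - y) * v y) ^ (1 / b))
          + ∫⁻ x, (∫⁻ y, rieszFar (x - y) * v y) ^ (1 / b)) := by
        have hm : Measurable fun x => (∫⁻ y, rieszNear (x - y) * v y) ^ (1 / b) :=
          ((measurable_sub_uncurry measurable_rieszNear hvm).lintegral_prod_right').pow_const _
        have hm' : Measurable fun x => (∫⁻ y, rieszFar (x - y) * v y) ^ (1 / b) :=
          ((measurable_sub_uncurry measurable_rieszFar hvm).lintegral_prod_right').pow_const _
        have hm2 : Measurable fun x => (∫⁻ y, rieszNear (x - y) * v y) ^ (1 / b)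
            + (∫⁻ y, rieszFar (x - y) * v y) ^ (1 / b) := hm.add hm'
        rw [lintegral_const_mul _ hm2, lintegral_add_left hm]
    _ < ⊤ := ENNReal.mul_lt_top
        (ENNReal.mul_lt_top (ENNReal.rpow_lt_top_of_nonneg hb' hC)
          (ENNReal.rpow_lt_top_of_nonneg (by linarith) (by simp)))
        (ENNReal.add_lt_top.2 ⟨hnear, hfar⟩)

lemma lintegral_mul_rpow_le {u v : Pos n → ℝ≥0∞} (hu : Measurable u) (hv : Measurable v)
    {a c : ℝ} (ha : 0 ≤ a) (hc : 0 ≤ c) (hac : c + a = 1) (x : Pos n) :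
    ∫⁻ y, u (x - y) ^ c * v y ^ a ≤ (∫⁻ y, u y) ^ c * (∫⁻ y, v y) ^ a := by
  have hux : Measurable fun y => u (x - y) := hu.comp (measurable_const.sub measurable_id)
  refine (ENNReal.lintegral_mul_norm_pow_le hux.aemeasurable hv.aemeasurable hc ha hac).trans ?_
  rw [lintegral_comp_sub_left x]

/-- The endpoint `b = 0` of `memLp_of_le_rieszPotential`. -/
lemma memLp_top_of_le_rieszPotential (hn : 2 ≤ n) {F G : Type*} [NormedAddCommGroup F]
    [NormedAddCommGroup G] {f : Pos n → F} {g : Pos n → G} {C : ℝ≥0∞} (hC : C ≠ ⊤)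
    (hg : AEStronglyMeasurable g volume)
    (hgf : ∀ x, ‖g x‖ₑ ≤ C * ∫⁻ y, ENNReal.ofReal (rieszKernel (x - y)) * ‖f y‖ₑ)
    {a₁ a₂ : ℝ} (hf₁ : MemLp f (expInv a₁) volume) (hf₂ : MemLp f (expInv a₂) volume)
    (ha₁ : a₁ < 1) (ha₂ : 0 < a₂) (hb₁ : 1 / (n : ℝ) < a₁) (hb₂ : a₂ < 1 / (n : ℝ)) :
    MemLp g ⊤ volume := by
  have hn0 : (0 : ℝ) < n := by exact_mod_cast (by omega : 0 < n)
  have hn1 : 0 < 1 / (n : ℝ) := by positivity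
  set v := hf₁.1.enorm.mk with hv
  have hvm : Measurable v := hf₁.1.enorm.measurable_mk
  have hfv : ∀ᵐ y, ‖f y‖ₑ = v y := hf₁.1.enorm.ae_eq_mk
  have hnear := lintegral_mul_rpow_le
    (measurable_rieszNear.pow_const (1 / (1 - a₂))) (hvm.pow_const (1 / a₂)) ha₂.le
    (by linarith : 0 ≤ 1 - a₂) (by ring)
  have hfar := lintegral_mul_rpow_le
    (measurable_rieszFar.pow_const (1 / (1 - a₁))) (hvm.pow_const (1 / a₁)) (by linarith : 0 ≤ a₁)
    (by linarith : 0 ≤ 1 - a₁) (by ring)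
  simp only [rpow_one_div_rpow _ ha₂, rpow_one_div_rpow _ (by linarith : 0 < 1 - a₂)] at hnear
  simp only [rpow_one_div_rpow _ (by linarith : 0 < a₁),
    rpow_one_div_rpow _ (by linarith : 0 < 1 - a₁)] at hfar
  set N₂ := (∫⁻ y : Pos n, rieszNear y ^ (1 / (1 - a₂))) ^ (1 - a₂)
    * (∫⁻ y, v y ^ (1 / a₂)) ^ a₂ with hN₂
  set N₁ := (∫⁻ y : Pos n, rieszFar y ^ (1 / (1 - a₁))) ^ (1 - a₁)
    * (∫⁻ y, v y ^ (1 / a₁)) ^ a₁ with hN₁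
  have hN₂t : N₂ ≠ ⊤ := ENNReal.mul_ne_top
    (ENNReal.rpow_ne_top_of_nonneg (by linarith)
      (lintegral_rieszNear_rpow_ne_top hn (by linarith) (by linarith)))
    (ENNReal.rpow_ne_top_of_nonneg ha₂.le (lintegral_enorm_rpow_ne_top ha₂ hf₂ hfv))
  have hN₁t : N₁ ≠ ⊤ := ENNReal.mul_ne_top
    (ENNReal.rpow_ne_top_of_nonneg (by linarith)
      (lintegral_rieszFar_rpow_ne_top hn (by linarith) (by linarith)))
    (ENNReal.rpow_ne_top_of_nonneg (by linarith)
      (lintegral_enorm_rpow_ne_top (by linarith) hf₁ hfv))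
  refine ⟨hg, ?_⟩
  rw [eLpNorm_exponent_top]
  refine lt_of_le_of_lt (eLpNormEssSup_le_of_ae_enorm_bound (C := C * (N₂ + N₁))
    (Eventually.of_forall fun x => ?_))
    (ENNReal.mul_lt_top hC.lt_top (ENNReal.add_lt_top.2 ⟨hN₂t.lt_top, hN₁t.lt_top⟩))
  refine (hgf x).trans ?_
  rw [lintegral_congr_ae (hfv.mono fun y hy => by
    show ENNReal.ofReal (rieszKernel (x - y)) * ‖f y‖ₑ = _
    rw [hy]), lintegral_rieszKernel_split hvm]
  gcongr
  · exact hnear x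
  · exact hfar x

/-! ### Matrices acting on spinors -/

open Matrix (toEuclideanLin)

lemma toEuclideanLin_mul_apply (A B : Mat n) (v : Spinor n) :
    toEuclideanLin (A * B) v = toEuclideanLin A (toEuclideanLin B v) := by
  simp

lemma toEuclideanLin_one_apply (v : Spinor n) : toEuclideanLin (1 : Mat n) v = v := by
  simp

lemma continuous_toEuclideanLin :
    Continuous fun p : Mat n × Spinor n => toEuclideanLin p.1 p.2 := by
  simp only [Matrix.toLpLin_apply]
  refine (PiLp.continuous_toLp 2 _).comp ?_
  exact Continuous.matrix_mulVec continuous_fst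
    ((PiLp.continuous_ofLp 2 _).comp continuous_snd)

lemma aestronglyMeasurable_toEuclideanLin {β : Type*} [MeasurableSpace β] {μ : Measure β}
    {A : β → Mat n} {v : β → Spinor n} (hA : AEStronglyMeasurable A μ)
    (hv : AEStronglyMeasurable v μ) :
    AEStronglyMeasurable (fun x => toEuclideanLin (A x) (v x)) μ :=
  Continuous.comp_aestronglyMeasurable (g := fun p : Mat n × Spinor n => toEuclideanLin p.1 p.2)
    (f := fun x => (A x, v x)) continuous_toEuclideanLin (hA.prodMk hv)

lemma norm_toEuclideanLin_le (A : Mat n) (v : Spinor n) :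
    ‖toEuclideanLin A v‖ ≤ (∑ l, ∑ m, ‖A l m‖) * ‖v‖ := by
  have h1 : toEuclideanLin A v
      = ∑ l, (∑ m, A l m * v m) • EuclideanSpace.single l (1 : ℂ) := by
    ext i
    simp [Matrix.toLpLin_apply, Matrix.mulVec, dotProduct, Pi.single_apply]
  rw [h1, Finset.sum_mul]
  refine (norm_sum_le _ _).trans (Finset.sum_le_sum fun l _ => ?_)
  rw [norm_smul, PiLp.norm_single, norm_one, mul_one, Finset.sum_mul]
  refine (norm_sum_le _ _).trans (Finset.sum_le_sum fun m _ => ?_)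
  rw [norm_mul]
  gcongr
  exact PiLp.norm_apply_le v m

/-- If `S⁴ = A²`, then `S² v` and `A v` have the same norm, so that
`‖S v‖² = ⟨v, S² v⟩ ≤ ‖A v‖ ‖v‖`. -/
lemma norm_sq_toEuclideanLin_le {S A : Mat n} (hS : S.IsHermitian) (hA : A.IsHermitian)
    (h : S * S * (S * S) = A * A) (v : Spinor n) :
    ‖toEuclideanLin S v‖ ^ 2 ≤ ‖toEuclideanLin A v‖ * ‖v‖ := by
  have key : ∀ {B : Mat n}, B.IsHermitian →
      ‖toEuclideanLin B v‖ ^ 2 = RCLike.re (inner ℂ v (toEuclideanLin (B * B) v)) := by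
    intro B hB
    have hadj : (toEuclideanLin B).adjoint = toEuclideanLin B := by
      rw [← Matrix.toEuclideanLin_conjTranspose_eq_adjoint, hB.eq]
    rw [← inner_self_eq_norm_sq (𝕜 := ℂ), toEuclideanLin_mul_apply]
    conv_rhs => rw [← hadj]
    rw [LinearMap.adjoint_inner_right, hadj]
  have hSS : (S * S).IsHermitian := by
    rw [Matrix.IsHermitian, Matrix.conjTranspose_mul, hS.eq]
  have h1 : ‖toEuclideanLin (S * S) v‖ = ‖toEuclideanLin A v‖ := by
    rw [← sq_eq_sq₀ (norm_nonneg _) (norm_nonneg _), key hSS, key hA, h]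
  rw [key hS, ← h1, mul_comm]
  exact (RCLike.re_le_norm _).trans (norm_inner_le_norm _ _)

/-! ### Functional calculus for the potential -/

section

open scoped Matrix.Norms.L2Operator

lemma continuousOn_cfc_isHermitian {f : ℝ → ℝ} (hf : Continuous f) :
    ContinuousOn (fun A : Mat n => cfc f A) {A | A.IsHermitian} :=
  ContinuousOn.cfc_of_mem_nhdsSet (s := Set.univ) f Filter.univ_mem continuousOn_id
    (fun _ h => h) hf.continuousOn

end

lemma aestronglyMeasurable_cfc {f : ℝ → ℝ} (hf : Continuous f) {V : Pos n → Mat n}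
    (hV : AEStronglyMeasurable V volume) (hVh : ∀ᵐ x, (V x).IsHermitian) :
    AEStronglyMeasurable (fun x => cfc f (V x)) volume := by
  -- precomposition with the Hermitian part gives a function that is continuous everywhere
  have hH : ∀ A : Mat n, ((1 / 2 : ℝ) • (A + A.conjTranspose)).IsHermitian := by
    intro A
    simp [Matrix.IsHermitian, Matrix.conjTranspose_smul, add_comm]
  have hc : Continuous fun A : Mat n => cfc f ((1 / 2 : ℝ) • (A + A.conjTranspose)) :=
    (continuousOn_cfc_isHermitian hf).comp_continuous (by fun_prop) hH
  refine (hc.comp_aestronglyMeasurable hV).congr ?_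
  filter_upwards [hVh] with x hx
  rw [hx.eq, ← two_smul ℝ (V x), smul_smul]
  norm_num

lemma continuousOn_spectrum (f : ℝ → ℝ) (A : Mat n) : ContinuousOn f (spectrum ℝ A) :=
  A.finite_real_spectrum.continuousOn f

lemma isHermitian_cfc (f : ℝ → ℝ) (A : Mat n) : (cfc f A).IsHermitian :=
  cfc_predicate (R := ℝ) (p := IsSelfAdjoint) f A

lemma polarSign_mul_sqrtAbs (A : Mat n) :
    polarSign A * sqrtAbs A = cfc (fun t : ℝ => Real.sign t * Real.sqrt |t|) A :=
  (cfc_mul _ _ A (continuousOn_spectrum _ A) (continuousOn_spectrum _ A)).symm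

lemma sign_mul_abs (t : ℝ) : Real.sign t * |t| = t := by
  rcases lt_trichotomy t 0 with h | rfl | h
  · simp [Real.sign_of_neg h, abs_of_neg h]
  · simp
  · simp [Real.sign_of_pos h, abs_of_pos h]

lemma sqrtAbs_mul_polarSign_mul_sqrtAbs {A : Mat n} (hA : A.IsHermitian) :
    sqrtAbs A * (polarSign A * sqrtAbs A) = A := by
  have hA' : IsSelfAdjoint A := hA
  rw [polarSign_mul_sqrtAbs, sqrtAbs,
    ← cfc_mul _ _ A (continuousOn_spectrum _ A) (continuousOn_spectrum _ A)]
  conv_rhs => rw [← cfc_id ℝ A hA']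
  refine cfc_congr fun t _ => ?_
  simp only [id]
  rw [mul_left_comm, Real.mul_self_sqrt (abs_nonneg t), sign_mul_abs]

lemma cfc_mul_self_mul_self {f : ℝ → ℝ} (hf : ∀ t, f t ^ 4 = t ^ 2) {A : Mat n}
    (hA : A.IsHermitian) : cfc f A * cfc f A * (cfc f A * cfc f A) = A * A := by
  have hA' : IsSelfAdjoint A := hA
  have hc := fun g : ℝ → ℝ => continuousOn_spectrum g A
  rw [← cfc_mul _ _ A (hc _) (hc _), ← cfc_mul _ _ A (hc _) (hc _)]
  conv_rhs => rw [← cfc_id ℝ A hA', ← cfc_mul _ _ A (hc _) (hc _)]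
  refine cfc_congr fun t _ => ?_
  have := hf t
  simp only [id]
  linear_combination this

lemma sqrt_abs_pow_four (t : ℝ) : Real.sqrt |t| ^ 4 = t ^ 2 := by
  rw [show 4 = 2 * 2 from rfl, pow_mul, Real.sq_sqrt (abs_nonneg t), sq_abs]

lemma sign_mul_sqrt_abs_pow_four (t : ℝ) : (Real.sign t * Real.sqrt |t|) ^ 4 = t ^ 2 := by
  rw [mul_pow, sqrt_abs_pow_four]
  rcases lt_trichotomy t 0 with h | rfl | h
  · simp [Real.sign_of_neg h, show (-1 : ℝ) ^ 4 = 1 by norm_num]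
  · simp
  · simp [Real.sign_of_pos h]

lemma continuous_sign_mul_sqrt_abs : Continuous fun t : ℝ => Real.sign t * Real.sqrt |t| := by
  have h : (fun t : ℝ => Real.sign t * Real.sqrt |t|)
      = fun t => Real.sqrt t - Real.sqrt (-t) := by
    ext t
    rcases lt_trichotomy t 0 with h | rfl | h
    · simp [Real.sign_of_neg h, abs_of_neg h, Real.sqrt_eq_zero_of_nonpos h.le]
    · simp
    · simp [Real.sign_of_pos h, abs_of_pos h,
        Real.sqrt_eq_zero_of_nonpos (neg_nonpos.2 h.le)]
  rw [h]
  fun_prop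

lemma conjTranspose_V₁ (V : Pos n → Mat n) (x : Pos n) : (V₁ V x).conjTranspose = V₁ V x :=
  (isHermitian_cfc _ (V x)).eq

lemma IsAdmissiblePotential.aestronglyMeasurable {V : Pos n → Mat n}
    (hV : IsAdmissiblePotential V) : AEStronglyMeasurable V volume := by
  have h : V = fun x => ∑ l, ∑ m, V x l m • Matrix.single l m (1 : ℂ) := by
    ext x : 1
    conv_lhs => rw [Matrix.matrix_eq_sum_single (V x)]
    simp
  rw [h]
  exact Finset.aestronglyMeasurable_fun_sum _ fun l _ =>
    Finset.aestronglyMeasurable_fun_sum _ fun m _ => (hV.memLp_top l m).1.smul_const _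

lemma IsAdmissiblePotential.aestronglyMeasurable_V₁ {V : Pos n → Mat n}
    (hV : IsAdmissiblePotential V) : AEStronglyMeasurable (V₁ V) volume :=
  aestronglyMeasurable_cfc (by fun_prop) hV.aestronglyMeasurable hV.selfAdjoint

lemma IsAdmissiblePotential.aestronglyMeasurable_V₂ {V : Pos n → Mat n}
    (hV : IsAdmissiblePotential V) : AEStronglyMeasurable (V₂ V) volume := by
  unfold V₂
  simp only [polarSign_mul_sqrtAbs]
  exact aestronglyMeasurable_cfc continuous_sign_mul_sqrt_abs hV.aestronglyMeasurable
    hV.selfAdjoint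

lemma inv_bracket_sq_le (x : Pos n) : (bracket x ^ 2)⁻¹ ≤ 2 * ((1 + ‖x‖)⁻¹) ^ 2 := by
  rw [bracket, Real.sq_sqrt (by positivity), inv_pow, ← div_eq_mul_inv,
    inv_le_comm₀ (by positivity) (by positivity), inv_div, div_le_iff₀ two_pos]
  nlinarith [sq_nonneg (1 - ‖x‖)]

lemma IsAdmissiblePotential.exists_norm_le {V : Pos n → Mat n} (hV : IsAdmissiblePotential V) :
    ∃ C, 0 ≤ C ∧ ∀ᵐ x, ∀ v : Spinor n,
      ‖toEuclideanLin (V x) v‖ ≤ C ^ 2 * ((1 + ‖x‖)⁻¹) ^ 2 * ‖v‖ := by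
  obtain ⟨C, hC0, hC⟩ := hV.decay
  simp only [← ae_all_iff] at hC
  set K : ℝ := ∑ _l : Fin (spinorDim n), ∑ _m : Fin (spinorDim n), C * 2 with hK
  have hK0 : 0 ≤ K := Finset.sum_nonneg fun _ _ => Finset.sum_nonneg fun _ _ => by positivity
  refine ⟨Real.sqrt K, Real.sqrt_nonneg _, ?_⟩
  filter_upwards [hC] with x hx v
  refine (norm_toEuclideanLin_le _ _).trans ?_
  rw [Real.sq_sqrt hK0]
  refine mul_le_mul_of_nonneg_right ?_ (norm_nonneg v)
  rw [hK, Finset.sum_mul]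
  refine Finset.sum_le_sum fun l _ => ?_
  rw [Finset.sum_mul]
  refine Finset.sum_le_sum fun m _ => (hx l m).trans ?_
  rw [mul_assoc]
  gcongr
  exact inv_bracket_sq_le x

lemma norm_cfc_le {f : ℝ → ℝ} (hf : ∀ t, f t ^ 4 = t ^ 2) {A : Mat n} (hA : A.IsHermitian)
    {b : ℝ} (hb : 0 ≤ b) (h : ∀ v : Spinor n, ‖toEuclideanLin A v‖ ≤ b ^ 2 * ‖v‖)
    (v : Spinor n) : ‖toEuclideanLin (cfc f A) v‖ ≤ b * ‖v‖ := by
  refine le_of_sq_le_sq ?_ (by positivity)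
  refine (norm_sq_toEuclideanLin_le (isHermitian_cfc f A) hA (cfc_mul_self_mul_self hf hA)
    v).trans ?_
  calc ‖toEuclideanLin A v‖ * ‖v‖ ≤ b ^ 2 * ‖v‖ * ‖v‖ := by
        gcongr
        exact h v
    _ = (b * ‖v‖) ^ 2 := by ring

/-- `V` decays like `|x|⁻²`, and its square roots `V₁` and `V₂` like `|x|⁻¹`. -/
lemma IsAdmissiblePotential.exists_bounds {V : Pos n → Mat n} (hV : IsAdmissiblePotential V) :
    ∃ C, 0 ≤ C ∧ ∀ᵐ x, ∀ v : Spinor n,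
      ‖toEuclideanLin (V x) v‖ ≤ C ^ 2 * ((1 + ‖x‖)⁻¹) ^ 2 * ‖v‖ ∧
      ‖toEuclideanLin (V₁ V x) v‖ ≤ C * (1 + ‖x‖)⁻¹ * ‖v‖ ∧
      ‖toEuclideanLin (V₂ V x) v‖ ≤ C * (1 + ‖x‖)⁻¹ * ‖v‖ := by
  obtain ⟨C, hC0, hC⟩ := hV.exists_norm_le
  refine ⟨C, hC0, ?_⟩
  filter_upwards [hC, hV.selfAdjoint] with x hx hsa v
  have hx' : ∀ v : Spinor n, ‖toEuclideanLin (V x) v‖ ≤ (C * (1 + ‖x‖)⁻¹) ^ 2 * ‖v‖ := by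
    simpa only [mul_pow] using hx
  refine ⟨hx v, norm_cfc_le sqrt_abs_pow_four hsa (by positivity) hx' v, ?_⟩
  rw [V₂, polarSign_mul_sqrtAbs]
  exact norm_cfc_le sign_mul_sqrt_abs_pow_four hsa (by positivity) hx' v

lemma IsAdmissiblePotential.V₁_V₂_apply {V : Pos n → Mat n} (hV : IsAdmissiblePotential V) :
    ∀ᵐ x, ∀ v : Spinor n, toEuclideanLin (V₁ V x).conjTranspose (toEuclideanLin (V₂ V x) v)
      = toEuclideanLin (V x) v := by
  filter_upwards [hV.selfAdjoint] with x hx v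
  rw [conjTranspose_V₁, ← toEuclideanLin_mul_apply, V₁, V₂,
    sqrtAbs_mul_polarSign_mul_sqrtAbs hx]

/-- The Clifford relations reduce a contraction with a symmetric tensor to its trace. -/
lemma IsDiracFamily.sum_symm {α : Fin (n + 1) → Mat n} (hα : IsDiracFamily α)
    {m : Fin n → Fin n → Spinor n} (hm : ∀ j l, m j l = m l j) :
    ∑ j, ∑ l, toEuclideanLin (α j.castSucc) (toEuclideanLin (α l.castSucc) (m j l))
      = ∑ j, m j j := by
  have h2 : ∀ j l : Fin n, toEuclideanLin (α j.castSucc) (toEuclideanLin (α l.castSucc) (m j l))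
      + toEuclideanLin (α l.castSucc) (toEuclideanLin (α j.castSucc) (m j l))
      = if j = l then (2 : ℂ) • m j l else 0 := by
    intro j l
    rw [← toEuclideanLin_mul_apply, ← toEuclideanLin_mul_apply, ← LinearMap.add_apply, ← map_add,
      hα.anticomm]
    by_cases h : j = l
    · subst h
      rw [if_pos rfl, if_pos rfl, map_smul, LinearMap.smul_apply, toEuclideanLin_one_apply]
    · rw [if_neg (by simpa using h), if_neg h]
      simp
  have hswap : ∑ j, ∑ l, toEuclideanLin (α l.castSucc) (toEuclideanLin (α j.castSucc) (m j l))
      = ∑ j, ∑ l, toEuclideanLin (α j.castSucc) (toEuclideanLin (α l.castSucc) (m j l)) := by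
    rw [Finset.sum_comm]
    exact Finset.sum_congr rfl fun j _ => Finset.sum_congr rfl fun l _ => by rw [hm l j]
  have h3 : (2 : ℂ) • ∑ j, ∑ l,
      toEuclideanLin (α j.castSucc) (toEuclideanLin (α l.castSucc) (m j l))
      = (2 : ℂ) • ∑ j, m j j := by
    rw [two_smul]
    nth_rewrite 2 [← hswap]
    simp only [← Finset.sum_add_distrib, h2]
    simp [Finset.smul_sum]
  exact smul_right_injective _ (two_ne_zero' ℂ) h3

/-! ### The free resolvent at zero energy -/

lemma half_mul_pi_rpow_mul_Gamma (hn : 2 ≤ n) :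
    1 / 2 * (Real.pi ^ (-(n : ℝ) / 2) * Real.Gamma ((n : ℝ) / 2)) = (sphereArea n)⁻¹ := by
  rw [sphereArea_eq hn, neg_div, Real.rpow_neg Real.pi_pos.le, inv_div]
  have := Real.rpow_pos_of_pos Real.pi_pos ((n : ℝ) / 2)
  field_simp

lemma toEuclideanLin_green (hn : 2 ≤ n) (α : Fin (n + 1) → Mat n) (x : Pos n) (v : Spinor n) :
    toEuclideanLin (green α x) v
      = (Complex.I / (sphereArea n : ℂ)) •
        ∑ j : Fin n, gradNewton j x • toEuclideanLin (α j.castSucc) v := by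
  have h : ∀ j : Fin n, Complex.I / 2 * ((Real.pi ^ (-(n : ℝ) / 2) * Real.Gamma ((n : ℝ) / 2)
      * (‖x‖ ^ n)⁻¹ : ℝ) : ℂ) * (x j : ℂ)
      = Complex.I / (sphereArea n : ℂ) * (gradNewton j x : ℂ) := by
    intro j
    rw [div_eq_mul_inv Complex.I (sphereArea n : ℂ), ← Complex.ofReal_inv,
      ← half_mul_pi_rpow_mul_Gamma hn, gradNewton]
    push_cast
    ring
  simp only [green, alphaDot, map_smul, LinearMap.smul_apply, map_sum, LinearMap.sum_apply,
    Finset.smul_sum, smul_smul, h]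
  refine Finset.sum_congr rfl fun j _ => ?_
  rw [mul_smul, Complex.coe_smul]

/-- A bound for the operator norm of the Green's function in terms of the Riesz kernel. -/
def greenBound (α : Fin (n + 1) → Mat n) : ℝ :=
  ‖(Complex.I / (sphereArea n : ℂ))‖ * ∑ j : Fin n, ∑ l, ∑ m, ‖α j.castSucc l m‖

lemma greenBound_nonneg (α : Fin (n + 1) → Mat n) : 0 ≤ greenBound α := by
  unfold greenBound
  positivity

lemma norm_green_le (hn : 2 ≤ n) (α : Fin (n + 1) → Mat n) (x : Pos n) (v : Spinor n) :
    ‖toEuclideanLin (green α x) v‖ ≤ greenBound α * (rieszKernel x * ‖v‖) := by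
  rw [toEuclideanLin_green hn, norm_smul, greenBound, mul_assoc]
  refine mul_le_mul_of_nonneg_left ?_ (norm_nonneg _)
  rw [Finset.sum_mul]
  refine (norm_sum_le _ _).trans (Finset.sum_le_sum fun j _ => ?_)
  rw [norm_smul, Real.norm_eq_abs]
  calc |gradNewton j x| * ‖toEuclideanLin (α j.castSucc) v‖
      ≤ rieszKernel x * ((∑ l, ∑ m, ‖α j.castSucc l m‖) * ‖v‖) :=
        mul_le_mul (abs_gradNewton_le hn j x) (norm_toEuclideanLin_le _ _) (norm_nonneg _)
          (rieszKernel_nonneg x)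
    _ = _ := by ring

lemma aestronglyMeasurable_const_toEuclideanLin {β : Type*} [MeasurableSpace β] {μ : Measure β}
    (A : Mat n) {v : β → Spinor n} (hv : AEStronglyMeasurable v μ) :
    AEStronglyMeasurable (fun x => toEuclideanLin A (v x)) μ :=
  aestronglyMeasurable_toEuclideanLin aestronglyMeasurable_const hv

lemma aestronglyMeasurable_green_sub (hn : 2 ≤ n) (α : Fin (n + 1) → Mat n)
    {f : Pos n → Spinor n} (hf : AEStronglyMeasurable f volume) :
    AEStronglyMeasurable (fun p : Pos n × Pos n => toEuclideanLin (green α (p.1 - p.2)) (f p.2))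
      ((volume : Measure (Pos n)).prod volume) := by
  simp only [toEuclideanLin_green hn]
  have hk : ∀ j : Fin n, AEStronglyMeasurable (fun p : Pos n × Pos n => gradNewton j (p.1 - p.2))
      ((volume : Measure (Pos n)).prod volume) := fun j =>
    ((measurable_gradNewton j).comp (measurable_fst.sub measurable_snd)).aestronglyMeasurable
  exact AEStronglyMeasurable.const_smul (Finset.aestronglyMeasurable_fun_sum _ fun j _ =>
    (hk j).smul (aestronglyMeasurable_const_toEuclideanLin (α j.castSucc) hf.comp_snd))
    (Complex.I / (sphereArea n : ℂ))

lemma aestronglyMeasurable_freeResolvent (hn : 2 ≤ n) (α : Fin (n + 1) → Mat n)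
    {f : Pos n → Spinor n} (hf : AEStronglyMeasurable f volume) :
    AEStronglyMeasurable (freeResolvent α f) volume :=
  (aestronglyMeasurable_green_sub hn α hf).integral_prod_right'

/-- The free resolvent is dominated by the Riesz potential of order one. -/
lemma enorm_freeResolvent_le (hn : 2 ≤ n) (α : Fin (n + 1) → Mat n) (f : Pos n → Spinor n)
    (x : Pos n) :
    ‖freeResolvent α f x‖ₑ ≤ ENNReal.ofReal (greenBound α)
      * ∫⁻ y, ENNReal.ofReal (rieszKernel (x - y)) * ‖f y‖ₑ := by
  refine (enorm_integral_le_lintegral_enorm _).trans ?_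
  rw [← lintegral_const_mul' _ _ ENNReal.ofReal_ne_top]
  refine lintegral_mono fun y => ?_
  rw [← ofReal_norm, ← ofReal_norm, ← ENNReal.ofReal_mul (rieszKernel_nonneg _),
    ← ENNReal.ofReal_mul (greenBound_nonneg α)]
  exact ENNReal.ofReal_le_ofReal (norm_green_le hn α _ _)

/-- Square integrability of `(1 + |x|) f`. -/
def WeightedL2 (f : Pos n → Spinor n) : Prop :=
  MemLp (fun y => (1 + ‖y‖) • f y) 2 volume

lemma WeightedL2.aestronglyMeasurable {f : Pos n → Spinor n} (hf : WeightedL2 f) :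
    AEStronglyMeasurable f volume := by
  have hm : Measurable fun y : Pos n => (1 + ‖y‖)⁻¹ := by fun_prop
  refine (hm.aestronglyMeasurable.smul hf.1).congr (Eventually.of_forall fun y => ?_)
  have : 1 + ‖y‖ ≠ 0 := by positivity
  simp [smul_smul, this]

lemma WeightedL2.memLp {f : Pos n → Spinor n} (hf : WeightedL2 f) : MemLp f 2 volume := by
  refine MemLp.mono hf hf.aestronglyMeasurable (Eventually.of_forall fun y => ?_)
  rw [norm_smul, Real.norm_of_nonneg (by positivity)]
  nlinarith [norm_nonneg y, norm_nonneg (f y)]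

lemma memLp_two_inv_one_add_norm_pow (hn : 2 ≤ n) :
    MemLp (fun x : Pos n => ((1 + ‖x‖) ^ n)⁻¹) 2 volume :=
  (memLp_two_iff_integrable_sq (by
    have : Measurable fun x : Pos n => ((1 + ‖x‖) ^ n)⁻¹ := by fun_prop
    exact this.aestronglyMeasurable)).2 (integrable_sq_inv_one_add_norm_pow hn)

lemma WeightedL2.integrable_bound (hn : 2 ≤ n) {f : Pos n → Spinor n} (hf : WeightedL2 f) :
    Integrable (fun y => ((1 + ‖y‖) ^ (n - 1))⁻¹ * ‖f y‖) volume := by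
  refine ((memLp_two_inv_one_add_norm_pow hn).integrable_mul hf.norm).congr
    (Eventually.of_forall fun y => ?_)
  have : (1 + ‖y‖) ≠ 0 := by positivity
  simp only [Pi.mul_apply]
  rw [norm_smul, Real.norm_of_nonneg (by positivity), ← inv_one_add_norm_mul hn]
  field_simp

lemma WeightedL2.integrable_gradPotential_smul (hn : 2 ≤ n) {f : Pos n → Spinor n}
    (hf : WeightedL2 f) {φ : Pos n → ℝ} (hφ : IsTestFunction φ) (j : Fin n) :
    Integrable (fun y => gradPotential φ j y • f y) volume := by
  obtain ⟨C, hC0, hC⟩ := exists_abs_gradPotential_le hn hφ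
  refine ((hf.integrable_bound hn).const_mul C).mono'
    ((contDiff_gradPotential hn hφ j).continuous.aestronglyMeasurable.smul
      hf.aestronglyMeasurable) (Eventually.of_forall fun y => ?_)
  rw [norm_smul, Real.norm_eq_abs, ← mul_assoc]
  gcongr
  exact hC j y

lemma WeightedL2.integrable_prod (hn : 2 ≤ n) (α : Fin (n + 1) → Mat n) {f : Pos n → Spinor n}
    (hf : WeightedL2 f) {φ : Pos n → ℝ} (hφ : IsTestFunction φ) :
    Integrable (fun p : Pos n × Pos n =>
        φ p.1 • toEuclideanLin (green α (p.1 - p.2)) (f p.2))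
      ((volume : Measure (Pos n)).prod volume) := by
  obtain ⟨C, hC0, hC⟩ := exists_rieszPotential_le hn hφ
  have hG : Integrable (fun p : Pos n × Pos n =>
      (|φ p.1| * rieszKernel (p.1 - p.2)) * ‖f p.2‖)
      ((volume : Measure (Pos n)).prod volume) := by
    have hm : AEStronglyMeasurable (fun p : Pos n × Pos n =>
        (|φ p.1| * rieszKernel (p.1 - p.2)) * ‖f p.2‖)
        ((volume : Measure (Pos n)).prod volume) := by
      refine AEStronglyMeasurable.mul (Measurable.aestronglyMeasurable ?_)
        hf.aestronglyMeasurable.comp_snd.norm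
      exact (hφ.continuous.abs.measurable.comp measurable_fst).mul
        (measurable_rieszKernel.comp (measurable_fst.sub measurable_snd))
    have hsymm : ∀ x y : Pos n, rieszKernel (x - y) = rieszKernel (y - x) := fun x y => by
      rw [← rieszKernel_neg, neg_sub]
    rw [integrable_prod_iff' hm]
    refine ⟨Eventually.of_forall fun y => ?_, ?_⟩
    · simp only [hsymm _ y]
      exact (integrable_mul_rieszKernel_sub hn hφ y).mul_const _
    · refine ((hf.integrable_bound hn).const_mul C).mono' hm.norm.prod_swap.integral_prod_right'
        (Eventually.of_forall fun y => ?_)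
      have h1 : ∀ x, ‖|φ x| * rieszKernel (x - y) * ‖f y‖‖
          = |φ x| * rieszKernel (y - x) * ‖f y‖ := fun x => by
        rw [Real.norm_of_nonneg (mul_nonneg (mul_nonneg (abs_nonneg _) (rieszKernel_nonneg _))
          (norm_nonneg _)), hsymm]
      simp only [h1]
      rw [integral_mul_const, norm_mul, norm_norm, ← mul_assoc, Real.norm_of_nonneg
        (integral_nonneg fun x => mul_nonneg (abs_nonneg _) (rieszKernel_nonneg _))]
      gcongr
      exact hC y
  refine (hG.const_mul (greenBound α)).mono' ?_ (Eventually.of_forall fun p => ?_)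
  · exact (hφ.continuous.measurable.comp measurable_fst).aestronglyMeasurable.smul
      (aestronglyMeasurable_green_sub hn α hf.aestronglyMeasurable)
  · rw [norm_smul, Real.norm_eq_abs]
    calc |φ p.1| * ‖toEuclideanLin (green α (p.1 - p.2)) (f p.2)‖
        ≤ |φ p.1| * (greenBound α * (rieszKernel (p.1 - p.2) * ‖f p.2‖)) := by
          gcongr
          exact norm_green_le hn α _ _
      _ = _ := by ring

lemma WeightedL2.integrable_smul_freeResolvent (hn : 2 ≤ n) (α : Fin (n + 1) → Mat n)
    {f : Pos n → Spinor n} (hf : WeightedL2 f) {φ : Pos n → ℝ} (hφ : IsTestFunction φ) :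
    Integrable (fun x => φ x • freeResolvent α f x) volume := by
  refine (hf.integrable_prod hn α hφ).integral_prod_left.congr (Eventually.of_forall fun x => ?_)
  simp only [freeResolvent]
  rw [integral_smul]

lemma exists_isTestFunction_eq_one_near (x₀ : Pos n) :
    ∃ χ : Pos n → ℝ, IsTestFunction χ ∧ ∀ x ∈ Metric.ball x₀ 1, χ x = 1 := by
  let b : ContDiffBump x₀ := ⟨1, 2, one_pos, one_lt_two⟩
  exact ⟨b, ⟨b.contDiff, b.hasCompactSupport⟩, fun x hx =>
    b.one_of_mem_closedBall (Metric.ball_subset_closedBall hx)⟩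

lemma WeightedL2.locallyIntegrable_freeResolvent (hn : 2 ≤ n) (α : Fin (n + 1) → Mat n)
    {f : Pos n → Spinor n} (hf : WeightedL2 f) :
    LocallyIntegrable (freeResolvent α f) volume := by
  intro x₀
  obtain ⟨χ, hχ, hχ1⟩ := exists_isTestFunction_eq_one_near x₀
  refine ⟨Metric.ball x₀ 1, Metric.ball_mem_nhds x₀ one_pos, ?_⟩
  refine (hf.integrable_smul_freeResolvent hn α hχ).integrableOn.congr_fun (fun x hx => ?_)
    Metric.isOpen_ball.measurableSet
  simp [hχ1 x hx]

lemma integral_toEuclideanLin (A : Mat n) {f : Pos n → Spinor n} (hf : Integrable f volume) :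
    ∫ x, toEuclideanLin A (f x) = toEuclideanLin A (∫ x, f x) :=
  (LinearMap.toContinuousLinearMap (toEuclideanLin A)).integral_comp_comm hf

lemma toEuclideanLin_real_smul (A : Mat n) (t : ℝ) (v : Spinor n) :
    toEuclideanLin A (t • v) = t • toEuclideanLin A v :=
  LinearMap.map_smul_of_tower _ t v

/-- The free resolvent is transposed onto the test function; the sign comes from the oddness of
the kernel. -/
lemma WeightedL2.integral_smul_freeResolvent (hn : 2 ≤ n) (α : Fin (n + 1) → Mat n)
    {f : Pos n → Spinor n} (hf : WeightedL2 f) {φ : Pos n → ℝ} (hφ : IsTestFunction φ) :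
    ∫ x, φ x • freeResolvent α f x
      = -((Complex.I / (sphereArea n : ℂ)) • ∑ j : Fin n,
          toEuclideanLin (α j.castSucc) (∫ y, gradPotential φ j y • f y)) := by
  have h1 : ∫ x, φ x • freeResolvent α f x
      = ∫ y, ∫ x, φ x • toEuclideanLin (green α (x - y)) (f y) := by
    rw [← integral_integral_swap (hf.integrable_prod hn α hφ)]
    simp only [freeResolvent, integral_smul]
  have h2 : ∀ y, ∫ x, φ x • toEuclideanLin (green α (x - y)) (f y)
      = -((Complex.I / (sphereArea n : ℂ)) • ∑ j : Fin n,
          toEuclideanLin (α j.castSucc) (gradPotential φ j y • f y)) := by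
    intro y
    have h3 : ∀ (j : Fin n) (x : Pos n), φ x * gradNewton j (x - y)
        = -(φ x * gradNewton j (y - x)) := fun j x => by
      rw [← neg_sub y x, gradNewton_neg, mul_neg]
    have h4 : ∀ j : Fin n, Integrable (fun x => φ x * gradNewton j (y - x)) volume := fun j => by
      have := hφ.compact.convolutionExists_left (ContinuousLinearMap.mul ℝ ℝ) hφ.continuous
        (locallyIntegrable_gradNewton hn j) y
      exact this
    have h5 : ∀ x, φ x • toEuclideanLin (green α (x - y)) (f y)
        = -((Complex.I / (sphereArea n : ℂ)) • ∑ j : Fin n,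
          (φ x * gradNewton j (y - x)) • toEuclideanLin (α j.castSucc) (f y)) := by
      intro x
      rw [toEuclideanLin_green hn, smul_comm, Finset.smul_sum, ← smul_neg,
        ← Finset.sum_neg_distrib]
      simp only [smul_smul, h3, neg_smul]
    simp only [h5]
    rw [integral_neg, integral_smul, integral_finsetSum _ fun j _ => (h4 j).smul_const _]
    simp only [integral_smul_const, toEuclideanLin_real_smul]
    rfl
  have h6 : ∀ j : Fin n, Integrable
      (fun y => toEuclideanLin (α j.castSucc) (gradPotential φ j y • f y)) volume := fun j =>
    (LinearMap.toContinuousLinearMap (toEuclideanLin (α j.castSucc))).integrable_comp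
      (hf.integrable_gradPotential_smul hn hφ j)
  rw [h1]
  simp only [h2]
  rw [integral_neg, integral_smul, integral_finsetSum _ fun j _ => h6 j]
  simp only [fun j : Fin n => integral_toEuclideanLin (α j.castSucc)
    (hf.integrable_gradPotential_smul hn hφ j)]

lemma sum_integral_gradPotential_smul (hn : 2 ≤ n) {f : Pos n → Spinor n}
    (hf : WeightedL2 f) {φ : Pos n → ℝ} (hφ : IsTestFunction φ) :
    ∑ j, ∫ y, gradPotential (partialDeriv j φ) j y • f y = sphereArea n • ∫ y, φ y • f y := by
  rw [← integral_finsetSum _ fun j _ =>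
    hf.integrable_gradPotential_smul hn (hφ.partialDeriv j) j, ← integral_smul]
  simp only [← Finset.sum_smul, sum_gradPotential_partialDeriv hn hφ, smul_smul]

lemma I_mul_I_div_sphereArea_smul (hn : 2 ≤ n) (v : Spinor n) :
    Complex.I • (Complex.I / (sphereArea n : ℂ)) • sphereArea n • v = -v := by
  have h : (sphereArea n : ℂ) ≠ 0 := by exact_mod_cast (sphereArea_pos hn).ne'
  rw [← Complex.coe_smul, smul_smul, smul_smul]
  have : Complex.I * (Complex.I / (sphereArea n : ℂ) * (sphereArea n : ℂ)) = -1 := by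
    rw [div_mul_cancel₀ _ h, Complex.I_mul_I]
  rw [← mul_assoc] at this
  rw [this, neg_one_smul]

/-- `-(H₀ - (0 + i0))⁻¹ f` solves `H₀ Ψ = -f` in the sense of distributions. -/
lemma IsDiracFamily.sum_integral_freeResolvent (hn : 2 ≤ n) {α : Fin (n + 1) → Mat n}
    (hα : IsDiracFamily α) {f : Pos n → Spinor n} (hf : WeightedL2 f) {φ : Pos n → ℝ}
    (hφ : IsTestFunction φ) :
    ∑ l : Fin n, Complex.I • toEuclideanLin (α l.castSucc)
      (∫ x, partialDeriv l φ x • freeResolvent α f x) = ∫ x, φ x • f x := by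
  simp only [fun l => hf.integral_smul_freeResolvent hn α (hφ.partialDeriv l)]
  simp only [map_neg, map_smul, map_sum, smul_neg, Finset.sum_neg_distrib, ← Finset.smul_sum]
  rw [hα.sum_symm (m := fun l j => ∫ y, gradPotential (partialDeriv l φ) j y • f y)
    (fun l j => by simp only [partialDeriv_gradPotential_symm hn hφ j l]),
    sum_integral_gradPotential_smul hn hf hφ, I_mul_I_div_sphereArea_smul hn, neg_neg]

/-- The free resolvent gains one derivative in `L²`. -/
lemma WeightedL2.gradMemL2_freeResolvent (hn : 2 ≤ n) (α : Fin (n + 1) → Mat n)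
    {f : Pos n → Spinor n} (hf : WeightedL2 f) : GradMemL2 (freeResolvent α f) := by
  intro l
  choose g hg hg' using fun j : Fin n => exists_transpose hn hf.memLp j l
  have hm : ∀ j : Fin n, MemLp (fun x => toEuclideanLin (α j.castSucc) (g j x)) 2 volume := fun j =>
    (LinearMap.toContinuousLinearMap (toEuclideanLin (α j.castSucc))).comp_memLp' (hg j)
  have hG : MemLp (fun x => (Complex.I / (sphereArea n : ℂ)) • ∑ j : Fin n,
      toEuclideanLin (α j.castSucc) (g j x)) 2 volume :=
    (memLp_finsetSum Finset.univ fun j _ => hm j).const_smul (Complex.I / (sphereArea n : ℂ))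
  refine ⟨_, ⟨hf.locallyIntegrable_freeResolvent hn α, hG.locallyIntegrable one_le_two,
    fun φ hφ => ?_⟩, hG⟩
  have hi : ∀ j, Integrable (fun x => φ x • g j x) volume := fun j =>
    memLp_one_iff_integrable.1 ((hg j).smul (hφ.memLp 2))
  have hi' : ∀ j : Fin n, Integrable
      (fun x => φ x • toEuclideanLin (α j.castSucc) (g j x)) volume := fun j => by
    simp only [← toEuclideanLin_real_smul]
    exact (LinearMap.toContinuousLinearMap (toEuclideanLin (α j.castSucc))).integrable_comp (hi j)
  rw [hf.integral_smul_freeResolvent hn α (hφ.partialDeriv l)]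
  simp only [fun j => hg' j φ hφ, ← integral_toEuclideanLin _ (hi _), toEuclideanLin_real_smul]
  rw [← integral_finsetSum _ fun j _ => hi' j, ← integral_smul]
  congr 2
  ext1 x
  rw [smul_comm (φ x), Finset.smul_sum (r := φ x)]

/-! ### Square-integrable zero-energy solutions are Green potentials -/

lemma integrable_real_smul {w : Pos n → ℝ} {Ψ : Pos n → Spinor n} (hw : MemLp w 2 volume)
    (hΨ : MemLp Ψ 2 volume) : Integrable (fun x => w x • Ψ x) volume :=
  memLp_one_iff_integrable.1 (hΨ.smul hw)

/-- A square-integrable solution may be tested with `gradPotential φ j`, although this function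
does not have compact support. -/
lemma IsZeroSolution.integral_gradPotential (hn : 2 ≤ n) {α : Fin (n + 1) → Mat n}
    {V : Pos n → Mat n} {Ψ : Pos n → Spinor n} (hΨ : IsZeroSolution α V Ψ)
    (hΨ2 : MemLp Ψ 2 volume) (hf : WeightedL2 fun x => toEuclideanLin (V x) (Ψ x))
    {φ : Pos n → ℝ} (hφ : IsTestFunction φ) (j : Fin n) :
    ∑ l : Fin n, Complex.I • toEuclideanLin (α l.castSucc)
        (∫ x, gradPotential (partialDeriv l φ) j x • Ψ x)
      + ∫ x, gradPotential φ j x • toEuclideanLin (V x) (Ψ x) = 0 := by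
  obtain ⟨χ, C, hχ⟩ := exists_isCutoffSequence (n := n)
  obtain ⟨C', hC'0, hC'⟩ := exists_abs_gradPotential_le hn hφ
  have hC0 : 0 ≤ C := (abs_nonneg _).trans (hχ.bound 0 0)
  let u : ℕ → Pos n → ℝ := fun k x => χ k x * gradPotential φ j x
  have hu : ∀ k, IsTestFunction (u k) := fun k => (hχ.test k).mul (contDiff_gradPotential hn hφ j)
  have hdu : ∀ k l x, partialDeriv l (u k) x
      = partialDeriv l (χ k) x * gradPotential φ j x
        + χ k x * gradPotential (partialDeriv l φ) j x := fun k l x => by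
    rw [partialDeriv_mul (hχ.test k) (contDiff_gradPotential hn hφ j),
      partialDeriv_gradPotential hn hφ]
  have hΨα : ∀ l : Fin n, MemLp (fun x => toEuclideanLin (α l.castSucc) (Ψ x)) 2 volume := fun l =>
    (LinearMap.toContinuousLinearMap (toEuclideanLin (α l.castSucc))).comp_memLp' hΨ2
  have hdw : ∀ l, MemLp (gradPotential (partialDeriv l φ) j) 2 volume := fun l =>
    memLp_gradPotential_partialDeriv hn hφ j l
  have hwf := hf.integrable_gradPotential_smul hn hφ j
  have hlim : Tendsto (fun k => ∫ x, ((∑ l : Fin n,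
        (Complex.I * (partialDeriv l (u k) x : ℂ)) • toEuclideanLin (α l.castSucc) (Ψ x))
      + u k x • toEuclideanLin (V x) (Ψ x))) atTop (𝓝 (∫ x, ((∑ l : Fin n,
        (Complex.I * (gradPotential (partialDeriv l φ) j x : ℂ)) •
          toEuclideanLin (α l.castSucc) (Ψ x))
      + gradPotential φ j x • toEuclideanLin (V x) (Ψ x)))) := by
    refine tendsto_integral_of_dominated_convergence (fun x => (∑ l : Fin n,
        (C * C' * ((1 + ‖x‖) ^ n)⁻¹ + C * ‖gradPotential (partialDeriv l φ) j x‖)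
          * ‖toEuclideanLin (α l.castSucc) (Ψ x)‖)
      + C * ‖gradPotential φ j x • toEuclideanLin (V x) (Ψ x)‖) ?_ ?_ ?_ ?_
    · intro k
      have h1 : ∀ l, AEStronglyMeasurable (fun x => Complex.I * (partialDeriv l (u k) x : ℂ))
          (volume : Measure (Pos n)) := fun l => by
        have := ((hu k).partialDeriv l).continuous
        exact Continuous.aestronglyMeasurable (by fun_prop)
      exact (Finset.aestronglyMeasurable_fun_sum _ fun l _ => (h1 l).smul (hΨα l).1).add
        ((hu k).continuous.aestronglyMeasurable.smul hf.aestronglyMeasurable)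
    · refine Integrable.add (integrable_finsetSum _ fun l _ => ?_) (hwf.norm.const_mul C)
      exact (((memLp_two_inv_one_add_norm_pow hn).const_mul (C * C')).add
        ((hdw l).norm.const_mul C)).integrable_mul (hΨα l).norm
    · intro k
      refine Eventually.of_forall fun x => (norm_add_le _ _).trans (add_le_add ?_ ?_)
      · refine (norm_sum_le _ _).trans (Finset.sum_le_sum fun l _ => ?_)
        rw [norm_smul, norm_mul, Complex.norm_I, one_mul, Complex.norm_real, hdu]
        refine mul_le_mul_of_nonneg_right ((norm_add_le _ _).trans (add_le_add ?_ ?_))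
          (norm_nonneg _)
        · rw [norm_mul, Real.norm_eq_abs, Real.norm_eq_abs]
          calc |partialDeriv l (χ k) x| * |gradPotential φ j x|
              ≤ (C * (1 + ‖x‖)⁻¹) * (C' * ((1 + ‖x‖) ^ (n - 1))⁻¹) := by
                gcongr
                · exact hχ.deriv_bound k l x
                · exact hC' j x
            _ = _ := by rw [mul_mul_mul_comm, inv_one_add_norm_mul hn]
        · rw [norm_mul]
          exact mul_le_mul_of_nonneg_right (hχ.bound k x) (norm_nonneg _)
      · simp only [u, mul_smul]
        rw [norm_smul]
        exact mul_le_mul_of_nonneg_right (hχ.bound k x) (norm_nonneg _)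
    · refine Eventually.of_forall fun x => Tendsto.add (tendsto_finsetSum _ fun l _ => ?_) ?_
      · have h1 : Tendsto (fun k => partialDeriv l (u k) x) atTop
            (𝓝 (gradPotential (partialDeriv l φ) j x)) := by
          simp only [hdu]
          simpa using ((hχ.deriv_tendsto l x).mul_const (gradPotential φ j x)).add
            ((hχ.tendsto_one x).mul_const (gradPotential (partialDeriv l φ) j x))
        exact (((Complex.continuous_ofReal.tendsto _).comp h1).const_mul Complex.I).smul_const _
      · have h1 : Tendsto (fun k => u k x) atTop (𝓝 (gradPotential φ j x)) := by
          simpa [u] using (hχ.tendsto_one x).mul_const (gradPotential φ j x)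
        exact h1.smul_const _
  simp only [fun k => hΨ.integral_eq (u k) (hu k)] at hlim
  have h0 := tendsto_nhds_unique hlim tendsto_const_nhds
  have hi : ∀ l, Integrable (fun x => gradPotential (partialDeriv l φ) j x • Ψ x) volume :=
    fun l => integrable_real_smul (hdw l) hΨ2
  have hi' : ∀ l : Fin n, Integrable (fun x =>
      (Complex.I * (gradPotential (partialDeriv l φ) j x : ℂ)) •
        toEuclideanLin (α l.castSucc) (Ψ x)) volume := fun l => by
    simp only [mul_smul, Complex.coe_smul]
    exact (integrable_real_smul (hdw l) (hΨα l)).smul Complex.I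
  rw [integral_add (integrable_finsetSum _ fun l _ => hi' l) hwf,
    integral_finsetSum _ fun l _ => hi' l] at h0
  rw [← h0]
  congr 1
  refine Finset.sum_congr rfl fun l _ => ?_
  simp only [mul_smul, Complex.coe_smul]
  rw [integral_smul, ← integral_toEuclideanLin _ (hi l)]
  simp only [toEuclideanLin_real_smul]

/-- A square-integrable solution of `H Ψ = 0` satisfies `Ψ = -(H₀ - (0 + i0))⁻¹ V Ψ`. -/
lemma IsZeroSolution.ae_eq_freeResolvent (hn : 2 ≤ n) {α : Fin (n + 1) → Mat n}
    (hα : IsDiracFamily α) {V : Pos n → Mat n} {Ψ : Pos n → Spinor n}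
    (hΨ : IsZeroSolution α V Ψ) (hΨ2 : MemLp Ψ 2 volume)
    (hf : WeightedL2 fun x => toEuclideanLin (V x) (Ψ x)) :
    Ψ =ᵐ[volume] fun x => -freeResolvent α (fun y => toEuclideanLin (V y) (Ψ y)) x := by
  have hloc := hf.locallyIntegrable_freeResolvent hn α
  have h := ae_eq_zero_of_integral_contDiff_smul_eq_zero (hΨ.locInt.add hloc) ?_
  · filter_upwards [h] with x hx
    exact eq_neg_of_add_eq_zero_left hx
  intro φ hφs hφc
  have hφ : IsTestFunction φ := ⟨hφs, hφc⟩
  have hi : ∀ j, Integrable (fun x => gradPotential (partialDeriv j φ) j x • Ψ x) volume :=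
    fun j => integrable_real_smul (memLp_gradPotential_partialDeriv hn hφ j j) hΨ2
  have hdiv : ∑ j, ∫ x, gradPotential (partialDeriv j φ) j x • Ψ x
      = sphereArea n • ∫ x, φ x • Ψ x := by
    rw [← integral_finsetSum _ fun j _ => hi j, ← integral_smul]
    simp only [← Finset.sum_smul, sum_gradPotential_partialDeriv hn hφ, smul_smul]
  have hsum : Complex.I • sphereArea n • (∫ x, φ x • Ψ x) + ∑ j : Fin n,
      toEuclideanLin (α j.castSucc)
        (∫ x, gradPotential φ j x • toEuclideanLin (V x) (Ψ x)) = 0 := by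
    rw [← hdiv, ← hα.sum_symm (m := fun j l => ∫ x, gradPotential (partialDeriv l φ) j x • Ψ x)
      (fun j l => by simp only [partialDeriv_gradPotential_symm hn hφ j l]), Finset.smul_sum,
      ← Finset.sum_add_distrib]
    refine Finset.sum_eq_zero fun j _ => ?_
    have := congrArg (toEuclideanLin (α j.castSucc))
      (hΨ.integral_gradPotential hn hΨ2 hf hφ j)
    simpa only [map_add, map_sum, map_smul, map_zero, Finset.smul_sum] using this
  have hφΨ : Integrable (fun x => φ x • Ψ x) volume :=
    integrable_real_smul (hφ.memLp 2) hΨ2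
  simp only [Pi.add_apply, smul_add]
  rw [integral_add hφΨ (hf.integrable_smul_freeResolvent hn α hφ),
    hf.integral_smul_freeResolvent hn α hφ, ← eq_neg_of_add_eq_zero_right hsum |>.symm]
  rw [smul_neg, neg_neg, smul_comm, I_mul_I_div_sphereArea_smul hn, add_neg_cancel]

/-! ### Lebesgue exponents of the decaying factors -/

lemma memLp_inv_one_add_norm_pow (hn : 2 ≤ n) (k : ℕ) {t : ℝ} (ht : 0 ≤ t)
    (htk : t < k / (n : ℝ)) :
    MemLp (fun x : Pos n => ((1 + ‖x‖)⁻¹) ^ k) (expInv t) volume := by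
  have hn0 : (0 : ℝ) < n := by exact_mod_cast (by omega : 0 < n)
  have hm : Measurable fun x : Pos n => ((1 + ‖x‖)⁻¹) ^ k := by fun_prop
  rcases ht.eq_or_lt with rfl | ht0
  · rw [expInv_zero]
    refine memLp_top_of_bound hm.aestronglyMeasurable 1 (Eventually.of_forall fun x => ?_)
    rw [Real.norm_of_nonneg (by positivity)]
    refine pow_le_one₀ (by positivity) (inv_le_one_of_one_le₀ ?_)
    linarith [norm_nonneg x]
  · rw [memLp_expInv_iff ht0]
    refine ⟨hm.aestronglyMeasurable, ?_⟩
    have hr : (n : ℝ) < k / t := by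
      rw [lt_div_iff₀ hn0] at htk
      rw [lt_div_iff₀ ht0]
      linarith
    have h := (integrable_one_add_norm (E := Pos n) (μ := volume) (r := k / t)
      (by rwa [finrank_euclideanSpace_fin])).lintegral_lt_top
    refine lt_of_eq_of_lt (lintegral_congr fun x => ?_) h
    rw [← ofReal_norm, Real.norm_of_nonneg (by positivity),
      ENNReal.ofReal_rpow_of_nonneg (by positivity) (by positivity), inv_pow,
      ← Real.rpow_natCast, ← Real.rpow_neg (by positivity), ← Real.rpow_mul (by positivity),
      neg_mul, mul_one_div]

/-- Multiplication by a factor that decays like `|x|^{-k}` raises the reciprocal exponent by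
less than `k / n`. -/
lemma memLp_of_norm_le_decay (hn : 2 ≤ n) {f g : Pos n → Spinor n} {C : ℝ} (k : ℕ)
    (hf : AEStronglyMeasurable f volume)
    (hfg : ∀ᵐ x, ‖f x‖ ≤ C * ((1 + ‖x‖)⁻¹) ^ k * ‖g x‖) {a b : ℝ} (hb : 0 ≤ b)
    (hg : MemLp g (expInv b) volume) (hba : b ≤ a) (hab : a < b + k / (n : ℝ)) :
    MemLp f (expInv a) volume := by
  have hw := memLp_inv_one_add_norm_pow hn k (sub_nonneg.2 hba) (by linarith)
  have := expInv_holder (sub_nonneg.2 hba) hb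
  rw [sub_add_cancel] at this
  refine MemLp.of_le_mul (c := C) (hg.smul hw) hf ?_
  filter_upwards [hfg] with x hx
  simp only [Pi.smul_apply']
  rw [norm_smul, Real.norm_of_nonneg (by positivity), ← mul_assoc]
  exact hx

lemma memLp_freeResolvent (hn : 2 ≤ n) (α : Fin (n + 1) → Mat n) {f : Pos n → Spinor n}
    {a₁ a₂ b : ℝ} (hf₁ : MemLp f (expInv a₁) volume) (hf₂ : MemLp f (expInv a₂) volume)
    (hb : 0 < b) (ha₁ : a₁ ≤ 1) (hb₁ : b < a₁ - 1 / n) (hb₂ : a₂ - 1 / n < b)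
    (hba : b ≤ a₂) : MemLp (fun x => -freeResolvent α f x) (expInv b) volume :=
  (memLp_of_le_rieszPotential hn ENNReal.ofReal_ne_top
    (aestronglyMeasurable_freeResolvent hn α hf₁.1) (enorm_freeResolvent_le hn α f) hf₁ hf₂ hb
    ha₁ hb₁ hb₂ hba).neg

lemma memLp_top_freeResolvent (hn : 2 ≤ n) (α : Fin (n + 1) → Mat n) {f : Pos n → Spinor n}
    {a₁ a₂ : ℝ} (hf₁ : MemLp f (expInv a₁) volume) (hf₂ : MemLp f (expInv a₂) volume)
    (ha₁ : a₁ < 1) (ha₂ : 0 < a₂) (hb₁ : 1 / (n : ℝ) < a₁) (hb₂ : a₂ < 1 / (n : ℝ)) :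
    MemLp (fun x => -freeResolvent α f x) ⊤ volume :=
  (memLp_top_of_le_rieszPotential hn ENNReal.ofReal_ne_top
    (aestronglyMeasurable_freeResolvent hn α hf₁.1) (enorm_freeResolvent_le hn α f) hf₁ hf₂
    ha₁ ha₂ hb₁ hb₂).neg

/-! ### The Birman–Schwinger kernel -/

/-- The source `V₁* Φ` of `zeroSolution α V Φ`. -/
def bsSource (V : Pos n → Mat n) (Φ : Pos n → Spinor n) (y : Pos n) : Spinor n :=
  toEuclideanLin (V₁ V y).conjTranspose (Φ y)

lemma zeroSolution_eq (α : Fin (n + 1) → Mat n) (V : Pos n → Mat n) (Φ : Pos n → Spinor n) :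
    zeroSolution α V Φ = fun x => -freeResolvent α (bsSource V Φ) x := rfl

lemma freeResolvent_congr (α : Fin (n + 1) → Mat n) {f g : Pos n → Spinor n}
    (h : f =ᵐ[volume] g) : freeResolvent α f = freeResolvent α g := by
  ext1 x
  exact integral_congr_ae (h.mono fun y hy => by simp only [hy])

lemma IsAdmissiblePotential.aestronglyMeasurable_bsSource {V : Pos n → Mat n}
    (hV : IsAdmissiblePotential V) {Φ : Pos n → Spinor n} (hΦ : AEStronglyMeasurable Φ volume) :
    AEStronglyMeasurable (bsSource V Φ) volume := by
  unfold bsSource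
  simp only [conjTranspose_V₁]
  exact aestronglyMeasurable_toEuclideanLin hV.aestronglyMeasurable_V₁ hΦ

lemma IsAdmissiblePotential.norm_bsSource_le {V : Pos n → Mat n}
    (hV : IsAdmissiblePotential V) (Φ : Pos n → Spinor n) :
    ∃ C, 0 ≤ C ∧ ∀ᵐ x, ‖bsSource V Φ x‖ ≤ C * ((1 + ‖x‖)⁻¹) ^ 1 * ‖Φ x‖ := by
  obtain ⟨C, hC0, hC⟩ := hV.exists_bounds
  refine ⟨C, hC0, ?_⟩
  filter_upwards [hC] with x hx
  rw [bsSource, conjTranspose_V₁, pow_one]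
  exact (hx (Φ x)).2.1

lemma weightedL2_of_norm_le {f g : Pos n → Spinor n} {C : ℝ}
    (hf : AEStronglyMeasurable f volume) (hg : MemLp g 2 volume)
    (h : ∀ᵐ x, ‖f x‖ ≤ C * (1 + ‖x‖)⁻¹ * ‖g x‖) : WeightedL2 f := by
  have hm : Measurable fun y : Pos n => 1 + ‖y‖ := by fun_prop
  refine MemLp.of_le_mul (c := C) hg (hm.aestronglyMeasurable.smul hf) ?_
  filter_upwards [h] with x hx
  have h0 : 0 < 1 + ‖x‖ := by positivity
  rw [norm_smul, Real.norm_of_nonneg h0.le]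
  calc (1 + ‖x‖) * ‖f x‖ ≤ (1 + ‖x‖) * (C * (1 + ‖x‖)⁻¹ * ‖g x‖) := by gcongr
    _ = C * ‖g x‖ := by field_simp

lemma IsAdmissiblePotential.weightedL2_bsSource {V : Pos n → Mat n}
    (hV : IsAdmissiblePotential V) {Φ : Pos n → Spinor n} (hΦ : MemLp Φ 2 volume) :
    WeightedL2 (bsSource V Φ) := by
  obtain ⟨C, -, hC⟩ := hV.norm_bsSource_le Φ
  simp only [pow_one] at hC
  exact weightedL2_of_norm_le (hV.aestronglyMeasurable_bsSource hΦ.1) hΦ hC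

lemma IsAdmissiblePotential.aestronglyMeasurable_apply {V : Pos n → Mat n}
    (hV : IsAdmissiblePotential V) {Ψ : Pos n → Spinor n} (hΨ : AEStronglyMeasurable Ψ volume) :
    AEStronglyMeasurable (fun x => toEuclideanLin (V x) (Ψ x)) volume :=
  aestronglyMeasurable_toEuclideanLin hV.aestronglyMeasurable hΨ

lemma IsAdmissiblePotential.norm_apply_le {V : Pos n → Mat n}
    (hV : IsAdmissiblePotential V) (Ψ : Pos n → Spinor n) :
    ∃ C, 0 ≤ C ∧ ∀ᵐ x, ‖toEuclideanLin (V x) (Ψ x)‖ ≤ C * ((1 + ‖x‖)⁻¹) ^ 2 * ‖Ψ x‖ := by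
  obtain ⟨C, hC0, hC⟩ := hV.exists_norm_le
  exact ⟨C ^ 2, by positivity, hC.mono fun x hx => hx (Ψ x)⟩

lemma IsAdmissiblePotential.weightedL2_apply {V : Pos n → Mat n}
    (hV : IsAdmissiblePotential V) {Ψ : Pos n → Spinor n} (hΨ : MemLp Ψ 2 volume) :
    WeightedL2 fun x => toEuclideanLin (V x) (Ψ x) := by
  obtain ⟨C, hC0, hC⟩ := hV.norm_apply_le Ψ
  refine weightedL2_of_norm_le (C := C) (hV.aestronglyMeasurable_apply hΨ.1) hΨ ?_
  filter_upwards [hC] with x hx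
  refine hx.trans ?_
  have h1 : (1 + ‖x‖)⁻¹ ≤ 1 := inv_le_one_of_one_le₀ (by linarith [norm_nonneg x])
  gcongr
  exact pow_le_of_le_one (by positivity) h1 two_ne_zero

section Kernel

variable {α : Fin (n + 1) → Mat n} {V : Pos n → Mat n} {Φ : L2 n}

/-- For `Φ` in the Birman–Schwinger kernel, `Φ = V₂ Ψ` with `Ψ` the function built from `Φ`. -/
lemma ae_eq_V₂_zeroSolution (hΦ : Φ ∈ bsKernel α V) :
    ∀ᵐ x, Φ x = toEuclideanLin (V₂ V x) (zeroSolution α V Φ x) := by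
  have h : ∀ᵐ x, Φ x + birmanSchwinger α V Φ x = 0 := hΦ
  filter_upwards [h] with x hx
  rw [eq_neg_of_add_eq_zero_left hx, zeroSolution, map_neg]
  rfl

lemma bsSource_ae_eq (hV : IsAdmissiblePotential V) (hΦ : Φ ∈ bsKernel α V) :
    bsSource V Φ =ᵐ[volume] fun x => toEuclideanLin (V x) (zeroSolution α V Φ x) := by
  filter_upwards [ae_eq_V₂_zeroSolution hΦ, hV.V₁_V₂_apply] with x h1 h2
  rw [bsSource]
  conv_lhs => rw [h1]
  exact h2 _

/-- The functions built from the Birman–Schwinger kernel solve `H Ψ = 0`. -/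
lemma isZeroSolution_zeroSolution (hn : 2 ≤ n) (hα : IsDiracFamily α)
    (hV : IsAdmissiblePotential V) (hΦ : Φ ∈ bsKernel α V) :
    IsZeroSolution α V (zeroSolution α V Φ) := by
  have hf := hV.weightedL2_bsSource (Lp.memLp Φ)
  refine ⟨?_, fun φ hφ => ?_⟩
  · rw [zeroSolution_eq]
    exact (hf.locallyIntegrable_freeResolvent hn α).neg
  have hi : ∀ l, Integrable
      (fun x => partialDeriv l φ x • freeResolvent α (bsSource V Φ) x) volume := fun l =>
    hf.integrable_smul_freeResolvent hn α (hφ.partialDeriv l)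
  have hpt : ∀ l : Fin n, ∀ x, (Complex.I * (partialDeriv l φ x : ℂ)) •
      toEuclideanLin (α l.castSucc) (zeroSolution α V Φ x)
      = -(Complex.I • toEuclideanLin (α l.castSucc)
          (partialDeriv l φ x • freeResolvent α (bsSource V Φ) x)) := by
    intro l x
    rw [zeroSolution_eq, map_neg, smul_neg, mul_smul, Complex.coe_smul, toEuclideanLin_real_smul]
  have hi' : ∀ l : Fin n, Integrable (fun x => (Complex.I * (partialDeriv l φ x : ℂ)) •
      toEuclideanLin (α l.castSucc) (zeroSolution α V Φ x)) volume := fun l => by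
    simp only [hpt]
    exact (((LinearMap.toContinuousLinearMap
      (toEuclideanLin (α l.castSucc))).integrable_comp (hi l)).smul Complex.I).neg
  have hφf : Integrable (fun x => φ x • bsSource V Φ x) volume :=
    integrable_real_smul (hφ.memLp 2) hf.memLp
  have hae : (fun x => φ x • toEuclideanLin (V x) (zeroSolution α V Φ x))
      =ᵐ[volume] fun x => φ x • bsSource V Φ x :=
    (bsSource_ae_eq hV hΦ).mono fun x hx => by simp only [hx]
  rw [integral_add (integrable_finsetSum _ fun l _ => hi' l) (hφf.congr hae.symm),
    integral_congr_ae hae, integral_finsetSum _ fun l _ => hi' l]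
  simp only [hpt, integral_neg, integral_smul, integral_toEuclideanLin _ (hi _)]
  rw [Finset.sum_neg_distrib, hα.sum_integral_freeResolvent hn hf hφ, neg_add_cancel]

lemma HasWeakPartialDeriv.neg {j : Fin n} {Ψ g : Pos n → Spinor n}
    (h : HasWeakPartialDeriv j Ψ g) :
    HasWeakPartialDeriv j (fun x => -Ψ x) (fun x => -g x) :=
  ⟨h.locInt.neg, h.locInt_deriv.neg, fun φ hφ => by
    simp only [smul_neg, integral_neg, h.integral_eq φ hφ]⟩

lemma GradMemL2.congr {Ψ Ψ' : Pos n → Spinor n} (h : GradMemL2 Ψ) (hae : Ψ =ᵐ[volume] Ψ') :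
    GradMemL2 Ψ' := by
  intro j
  obtain ⟨g, hg, hg2⟩ := h j
  refine ⟨g, ⟨hg.locInt.congr hae, hg.locInt_deriv, fun φ hφ => ?_⟩, hg2⟩
  rw [← hg.integral_eq φ hφ]
  exact integral_congr_ae (hae.mono fun x hx => by simp only [hx])

lemma gradMemL2_zeroSolution (hn : 2 ≤ n) (hV : IsAdmissiblePotential V) :
    GradMemL2 (zeroSolution α V Φ) := by
  intro j
  obtain ⟨g, hg, hg2⟩ :=
    (hV.weightedL2_bsSource (Lp.memLp Φ)).gradMemL2_freeResolvent hn α j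
  exact ⟨_, hg.neg, hg2.neg⟩

lemma memLp_bsSource (hn : 2 ≤ n) (hV : IsAdmissiblePotential V) {a : ℝ} (ha : 1 / 2 ≤ a)
    (ha' : a < 1 / 2 + 1 / n) : MemLp (bsSource V Φ) (expInv a) volume := by
  obtain ⟨C, -, hC⟩ := hV.norm_bsSource_le Φ
  refine memLp_of_norm_le_decay hn 1 (hV.aestronglyMeasurable_bsSource (Lp.memLp Φ).1) hC
    (b := 1 / 2) (by norm_num) ?_ ha (by simpa using ha')
  rw [expInv_half]
  exact Lp.memLp Φ

lemma memLp_apply (hn : 2 ≤ n) (hV : IsAdmissiblePotential V) {Ψ : Pos n → Spinor n} {a b : ℝ}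
    (hb : 0 ≤ b) (hΨ : MemLp Ψ (expInv b) volume) (hba : b ≤ a) (hab : a < b + 2 / n) :
    MemLp (fun x => toEuclideanLin (V x) (Ψ x)) (expInv a) volume := by
  obtain ⟨C, -, hC⟩ := hV.norm_apply_le Ψ
  exact memLp_of_norm_le_decay hn 2 (hV.aestronglyMeasurable_apply hΨ.1) hC hb hΨ hba
    (by exact_mod_cast hab)

lemma memLp_zeroSolution (hn : 2 ≤ n) (hV : IsAdmissiblePotential V) {b : ℝ}
    (hb : 1 / 2 - 1 / n < b) (hb' : b < 1 / 2) :
    MemLp (zeroSolution α V Φ) (expInv b) volume := by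
  have hn0 : (2 : ℝ) ≤ n := by exact_mod_cast hn
  have hn1 : 1 / (n : ℝ) ≤ 1 / 2 := by gcongr
  have hn2 : 0 < 1 / (n : ℝ) := by positivity
  exact memLp_freeResolvent hn α (a₁ := (b + 1 / 2 + 2 * (1 / n)) / 2) (a₂ := 1 / 2)
    (memLp_bsSource hn hV (by linarith) (by linarith))
    (memLp_bsSource hn hV le_rfl (by linarith)) (by linarith) (by linarith) (by linarith) hb
    hb'.le

/-- In dimension two the functions built from the Birman–Schwinger kernel are bounded: the local
singularity of the Riesz potential is controlled by the integrability of `V Ψ`, which is that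
of `Ψ`. -/
lemma memLp_top_zeroSolution_two (hn : n = 2) (hV : IsAdmissiblePotential V)
    (hΦ : Φ ∈ bsKernel α V) : MemLp (zeroSolution α V Φ) ⊤ volume := by
  have hn2 : 2 ≤ n := hn.ge
  have hcast : 1 / (n : ℝ) = 1 / 2 := by
    rw [hn]
    norm_num
  have h1 : MemLp (zeroSolution α V Φ) (expInv (1 / 4)) volume :=
    memLp_zeroSolution hn2 hV (by rw [hcast]; norm_num) (by norm_num)
  have h2 : MemLp (bsSource V Φ) (expInv (1 / 4)) volume :=
    (memLp_congr_ae (bsSource_ae_eq hV hΦ)).2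
      (memLp_apply hn2 hV (by norm_num) h1 le_rfl (by
        have : (0 : ℝ) < 2 / n := by
          rw [hn]
          norm_num
        linarith))
  exact memLp_top_freeResolvent hn2 α (a₁ := 3 / 4)
    (memLp_bsSource hn2 hV (by norm_num) (by rw [hcast]; norm_num)) h2 (by norm_num)
    (by norm_num) (by rw [hcast]; norm_num) (by rw [hcast]; norm_num)

/-- In dimension at least three the functions built from the Birman–Schwinger kernel are square
integrable. The decay of `V₁` alone only gives exponents slightly larger than `2`; since `V₁* Φ`
equals `V Ψ`, the decay of `V` then gives the exponent `2`. -/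
lemma memLp_two_zeroSolution (hn : 3 ≤ n) (hV : IsAdmissiblePotential V)
    (hΦ : Φ ∈ bsKernel α V) : MemLp (zeroSolution α V Φ) 2 volume := by
  have hn2 : 2 ≤ n := by omega
  have hn0 : (3 : ℝ) ≤ n := by exact_mod_cast hn
  have h3 : 1 / (n : ℝ) ≤ 1 / 3 := by gcongr
  have h0 : 0 < 1 / (n : ℝ) := by positivity
  have htwo : 2 / (n : ℝ) = 2 * (1 / n) := by ring
  have h1 : MemLp (zeroSolution α V Φ) (expInv (1 / 2 - 1 / 4 * (1 / n))) volume :=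
    memLp_zeroSolution hn2 hV (by linarith) (by linarith)
  have h2 : MemLp (bsSource V Φ) (expInv (1 / 2 + 3 / 2 * (1 / n))) volume :=
    (memLp_congr_ae (bsSource_ae_eq hV hΦ)).2
      (memLp_apply hn2 hV (by linarith) h1 (by linarith) (by linarith))
  have := memLp_freeResolvent hn2 α h2 (memLp_bsSource hn2 hV le_rfl (by linarith))
    (b := 1 / 2) (by norm_num) (by linarith) (by linarith) (by linarith) le_rfl
  rwa [expInv_half] at this

end Kernel

/-! ### Eigenfunctions and resonances -/

variable {α : Fin (n + 1) → Mat n} {V : Pos n → Mat n}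

lemma zeroSolution_zero {Φ : Pos n → Spinor n}
    (hΦ : Φ =ᵐ[volume] 0) : zeroSolution α V Φ = 0 := by
  have h : bsSource V Φ =ᵐ[volume] 0 := by
    filter_upwards [hΦ] with x hx
    simp [bsSource, hx]
  rw [zeroSolution_eq, freeResolvent_congr α h]
  ext1 x
  simp [freeResolvent]

/-- A nonzero element of the Birman–Schwinger kernel gives a nonzero function. -/
lemma zeroSolution_ne_zero {Φ : L2 n} (hΦ : Φ ∈ bsKernel α V) (hΦ0 : Φ ≠ 0) :
    ¬ zeroSolution α V Φ =ᵐ[volume] 0 := by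
  intro h
  refine hΦ0 (Lp.ext ?_)
  filter_upwards [h, ae_eq_V₂_zeroSolution hΦ, Lp.coeFn_zero (Spinor n) 2 volume] with x h1 h2 h3
  rw [h2, h1, h3]
  simp

/-- A zero-energy eigenfunction `Ψ` arises from the element `V₂ Ψ` of the Birman–Schwinger
kernel. -/
lemma IsZeroEigenfunction.exists_bsKernel (hn : 2 ≤ n) (hα : IsDiracFamily α)
    (hV : IsAdmissiblePotential V) {Ψ : Pos n → Spinor n} (hΨ : IsZeroEigenfunction α V Ψ) :
    ∃ Φ ∈ bsKernel α V, Φ ≠ 0 ∧ Ψ =ᵐ[volume] zeroSolution α V Φ := by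
  have hΨ2 := hΨ.mem_dom.1
  have hrep := hΨ.solution.ae_eq_freeResolvent hn hα hΨ2 (hV.weightedL2_apply hΨ2)
  have hΦ : MemLp (fun x => toEuclideanLin (V₂ V x) (Ψ x)) 2 volume := by
    obtain ⟨C, hC0, hC⟩ := hV.exists_bounds
    refine hΨ2.of_le_mul (c := C)
      (aestronglyMeasurable_toEuclideanLin hV.aestronglyMeasurable_V₂ hΨ2.1) ?_
    filter_upwards [hC] with x hx
    refine (hx (Ψ x)).2.2.trans ?_
    have h1 : (1 + ‖x‖)⁻¹ ≤ 1 := inv_le_one_of_one_le₀ (by linarith [norm_nonneg x])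
    gcongr
    exact mul_le_of_le_one_right hC0 h1
  have hsrc : bsSource V (hΦ.toLp _)
      =ᵐ[volume] fun y => toEuclideanLin (V y) (Ψ y) := by
    filter_upwards [hΦ.coeFn_toLp, hV.V₁_V₂_apply] with x h1 h2
    rw [bsSource, h1, h2]
  have hΨΦ : Ψ =ᵐ[volume] zeroSolution α V (hΦ.toLp _) := by
    rw [zeroSolution_eq, freeResolvent_congr α hsrc]
    exact hrep
  refine ⟨hΦ.toLp _, ?_, fun h0 => hΨ.ne_zero ?_, hΨΦ⟩
  · show ∀ᵐ x, _
    filter_upwards [hΦ.coeFn_toLp, hΨΦ] with x h1 h2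
    have h3 : freeResolvent α (bsSource V (hΦ.toLp _)) x = -Ψ x := by
      rw [h2, zeroSolution_eq, neg_neg]
    have h4 : birmanSchwinger α V (hΦ.toLp _) x
        = toEuclideanLin (V₂ V x) (freeResolvent α (bsSource V (hΦ.toLp _)) x) := rfl
    rw [h1, h4, h3, map_neg, add_neg_cancel]
  · refine hΨΦ.trans ?_
    rw [zeroSolution_zero]
    rw [h0]
    exact Lp.coeFn_zero _ _ _

/-- An element of the Birman–Schwinger kernel whose function is square integrable gives an
eigenfunction. -/
lemma isZeroEigenfunction_zeroSolution (hn : 2 ≤ n) (hα : IsDiracFamily α)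
    (hV : IsAdmissiblePotential V) {Φ : L2 n} (hΦ : Φ ∈ bsKernel α V) (hΦ0 : Φ ≠ 0)
    (h2 : MemLp (zeroSolution α V Φ) 2 volume) :
    IsZeroEigenfunction α V (zeroSolution α V Φ) :=
  ⟨⟨h2, gradMemL2_zeroSolution hn hV⟩, isZeroSolution_zeroSolution hn hα hV hΦ,
    zeroSolution_ne_zero hΦ hΦ0⟩

lemma zero_mem_bsKernel : (0 : L2 n) ∈ bsKernel α V := by
  have h := Lp.coeFn_zero (Spinor n) 2 (volume : Measure (Pos n))
  show ∀ᵐ x, _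
  filter_upwards [h] with x hx
  have h0 : freeResolvent α (bsSource V (0 : L2 n)) x = 0 := by
    have := congrFun (zeroSolution_zero (α := α) (V := V) h) x
    rwa [zeroSolution_eq, Pi.zero_apply, neg_eq_zero] at this
  have h1 : birmanSchwinger α V (0 : L2 n) x
      = toEuclideanLin (V₂ V x) (freeResolvent α (bsSource V (0 : L2 n)) x) := rfl
  rw [hx, h1, h0]
  simp

/-- Zero is a regular point exactly when the Birman–Schwinger kernel is trivial. -/
lemma isRegular_iff (hn : 2 ≤ n) (hα : IsDiracFamily α) (hV : IsAdmissiblePotential V) :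
    IsRegular α V ↔ bsKernel α V = {0} := by
  constructor
  · rintro ⟨he, hr⟩
    refine Set.eq_singleton_iff_unique_mem.2 ⟨zero_mem_bsKernel, fun Φ hΦ => ?_⟩
    by_contra hΦ0
    by_cases h2 : MemLp (zeroSolution α V Φ) 2 volume
    · exact he ⟨_, isZeroEigenfunction_zeroSolution hn hα hV hΦ hΦ0 h2⟩
    · exact hr ⟨_, ⟨Φ, hΦ, hΦ0, Filter.EventuallyEq.rfl⟩,
        isZeroSolution_zeroSolution hn hα hV hΦ, h2⟩
  · intro h
    have h0 : ∀ Φ ∈ bsKernel α V, Φ = 0 := fun Φ hΦ => by rwa [h] at hΦ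
    refine ⟨?_, ?_⟩
    · rintro ⟨Ψ, hΨ⟩
      obtain ⟨Φ, hΦ, hΦ0, -⟩ := hΨ.exists_bsKernel hn hα hV
      exact hΦ0 (h0 Φ hΦ)
    · rintro ⟨Ψ, ⟨Φ, hΦ, hΦ0, -⟩, -, -⟩
      exact hΦ0 (h0 Φ hΦ)

lemma exists_expInv_eq {q : ℝ≥0∞} (h0 : q ≠ 0) (ht : q ≠ ⊤) :
    ∃ b : ℝ, 0 < b ∧ q = expInv b ∧ b = 1 / q.toReal := by
  have hq := ENNReal.toReal_pos h0 ht
  refine ⟨1 / q.toReal, by positivity, ?_, rfl⟩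
  rw [expInv, one_div, ENNReal.ofReal_inv_of_pos hq, inv_inv, ENNReal.ofReal_toReal ht]

/-- In dimension two the functions built from the Birman–Schwinger kernel lie in `L^q` for all
`q > 2`. -/
lemma memLp_zeroSolution_two (hn : n = 2) (hV : IsAdmissiblePotential V) {Φ : L2 n}
    (hΦ : Φ ∈ bsKernel α V) {q : ℝ≥0∞} (hq : 2 < q) :
    MemLp (zeroSolution α V Φ) q volume := by
  rcases eq_or_ne q ⊤ with rfl | hqt
  · exact memLp_top_zeroSolution_two hn hV hΦ
  · obtain ⟨b, hb0, rfl, hb⟩ := exists_expInv_eq (pos_of_gt hq).ne' hqt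
    have h2 := ENNReal.toReal_strict_mono hqt hq
    rw [ENNReal.toReal_ofNat] at h2
    refine memLp_zeroSolution hn.ge hV ?_ ?_
    · rw [hn]
      norm_num
      exact hb0
    · rw [hb]
      exact one_div_lt_one_div_of_lt two_pos h2

/-- The exponents of an eigenfunction that follow from square integrability and the decay of the
potential. -/
lemma IsZeroEigenfunction.memLp_expInv (hn : 2 ≤ n) (hα : IsDiracFamily α)
    (hV : IsAdmissiblePotential V) {Ψ : Pos n → Spinor n} (hΨ : IsZeroEigenfunction α V Ψ)
    {a b : ℝ} (hb0 : 0 < b) (ha : a ≤ 1) (ha' : a < 1 / 2 + 2 / n) (hb : 1 / 2 - 1 / n < b)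
    (hba : b < a - 1 / n) : MemLp Ψ (expInv b) volume := by
  have hΨ2 := hΨ.mem_dom.1
  have hn0 : (2 : ℝ) ≤ n := by exact_mod_cast hn
  have h0 : 0 < 1 / (n : ℝ) := by positivity
  have hVΨ : ∀ c : ℝ, 1 / 2 ≤ c → c < 1 / 2 + 2 / n →
      MemLp (fun x => toEuclideanLin (V x) (Ψ x)) (expInv c) volume := fun c hc hc' =>
    memLp_apply hn hV (by norm_num : (0 : ℝ) ≤ 1 / 2) (by rwa [expInv_half]) hc hc'
  refine (memLp_congr_ae
    (hΨ.solution.ae_eq_freeResolvent hn hα hΨ2 (hV.weightedL2_apply hΨ2))).2 ?_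
  refine memLp_freeResolvent hn α (hVΨ a (by linarith) ha')
    (hVΨ (max (1 / 2) b) (le_max_left _ _) (max_lt ?_ ?_)) hb0 ha hba ?_ (le_max_right _ _)
  · have : 0 < 2 / (n : ℝ) := by positivity
    linarith
  · linarith
  · rcases max_cases (1 / 2 : ℝ) b with h | h <;> linarith [h.1]

lemma IsZeroEigenfunction.memLp_three (hn : n = 3) (hα : IsDiracFamily α)
    (hV : IsAdmissiblePotential V) {Ψ : Pos n → Spinor n} (hΨ : IsZeroEigenfunction α V Ψ)
    {q : ℝ≥0∞} (hq : 3 / 2 < q) : MemLp Ψ q volume := by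
  have hn2 : 2 ≤ n := by omega
  have hn3 : (n : ℝ) = 3 := by
    rw [hn]
    norm_num
  have hΨ2 := hΨ.mem_dom.1
  have hrep := hΨ.solution.ae_eq_freeResolvent hn2 hα hΨ2 (hV.weightedL2_apply hΨ2)
  have hmid : ∀ b : ℝ, 1 / 6 < b → b < 2 / 3 → MemLp Ψ (expInv b) volume := fun b hb hb' =>
    hΨ.memLp_expInv hn2 hα hV (a := 1) (by linarith) le_rfl (by rw [hn3]; norm_num)
      (by rw [hn3]; linarith) (by rw [hn3]; linarith)
  -- the exponent `5` exceeds the dimension, so `V Ψ ∈ L⁵` bounds the part of the Riesz potential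
  -- near `x`
  have h5 : MemLp (fun x => toEuclideanLin (V x) (Ψ x)) (expInv (1 / 5)) volume :=
    memLp_apply hn2 hV (by norm_num) (hmid (1 / 5) (by norm_num) (by norm_num)) le_rfl
      (by rw [hn3]; norm_num)
  have hVΨ : ∀ c : ℝ, 1 / 2 ≤ c → c ≤ 1 →
      MemLp (fun x => toEuclideanLin (V x) (Ψ x)) (expInv c) volume := fun c hc hc' =>
    memLp_apply hn2 hV (by norm_num : (0 : ℝ) ≤ 1 / 2) (by rwa [expInv_half]) hc
      (by rw [hn3]; linarith)
  rcases eq_or_ne q ⊤ with rfl | hqt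
  · refine (memLp_congr_ae hrep).2 ?_
    exact memLp_top_freeResolvent hn2 α (hVΨ (1 / 2) le_rfl (by norm_num)) h5 (by norm_num)
      (by norm_num) (by rw [hn3]; norm_num) (by rw [hn3]; norm_num)
  · obtain ⟨b, hb0, rfl, hb⟩ := exists_expInv_eq (pos_of_gt hq).ne' hqt
    have h2 := ENNReal.toReal_strict_mono hqt hq
    rw [ENNReal.toReal_div, ENNReal.toReal_ofNat, ENNReal.toReal_ofNat] at h2
    have hb23 : b < 2 / 3 := by
      rw [hb]
      exact (one_div_lt_one_div_of_lt (by norm_num) h2).trans_eq (by norm_num)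
    rcases lt_or_ge (1 / 6) b with h6 | h6
    · exact hmid b h6 hb23
    · refine (memLp_congr_ae hrep).2 ?_
      exact memLp_freeResolvent hn2 α (hVΨ 1 (by norm_num) le_rfl) h5 hb0 le_rfl
        (by rw [hn3]; linarith) (by rw [hn3]; linarith) (by linarith)

lemma IsZeroEigenfunction.memLp_of_four_le (hn : 4 ≤ n) (hα : IsDiracFamily α)
    (hV : IsAdmissiblePotential V) {Ψ : Pos n → Spinor n} (hΨ : IsZeroEigenfunction α V Ψ)
    {b : ℝ} (hb : 1 / 2 - 1 / n < b) (hb' : b < 1 / 2 + 1 / n) :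
    MemLp Ψ (expInv b) volume := by
  have hn0 : (4 : ℝ) ≤ n := by exact_mod_cast hn
  have h0 : 1 / (n : ℝ) ≤ 1 / 4 := by gcongr
  have htwo : 2 / (n : ℝ) = 2 * (1 / n) := by ring
  exact hΨ.memLp_expInv (by omega) hα hV (a := (b + 1 / n + (1 / 2 + 2 / n)) / 2) (by linarith)
    (by linarith) (by linarith) hb (by linarith)

lemma IsZeroEigenfunction.memLp_four (hn : n = 4) (hα : IsDiracFamily α)
    (hV : IsAdmissiblePotential V) {Ψ : Pos n → Spinor n} (hΨ : IsZeroEigenfunction α V Ψ)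
    {q : ℝ≥0∞} (hq : 4 / 3 < q) (hq' : q < 4) : MemLp Ψ q volume := by
  have hqt : q ≠ ⊤ := (hq'.trans (by simp)).ne
  have hn4 : (n : ℝ) = 4 := by
    rw [hn]
    norm_num
  have h1 := ENNReal.toReal_strict_mono hqt hq
  have h2 := ENNReal.toReal_strict_mono (by simp) hq'
  rw [ENNReal.toReal_div, ENNReal.toReal_ofNat, ENNReal.toReal_ofNat] at h1
  rw [ENNReal.toReal_ofNat] at h2
  obtain ⟨b, hb0, rfl, hb⟩ := exists_expInv_eq (pos_of_gt hq).ne' hqt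
  refine hΨ.memLp_of_four_le hn.ge hα hV ?_ ?_
  · rw [hb, hn4]
    exact lt_of_eq_of_lt (by norm_num) (one_div_lt_one_div_of_lt (by linarith) h2)
  · rw [hb, hn4]
    exact (one_div_lt_one_div_of_lt (by norm_num) h1).trans_eq (by norm_num)

lemma IsZeroEigenfunction.memLp_of_five_le (hn : 5 ≤ n) (hα : IsDiracFamily α)
    (hV : IsAdmissiblePotential V) {Ψ : Pos n → Spinor n} (hΨ : IsZeroEigenfunction α V Ψ)
    {q : ℝ} (hq : 2 * (n : ℝ) / ((n : ℝ) + 2) < q) (hq' : q < 2 * (n : ℝ) / ((n : ℝ) - 2)) :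
    MemLp Ψ (ENNReal.ofReal q) volume := by
  have hn0 : (5 : ℝ) ≤ n := by exact_mod_cast hn
  have hn2 : 0 < (n : ℝ) - 2 := by linarith
  have hpos : 0 < 2 * (n : ℝ) / ((n : ℝ) + 2) := by positivity
  have hq0 : 0 < q := hpos.trans hq
  have h : ENNReal.ofReal q = expInv (1 / q) := by
    rw [expInv, one_div, ENNReal.ofReal_inv_of_pos hq0, inv_inv]
  rw [h]
  refine hΨ.memLp_of_four_le (by omega) hα hV ?_ ?_
  · refine lt_of_eq_of_lt ?_ (one_div_lt_one_div_of_lt hq0 hq')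
    field_simp
  · refine (one_div_lt_one_div_of_lt hpos hq).trans_eq ?_
    field_simp

end

end MasslessDirac

theorem theorem3p4 (n : ℕ) (hn : 2 ≤ n)
    (α : Fin (n + 1) → MasslessDirac.Mat n) (hα : MasslessDirac.IsDiracFamily α)
    (V : MasslessDirac.Pos n → MasslessDirac.Mat n)
    (hV : MasslessDirac.IsAdmissiblePotential V) :
    -- two dimensions: four mutually exclusive cases, and the bounds
    (n = 2 →
      ((MasslessDirac.IsRegular α V ∧
          ¬ MasslessDirac.IsZeroResonance α V ∧ ¬ MasslessDirac.IsZeroEigenvalue α V) ∨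
        (¬ MasslessDirac.IsRegular α V ∧
          MasslessDirac.IsZeroResonance α V ∧ ¬ MasslessDirac.IsZeroEigenvalue α V) ∨
        (¬ MasslessDirac.IsRegular α V ∧
          ¬ MasslessDirac.IsZeroResonance α V ∧ MasslessDirac.IsZeroEigenvalue α V) ∨
        (¬ MasslessDirac.IsRegular α V ∧
          MasslessDirac.IsZeroResonance α V ∧ MasslessDirac.IsZeroEigenvalue α V)) ∧
      (∀ Ψ, MasslessDirac.IsResonanceFunction α V Ψ →
        (∀ q : ℝ≥0∞, 2 < q → MemLp Ψ q volume) ∧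
          MasslessDirac.GradMemL2 Ψ ∧ ¬ MemLp Ψ 2 volume) ∧
      (∀ Ψ, MasslessDirac.IsZeroEigenfunction α V Ψ →
        ∀ q : ℝ≥0∞, 2 ≤ q → MemLp Ψ q volume)) ∧
    -- three and more dimensions: no resonances, two mutually exclusive cases, and the bounds
    (3 ≤ n →
      (∀ Φ ∈ MasslessDirac.bsKernel α V,
        MasslessDirac.IsZeroSolution α V (MasslessDirac.zeroSolution α V Φ) ∧
          MasslessDirac.MemW12 (MasslessDirac.zeroSolution α V Φ)) ∧
      ¬ MasslessDirac.IsZeroResonance α V ∧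
      ((MasslessDirac.IsRegular α V ∧ ¬ MasslessDirac.IsZeroEigenvalue α V) ∨
        (¬ MasslessDirac.IsRegular α V ∧ MasslessDirac.IsZeroEigenvalue α V)) ∧
      (∀ Ψ, MasslessDirac.IsZeroEigenfunction α V Ψ →
        (n = 3 → ∀ q : ℝ≥0∞, 3 / 2 < q → MemLp Ψ q volume) ∧
        (n = 4 → ∀ q : ℝ≥0∞, 4 / 3 < q → q < 4 → MemLp Ψ q volume) ∧
        (5 ≤ n → ∀ q : ℝ, 2 * (n : ℝ) / ((n : ℝ) + 2) < q → q < 2 * (n : ℝ) / ((n : ℝ) - 2) →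
          MemLp Ψ (ENNReal.ofReal q) volume))) ∧
    -- all dimensions: regularity in terms of the Birman–Schwinger kernel
    (MasslessDirac.IsRegular α V ↔ MasslessDirac.bsKernel α V = {0}) := by
  refine ⟨fun h2 => ⟨?_, fun Ψ hΨ => ?_, fun Ψ hΨ q hq => ?_⟩, fun h3 => ?_,
    MasslessDirac.isRegular_iff hn hα hV⟩
  · simp only [MasslessDirac.IsRegular]
    tauto
  · obtain ⟨Φ, hΦ, -, hae⟩ := hΨ.built
    exact ⟨fun q hq => (memLp_congr_ae hae).2 (MasslessDirac.memLp_zeroSolution_two h2 hV hΦ hq),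
      (MasslessDirac.gradMemL2_zeroSolution hn hV).congr hae.symm, hΨ.not_memLp⟩
  · rcases hq.eq_or_lt with rfl | hq
    · exact hΨ.mem_dom.1
    · obtain ⟨Φ, hΦ, -, hae⟩ := hΨ.exists_bsKernel hn hα hV
      exact (memLp_congr_ae hae).2 (MasslessDirac.memLp_zeroSolution_two h2 hV hΦ hq)
  · have hres : ¬ MasslessDirac.IsZeroResonance α V := by
      rintro ⟨Ψ, ⟨Φ, hΦ, -, hae⟩, -, hnot⟩
      exact hnot ((memLp_congr_ae hae).2 (MasslessDirac.memLp_two_zeroSolution h3 hV hΦ))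
    refine ⟨fun Φ hΦ => ⟨MasslessDirac.isZeroSolution_zeroSolution hn hα hV hΦ,
      MasslessDirac.memLp_two_zeroSolution h3 hV hΦ,
      MasslessDirac.gradMemL2_zeroSolution hn hV⟩, hres, ?_, fun Ψ hΨ =>
      ⟨fun h q hq => hΨ.memLp_three h hα hV hq, fun h q hq hq' => hΨ.memLp_four h hα hV hq hq',
        fun h q hq hq' => hΨ.memLp_of_five_le h hα hV hq hq'⟩⟩
    simp only [MasslessDirac.IsRegular]
    tauto
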